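/- Consider a classical gas of massless particles with $\lambda\varphi^4$ interaction, in natural units and in the equilibrium rest frame. Momenta are $p=(p^1,p^2,p^3)\in\mathbb{R}^3$, with energy $p^0=|p|$, and the equilibrium distribution is $f^{\rm eq}_p=e^{\alpha-\beta p^0}$ with $\alpha\in\mathbb{R}$, $\beta>0$. Scattering is isotropic in the center-of-momentum frame with total cross-section $\sigma(s)=g/s$, $g>0$, where $s=(p^0+p'^0)^2-|p+p'|^2$, and the linearized Boltzmann collision operator is $$L\phi_p=\int\frac{d^3p'}{(2\pi)^3p'^0}\,f^{\rm eq}_{p'}\,\frac{s\,\sigma(s)}{2}\int_{S^2}\frac{d\omega}{4\pi}\,\big(\phi_q+\phi_{q'}-\phi_p-\phi_{p'}\big),$$ where $q$ and $q'=p+p'-q$ are the outgoing momenta when the first outgoing particle has direction $\omega$ in the center-of-momentum frame. Let $\mathcal H=L^2(\mathbb{R}^3,f^{\rm eq}_p\,d^3p/(2\pi)^3)$ (complex-valued), $\mathcal H_{\rm hy}=\mathrm{span}\{1,p^0,p^1,p^2,p^3\}$ and $\mathcal H_{\text{non-hy}}=\mathcal H_{\rm hy}^\perp$. Consider $(p^0)^{-1}L$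 on its natural domain $D=\{\phi\in\mathcal H:(p^0)^{-1}L\phi\in\mathcal H\}$. Let $L^{(5)}_n$ be the generalized Laguerre polynomials, let $\phi^{(n)}_p=L^{(5)}_n(\beta p^0)\,p^2p^3$ for $n\ge 0$ (where $p^2,p^3$ are components of the momentum), and let $\mathcal M=\int \frac{d^3p}{(2\pi)^3p^0}f^{\rm eq}_p$. Then: 1. $(p^0)^{-1}L$ is self-adjoint on $\mathcal H$, and it maps $D\cap\mathcal H_{\text{non-hy}}$ into $\mathcal H_{\text{non-hy}}$. 2. $L\phi^{(n)}=\chi_{n2}\,\phi^{(n)}$ with $\chi_{n2}=-\frac{g\mathcal M}{2}\,\frac{n+1}{n+3}$, for all $n\ge0$. 3. For all $n\ge 0$, $\phi^{(n)}$ is a non-zero element of $\mathcal H_{\text{non-hy}}\cap D$, and $$\frac{\|(p^0)^{-1}L\phi^{(n)}\|}{\|\phi^{(n)}\|}\le\frac{g\mathcal M\beta}{2\sqrt{10}}\,\frac{1}{\sqrt{n+3}}.$$ 4. (Criterion (b)) $\displaystyle\inf_{0\ne\phi\in D\cap\mathcal H_{\text{non-hy}}}\frac{\|(p^0)^{-1}L\phi\|}{\|\phi\|}=0$.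 5. There are non-hydrodynamic excitations that survive as long as we want: for every $t>0$, $\sup\|\phi(t)\|/\|\phi(0)\|=1$, the supremum being over all (mild) solutions on $[0,\infty)$ of $\partial_t\phi=(p^0)^{-1}L\phi$ with $0\neq\phi(0)\in\mathcal H_{\text{non-hy}}$. 6. The non-hydrodynamic sector is gapless: for every $\varepsilon>0$, the spectrum of the restriction of $(p^0)^{-1}L$ to $\mathcal H_{\text{non-hy}}$ contains a point $z\ne0$ with $|z|<\varepsilon$. -/

import Mathlib

open MeasureTheory Set Filter Topology
open scoped InnerProductSpace

noncomputable section

namespace MasslessGas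

/-- Momentum space `ℝ³`. The components `p¹, p², p³` are `p 0, p 1, p 2`, and a massless particle
has energy `p⁰ = ‖p‖`. Natural units, equilibrium rest frame. -/
abbrev Mom : Type := EuclideanSpace ℝ (Fin 3)

/-- The equilibrium distribution `f^eq_p = exp (α - β p⁰)`. -/
def feq (α β : ℝ) (p : Mom) : ℝ := Real.exp (α - β * ‖p‖)

/-- The measure `f^eq_p d³p / (2π)³`. -/
def eqMeasure (α β : ℝ) : Measure Mom :=
  (volume : Measure Mom).withDensity
    (fun p => ENNReal.ofReal (feq α β p / (2 * Real.pi) ^ 3))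

/-- The Hilbert space `L²(ℝ³, f^eq_p d³p / (2π)³)` of complex perturbations `φ`. -/
abbrev State (α β : ℝ) : Type := Lp ℂ 2 (eqMeasure α β)

/-- The squared centre-of-momentum energy `s = (p⁰ + p'⁰)² - |p + p'|²`. -/
def mandelstam (p p' : Mom) : ℝ := (‖p‖ + ‖p'‖) ^ 2 - ‖p + p'‖ ^ 2

/-- The momentum `q` of the first outgoing particle in the collision `p + p' → q + q'` whose
scattering direction in the centre-of-momentum frame is the unit vector `ω`: the boost of
`(√s / 2) ω` to the frame where the total energy-momentum is `(E, P) = (p⁰ + p'⁰, p + p')`.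
(One has `q⁰ = (E + P·ω) / 2`.) The second one is `q' = p + p' - q`, with `q⁰ + q'⁰ = p⁰ + p'⁰`. -/
def outgoing (p p' : Mom) (ω : Metric.sphere (0 : Mom) 1) : Mom :=
  (1 / 2 : ℝ) • ((p + p') + Real.sqrt (mandelstam p p') • (ω : Mom)
    + (⟪p + p', (ω : Mom)⟫_ℝ / (‖p‖ + ‖p'‖ + Real.sqrt (mandelstam p p'))) • (p + p'))

/-- The total cross-section `g / s` of massless `λφ⁴` scattering at leading order; the scattering
is isotropic in the centre-of-momentum frame. -/
def crossSection (g s : ℝ) : ℝ := g / s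

/-- The linearised Boltzmann collision operator with the `λφ⁴` cross-section,
`(Lφ)(p) = ∫ d³p'/((2π)³ p'⁰) f^eq_{p'} (s σ(s) / 2) ∫ dω/(4π) (φ_q + φ_{q'} - φ_p - φ_{p'})`.
It is `∫ d³p'/((2π)³p'⁰) d³q/((2π)³q⁰) d³q'/((2π)³q'⁰) W f^eq_{p'} (φ_q + φ_{q'} - φ_p - φ_{p'})`
with transition rate `W = (2π)⁵ s σ(s) δ⁴(p + p' - q - q') / 2`, the delta function being resolved by
`δ⁴(p + p' - q - q') d³q/q⁰ d³q'/q'⁰ = dω/2`. -/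
def collision (α β g : ℝ) (φ : Mom → ℂ) (p : Mom) : ℂ :=
  ∫ p' : Mom,
    ((feq α β p' / ((2 * Real.pi) ^ 3 * ‖p'‖)
        * (mandelstam p p' * crossSection g (mandelstam p p') / 2) : ℝ) : ℂ) *
      (((4 * Real.pi)⁻¹ : ℝ) *
        ∫ ω, (φ (outgoing p p' ω) + φ (p + p' - outgoing p p' ω) - φ p - φ p')
          ∂((volume : Measure Mom).toSphere))

/-- The graph of the operator `(p⁰)⁻¹ L` on the Hilbert space, with its natural domain
`{φ | (p⁰)⁻¹ L φ ∈ L²}`: the pairs `(φ, χ)` with `χ = (p⁰)⁻¹ L φ` almost everywhere. -/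
def generator (α β g : ℝ) : Set (State α β × State α β) :=
  {x | (x.2 : Mom → ℂ) =ᵐ[eqMeasure α β]
    fun p => ((‖p‖⁻¹ : ℝ) : ℂ) * collision α β g (x.1 : Mom → ℂ) p}

/-- The operator with graph `G` equals its Hilbert-space adjoint. -/
def IsSelfAdjointGraph {α β : ℝ} (G : Set (State α β × State α β)) : Prop :=
  ∀ φ χ : State α β,
    (φ, χ) ∈ G ↔ ∀ x ∈ G, ⟪x.2, φ⟫_ℂ = ⟪x.1, χ⟫_ℂ

/-- The hydrodynamic states: the span of `1`, `p⁰`, `p¹`, `p²`, `p³`. -/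
def hydro (α β : ℝ) : Submodule ℂ (State α β) :=
  Submodule.span ℂ
    {ψ | (ψ : Mom → ℂ) =ᵐ[eqMeasure α β] (fun _ => 1) ∨
      (ψ : Mom → ℂ) =ᵐ[eqMeasure α β] (fun p => ((‖p‖ : ℝ) : ℂ)) ∨
      ∃ i : Fin 3, (ψ : Mom → ℂ) =ᵐ[eqMeasure α β] (fun p => ((p i : ℝ) : ℂ))}

/-- The non-hydrodynamic states. -/
def nonHydro (α β : ℝ) : Submodule ℂ (State α β) := (hydro α β)ᗮ

/-- The spectrum of `(p⁰)⁻¹ L` within the space of non-hydrodynamic states: `z` is outside it when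
`(p⁰)⁻¹ L - z`, restricted to that space, has an everywhere defined bounded inverse `R`. -/
def nonHydroSpectrum (α β g : ℝ) : Set ℂ :=
  {z | ¬ ∃ R : nonHydro α β →L[ℂ] nonHydro α β, ∀ x y : nonHydro α β,
    R y = x ↔ ((x : State α β), (y : State α β) + z • (x : State α β)) ∈ generator α β g}

/-- `u` is a (mild) solution on `[0, ∞)` of `∂ₜ φ = (p⁰)⁻¹ L φ`, that is `u t = e^{(p⁰)⁻¹ L t} u 0`:
it is continuous, `∫₀ᵗ u` lies in the domain of `(p⁰)⁻¹ L`, and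
`u t - u 0 = (p⁰)⁻¹ L ∫₀ᵗ u` for all `t ≥ 0`. -/
def IsEvolution (α β g : ℝ) (u : ℝ → State α β) : Prop :=
  ContinuousOn u (Ici 0) ∧
    ∀ t : ℝ, 0 ≤ t → ((∫ τ in (0 : ℝ)..t, u τ), u t - u 0) ∈ generator α β g

/-- The generalised Laguerre polynomial `L_n^{(a)}`, for natural `a`. -/
def laguerre (a n : ℕ) (x : ℝ) : ℝ :=
  ∑ k ∈ Finset.range (n + 1),
    (-1) ^ k * ((n + a).choose (n - k) : ℝ) * x ^ k / (k.factorial : ℝ)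

/-- The function `φ⁽ⁿ⁾ = L_n^{(5)}(β p⁰) p² p³` (the last factors being components of `p`). -/
def mode (β : ℝ) (n : ℕ) (p : Mom) : ℂ :=
  ((laguerre 5 n (β * ‖p‖) * p 1 * p 2 : ℝ) : ℂ)

/-- `M = ∫ d³p/((2π)³ p⁰) f^eq_p`. -/
def invDensity (α β : ℝ) : ℝ :=
  ∫ p : Mom, feq α β p / ((2 * Real.pi) ^ 3 * ‖p‖)

/-- The eigenvalue `χ_{n2} = -(g M / 2) (n + 1) / (n + 3)`. -/
def eigval (α β g : ℝ) (n : ℕ) : ℝ :=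
  -(g * invDensity α β / 2) * (((n : ℝ) + 1) / ((n : ℝ) + 3))

end MasslessGas

end

/-!
The operator `A = (p⁰)⁻¹ L` is studied in four steps.

**Self-adjointness and sign.** The momenta `(p, p', q, q')` of a collision carry a natural
measure, `collMeasure`, which is invariant under the exchange of the incoming and the outgoing
pair (`lintegral_collision_symm`, `measurePreserving_swap`): at fixed total momentum, both pairs
are parametrised by the invariant mass and by their directions in the rest frame, and the Jacobian
of this change of variables is symmetric (`lintegral_pair`). Since `s σ(s)` is constant, so is the
collision frequency, and `A` is multiplication by `-(g M / 2) / p⁰` plus a gain operator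
(`mem_generator_iff`). The gain operator is symmetric by detailed balance, and bounded by a Schur
test with the weight `(p⁰ p'⁰ / (q⁰ q'⁰))^(3/2)` (`exists_lintegral_weight_le`). Therefore `A` is
self-adjoint on its natural domain (`isSelfAdj_generator`). Symmetrising its quadratic form over
the four momenta shows that `A ≤ 0` (`isDissipative_generator`). The hydrodynamic states are
conserved in each collision, hence in the kernel, so `A` restricts to their orthogonal complement.

**Eigenfunctions of `L`.** For a null vector `(1, a)`, the component `q⁰ - a·q` of an outgoing
momentum is uniformly distributed between `0` and the total `(p⁰ - a·p) + (p'⁰ - a·p')`, by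
Archimedes' hat-box theorem in the rest frame (`integral_nullComp_outgoing_pow`). Averaging over
`p'` as well, the powers `(β (p⁰ - a·p) / 2)^m / m!` are mapped to `M / (m + 1)` times the sum of
all those of order at most `m` (`integral_nullPow_outgoing`). Projected to the harmonic `a² a³`
(Funk–Hecke), these powers become multiples of `(p⁰)^(m - 2) p² p³`. A triangular matrix with rows
`1 / (m + 1)` is diagonalised by alternating binomial sums, with eigenvalues `1 / (N + 1)`
(`sum_alternating_choose_mul_sum`), and for `N = n + 2` the sum is `φ⁽ⁿ⁾` (`realMode_eq_sum`). Two
outgoing particles and the loss term give `(g / 2) M (2 / (n + 3) - 1)`, which is the eigenvalue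
(`collision_mode`).

**Slow states.** `A φ⁽ⁿ⁾` is the eigenvalue times `L_n(β p⁰) p² p³ / p⁰`, and the ratio of the
squared norms of this function and of `φ⁽ⁿ⁾` is `β²` times a ratio of moments of `L_n²` with the
weights `x⁴ e^{-x}` and `x⁶ e^{-x}`, which is `1/(10 (n + 3))` (`moment_four_lag_sq`,
`moment_six_lag_sq`). It tends to `0`, so the `φ⁽ⁿ⁾` are approximate null vectors of `A`. They are
orthogonal to the hydrodynamic states by reflection symmetry. They are also orthogonal to the
whole kernel of `A`, as the functions `L_m(β p⁰) p² p³ / p⁰` in the range of `A` span the `φ⁽ⁿ⁾`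
(`inner_modeState_eq_zero_of_kernel`).

**Abstract conclusion.** For a self-adjoint `A ≤ 0`, the resolvent `(1 - A)⁻¹` is a positive
contraction (`exists_resolvent`, `resolvent_nonneg`), and its continuous functional calculus
separates the part of the spectrum of `A` near `0`. Approximate null vectors give mild solutions
in that part, which hardly decay (`exists_slow_mildSolution`), while no mild solution grows
(`IsMildSolution.norm_le`). If they are orthogonal to the kernel, then that part of the spectrum
is not only `0` (`exists_mem_relSpectrum`).
-/

/-! ### Self-adjoint dissipative relations on a Hilbert space -/

namespace SelfAdjointRelation

variable {H : Type*} [NormedAddCommGroup H] [InnerProductSpace ℂ H]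

/-- A subset of `H × H` that equals its Hilbert-space adjoint; for the graph of an operator this
says that the operator is self-adjoint. -/
def IsSelfAdj (G : Set (H × H)) : Prop :=
  ∀ φ χ : H, (φ, χ) ∈ G ↔ ∀ x ∈ G, ⟪x.2, φ⟫_ℂ = ⟪x.1, χ⟫_ℂ

/-- The relation `G` is dissipative: `Re ⟪x, A x⟫ ≤ 0` if `G` is the graph of `A`. -/
def IsDissipative (G : Set (H × H)) : Prop :=
  ∀ x ∈ G, (⟪x.1, x.2⟫_ℂ).re ≤ 0

variable {G : Set (H × H)}

theorem IsSelfAdj.symm (hG : IsSelfAdj G) {x y : H × H} (hx : x ∈ G) (hy : y ∈ G) :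
    ⟪x.2, y.1⟫_ℂ = ⟪x.1, y.2⟫_ℂ :=
  (hG y.1 y.2).1 hy x hx

/-- A self-adjoint relation, as a linear subspace of `H × H`. -/
def IsSelfAdj.submodule (hG : IsSelfAdj G) : Submodule ℂ (H × H) where
  carrier := G
  zero_mem' := (hG 0 0).2 fun x _ => by simp
  add_mem' {a b} ha hb := (hG _ _).2 fun x hx => by
    simp [hG.symm hx ha, hG.symm hx hb]
  smul_mem' c a ha := (hG _ _).2 fun x hx => by
    simp [hG.symm hx ha]

theorem IsSelfAdj.isClosed (hG : IsSelfAdj G) : IsClosed G := by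
  have : G = ⋂ x ∈ G, {y : H × H | ⟪x.2, y.1⟫_ℂ = ⟪x.1, y.2⟫_ℂ} := by
    ext ⟨φ, χ⟩
    simp only [mem_iInter, mem_ofPred_eq]
    exact hG φ χ
  rw [this]
  refine isClosed_biInter fun x _ => isClosed_eq ?_ ?_ <;> fun_prop

/-- The graph norm is controlled by `x - A x`. -/
theorem IsDissipative.norm_sq_le (hd : IsDissipative G) {x : H × H} (hx : x ∈ G) :
    ‖x.1‖ ^ 2 + ‖x.2‖ ^ 2 ≤ ‖x.1 - x.2‖ ^ 2 := by
  have h := hd x hx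
  have := @norm_sub_sq ℂ H _ _ _ x.1 x.2
  simp only [RCLike.re_to_complex] at this
  linarith

/-- Hille–Yosida in the self-adjoint case: `1 - A` has a contractive inverse `R`. The range of
`1 - A` is closed because `‖x‖² + ‖A x‖² ≤ ‖x - A x‖²`, and a vector `ξ` orthogonal to it satisfies
`A ξ = ξ`, so it vanishes. -/
theorem exists_resolvent [CompleteSpace H] (hG : IsSelfAdj G) (hd : IsDissipative G) :
    ∃ R : H →L[ℂ] H, ‖R‖ ≤ 1 ∧ (∀ y, (R y, R y - y) ∈ G) ∧ ∀ x ∈ G, R (x.1 - x.2) = x.1 := by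
  let S := hG.submodule
  have hSG : ∀ x, x ∈ S ↔ x ∈ G := fun x => Iff.rfl
  let T : S →ₗ[ℂ] H := (LinearMap.fst ℂ H H - LinearMap.snd ℂ H H) ∘ₗ S.subtype
  have hT : ∀ x : S, T x = (x : H × H).1 - (x : H × H).2 := fun x => rfl
  have hnorm : ∀ x : S, ‖(x : H × H).1‖ ^ 2 + ‖(x : H × H).2‖ ^ 2 ≤ ‖T x‖ ^ 2 :=
    fun x => hd.norm_sq_le x.2
  have hle1 : ∀ x : S, ‖(x : H × H).1‖ ≤ ‖T x‖ := fun x =>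
    le_of_sq_le_sq (by nlinarith [hnorm x, sq_nonneg ‖(x : H × H).2‖]) (norm_nonneg _)
  have hle2 : ∀ x : S, ‖(x : H × H).2‖ ≤ ‖T x‖ := fun x =>
    le_of_sq_le_sq (by nlinarith [hnorm x, sq_nonneg ‖(x : H × H).1‖]) (norm_nonneg _)
  have hlip : ∀ x : S, ‖x‖ ≤ ‖T x‖ := fun x => by
    change ‖(x : H × H)‖ ≤ _
    rw [Prod.norm_def]
    exact max_le (hle1 x) (hle2 x)
  have hinj : Function.Injective T := by
    rw [← LinearMap.ker_eq_bot, LinearMap.ker_eq_bot']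
    intro x hx
    have := hlip x
    rw [hx, norm_zero] at this
    exact norm_le_zero_iff.1 this
  have hSc : IsClosed (S : Set (H × H)) := hG.isClosed
  have : CompleteSpace S := hSc.completeSpace_coe
  have hTc : Continuous T := by
    have : Continuous fun x : S => (x : H × H).1 - (x : H × H).2 := by fun_prop
    exact this
  have hanti : AntilipschitzWith 1 T := by
    refine AntilipschitzWith.of_le_mul_dist fun x y => ?_
    rw [dist_eq_norm, dist_eq_norm, ← map_sub]
    simpa using hlip (x - y)
  have hclosed : IsClosed (Set.range T) :=
    hanti.isClosed_range (uniformContinuous_of_continuousAt_zero T hTc.continuousAt)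
  have hrange : LinearMap.range T = ⊤ := by
    have : CompleteSpace (LinearMap.range T) := by
      have : IsClosed ((LinearMap.range T : Submodule ℂ H) : Set H) := by
        rw [LinearMap.coe_range]; exact hclosed
      exact this.completeSpace_coe
    rw [← Submodule.orthogonal_eq_bot_iff, Submodule.eq_bot_iff]
    intro ξ hξ
    have h1 : (ξ, ξ) ∈ G := (hG ξ ξ).2 fun x hx => by
      have := (Submodule.mem_orthogonal _ _).1 hξ (T ⟨x, hx⟩) ⟨_, rfl⟩
      rw [hT, inner_sub_left, sub_eq_zero] at this
      exact this.symm
    have h2 := hd _ h1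
    have h3 : (⟪ξ, ξ⟫_ℂ).re = ‖ξ‖ ^ 2 := by
      rw [inner_self_eq_norm_sq_to_K]
      norm_cast
    rw [h3] at h2
    have : ‖ξ‖ = 0 := by nlinarith [norm_nonneg ξ]
    exact norm_eq_zero.1 this
  let e : S ≃ₗ[ℂ] H := LinearEquiv.ofBijective T ⟨hinj, LinearMap.range_eq_top.1 hrange⟩
  have he : ∀ y, T (e.symm y) = y := fun y => e.apply_symm_apply y
  let R : H →L[ℂ] H := LinearMap.mkContinuous
    (LinearMap.fst ℂ H H ∘ₗ S.subtype ∘ₗ e.symm.toLinearMap) 1 fun y => by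
      have := hle1 (e.symm y)
      rw [he] at this
      simpa using this
  have hR : ∀ y, R y = (e.symm y : H × H).1 := fun y => rfl
  refine ⟨R, LinearMap.mkContinuous_norm_le _ zero_le_one _, fun y => ?_, fun x hx => ?_⟩
  · have h1 := he y
    rw [hT] at h1
    have h2 : (R y, R y - y) = (e.symm y : H × H) := by
      rw [Prod.ext_iff]
      refine ⟨rfl, ?_⟩
      rw [hR]
      conv_lhs => rw [← h1]
      simp [h1]
      nth_rewrite 2 [← h1]
      abel
    rw [h2]
    exact (e.symm y).2
  · have : x.1 - x.2 = e ⟨x, hx⟩ := rfl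
    rw [hR, this, e.symm_apply_apply]

/-- The resolvent `R = (1 - A)⁻¹` is a positive operator, so that `A = 1 - R⁻¹` can be studied with
the continuous functional calculus of `R`. -/
theorem resolvent_nonneg [CompleteSpace H] (hG : IsSelfAdj G) (hd : IsDissipative G)
    {R : H →L[ℂ] H} (hR : ∀ y, (R y, R y - y) ∈ G) : 0 ≤ R := by
  rw [ContinuousLinearMap.nonneg_iff_isPositive, ContinuousLinearMap.isPositive_iff]
  have hs : ∀ y z, ⟪R y, z⟫_ℂ = ⟪y, R z⟫_ℂ := fun y z => by
    have := hG.symm (hR y) (hR z)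
    simp only [inner_sub_left, inner_sub_right] at this
    exact (sub_right_injective this).symm
  refine ⟨fun y z => hs y z, fun y => ?_⟩
  have h1 := hd _ (hR y)
  simp only [inner_sub_right, Complex.sub_re] at h1
  have h3 : (⟪R y, R y⟫_ℂ).re = ‖R y‖ ^ 2 := by
    rw [inner_self_eq_norm_sq_to_K]
    norm_cast
  have h4 : 0 ≤ (⟪R y, y⟫_ℂ).re := by nlinarith [sq_nonneg ‖R y‖]
  rw [RCLike.nonneg_iff]
  refine ⟨h4, ?_⟩
  have := inner_conj_symm (𝕜 := ℂ) (R y) y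
  rw [← hs] at this
  simpa using Complex.conj_eq_iff_im.1 this

theorem spectrum_resolvent_subset [CompleteSpace H] {R : H →L[ℂ] H} (h0 : 0 ≤ R) (h1 : ‖R‖ ≤ 1) :
    spectrum ℝ R ⊆ Icc 0 1 := fun x hx => by
  refine ⟨spectrum_nonneg_of_nonneg h0 hx, ?_⟩
  rcases subsingleton_or_nontrivial H with hH | hH
  · simp at hx
  · have := spectrum.norm_le_norm_of_mem hx
    exact (le_abs_self x).trans (this.trans h1)

/-- `cutQuot l x = c / (c - 1)` with `c = min x l`. In terms of the generator `A = 1 - R⁻¹`, it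
inverts `A` on the part of the spectrum that is at distance at least `l⁻¹ - 1` from `0`. -/
noncomputable def cutQuot (l x : ℝ) : ℝ := min x l / (min x l - 1)

/-- A function supported in `[l, ∞)`, that is on the part of the spectrum of `A = 1 - R⁻¹` near `0`,
with `x = cutQuot l x * (x - 1) + cutBump l x`. -/
noncomputable def cutBump (l x : ℝ) : ℝ := max 0 (x - l) / (1 - l)

variable {l : ℝ}

theorem continuous_cutQuot (hl : l < 1) : Continuous (cutQuot l) := by
  unfold cutQuot
  refine Continuous.div (by fun_prop) (by fun_prop) fun x => ?_
  have : min x l ≤ l := min_le_right _ _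
  linarith

theorem continuous_cutBump : Continuous (cutBump l) := by
  unfold cutBump
  fun_prop

theorem cutQuot_mul_add (hl : l < 1) (x : ℝ) :
    cutQuot l x * (x - 1) + cutBump l x = x := by
  unfold cutQuot cutBump
  have h1 : (1 : ℝ) - l ≠ 0 := by linarith
  have h2 : l - 1 ≠ 0 := by linarith
  rcases le_total x l with h | h
  · have h3 : x - 1 ≠ 0 := by linarith
    rw [min_eq_left h, max_eq_left (by linarith), div_mul_cancel₀ _ h3]
    simp
  · rw [min_eq_right h, max_eq_right (by linarith)]
    field_simp
    ring

theorem abs_cutQuot_le (hl : l < 1) {x : ℝ} (hx : 0 ≤ x) (hl0 : 0 ≤ l) :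
    |cutQuot l x| ≤ l / (1 - l) := by
  unfold cutQuot
  have h1 : 0 ≤ min x l := le_min hx hl0
  have h2 : min x l ≤ l := min_le_right _ _
  rw [abs_div, abs_of_nonneg h1, abs_of_neg (by linarith),
      div_le_div_iff₀ (by linarith) (by linarith)]
  nlinarith

section

variable [CompleteSpace H] {R : H →L[ℂ] H}

theorem norm_cfc_cutQuot_le (h0 : 0 ≤ R) (h1 : ‖R‖ ≤ 1) (hl : l < 1) (hl0 : 0 ≤ l) :
    ‖cfc (cutQuot l) R‖ ≤ l / (1 - l) := by
  refine norm_cfc_le (div_nonneg hl0 (by linarith)) fun x hx => ?_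
  exact abs_cutQuot_le hl (spectrum_resolvent_subset h0 h1 hx).1 hl0

/-- The splitting of a vector in the domain of `A = 1 - R⁻¹` along the spectrum of `A`. -/
theorem domain_splitting (h0 : 0 ≤ R) (hres : ∀ x ∈ G, R (x.1 - x.2) = x.1) (hl : l < 1)
    {x : H × H} (hx : x ∈ G) :
    x.1 = cfc (cutQuot l) R x.2 + cfc (cutBump l) R (x.1 - x.2) := by
  have hsa : IsSelfAdjoint R := IsSelfAdjoint.of_nonneg h0
  have hk := continuous_cutQuot hl
  have hb := continuous_cutBump (l := l)
  have key : cfc (cutQuot l) R * (R - 1) + cfc (cutBump l) R = R := by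
    have e1 : R - 1 = cfc (fun x : ℝ => x - 1) R := by
      rw [cfc_sub (fun x => x) (fun _ => 1) R (by fun_prop) (by fun_prop), cfc_id' ℝ R,
        cfc_const_one ℝ R]
    rw [e1, ← cfc_mul (cutQuot l) (fun x => x - 1) R hk.continuousOn (by fun_prop),
      ← cfc_add (a := R) (fun x => cutQuot l x * (x - 1)) (cutBump l)
        (by fun_prop) hb.continuousOn]
    conv_rhs => rw [← cfc_id' ℝ R]
    exact cfc_congr fun x _ => cutQuot_mul_add hl x
  have h2 := hres x hx
  have h3 : (R - 1) (x.1 - x.2) = x.2 := by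
    simp only [_root_.sub_apply, one_apply_eq_self, h2]
    abel
  have := congrArg (fun T : H →L[ℂ] H => T (x.1 - x.2)) key
  simp only [_root_.add_apply, mul_apply_eq_comp, h3, h2] at this
  exact this.symm

end

/-- The spectrum of the operator with graph `G`: the complement of those `z` for which `A - z` has
an everywhere defined bounded inverse. -/
def relSpectrum (G : Set (H × H)) : Set ℂ :=
  {z | ¬ ∃ S : H →L[ℂ] H, ∀ x y, S y = x ↔ (x, y + z • x) ∈ G}

/-- The spectral mapping for `A = 1 - R⁻¹`: if `1 - l⁻¹` is not in the spectrum of `A`, then `l` is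
not in the spectrum of `R`. With `S = (A - z)⁻¹`, the inverse of `l - R` is `l⁻¹ (1 - (1 - z) S)`.
-/
theorem notMem_spectrum_resolvent [CompleteSpace H] {R : H →L[ℂ] H} (hR : ∀ y, (R y, R y - y) ∈ G)
    (hG : IsSelfAdj G) (hres : ∀ x ∈ G, R (x.1 - x.2) = x.1) {l : ℝ} (hl : 0 < l)
    (hz : ((1 - l⁻¹ : ℝ) : ℂ) ∉ relSpectrum G) : l ∉ spectrum ℝ R := by
  have hl' : (l : ℂ) ≠ 0 := by exact_mod_cast hl.ne'
  obtain ⟨S, hS⟩ := not_not.1 hz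
  set z : ℂ := ((1 - l⁻¹ : ℝ) : ℂ) with hzdef
  have hzl : 1 - z = (l : ℂ)⁻¹ := by rw [hzdef]; push_cast; ring
  let Q : H →L[ℂ] H := (l : ℂ)⁻¹ • (1 - (1 - z) • S)
  rw [spectrum.notMem_iff]
  have hdef : ∀ y, (algebraMap ℝ (H →L[ℂ] H) l - R) y = (l : ℂ) • y - R y := fun y => by
    simp [Algebra.algebraMap_eq_smul_one]
  have hQ : ∀ y, Q y = (l : ℂ)⁻¹ • (y - (l : ℂ)⁻¹ • S y) := fun y => by simp [Q, hzl]
  refine ⟨⟨algebraMap ℝ (H →L[ℂ] H) l - R, Q, ?_, ?_⟩, rfl⟩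
  · ext y
    have h1 := hres _ ((hS (S y) y).1 rfl)
    have h2 : S y - (y + z • S y) = (l : ℂ)⁻¹ • S y - y := by
      rw [← hzl, sub_smul, one_smul]; abel
    simp only [h2] at h1
    rw [mul_apply_eq_comp, hdef, hQ, map_smul, ← neg_sub ((l : ℂ)⁻¹ • S y) y, map_neg,
      h1]
    rw [one_apply_eq_self]
    match_scalars <;> field_simp
    ring
  · ext y
    have h1 : S ((l : ℂ) • y - R y) = -((l : ℂ) • R y) := by
      rw [hS]
      have h3 : (-(l : ℂ)) • (R y, R y - y) ∈ hG.submodule := hG.submodule.smul_mem _ (hR y)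
      have h4 : ((-((l : ℂ) • R y), (l : ℂ) • y - R y + z • -((l : ℂ) • R y)) : H × H)
          = (-(l : ℂ)) • (R y, R y - y) := by
        have hz' : z = 1 - (l : ℂ)⁻¹ := by rw [← hzl]; ring
        rw [hz', Prod.smul_mk, Prod.mk.injEq]
        constructor
        · simp
        · match_scalars <;> field_simp
          ring
      rw [h4]
      exact h3
    rw [mul_apply_eq_comp, hdef, hQ, h1]
    simp only [one_apply_eq_self, smul_neg, smul_smul, inv_mul_cancel₀ hl', one_smul,
      sub_neg_eq_add]
    rw [sub_add_cancel, smul_smul, inv_mul_cancel₀ hl', one_smul]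

/-- If `A` has approximate null vectors orthogonal to its kernel, then `0` is not isolated in its
spectrum. Otherwise a bump function of `R` supported near `1` has its range in the kernel, it
vanishes on vectors orthogonal to the kernel, and on those `A` is bounded below. -/
theorem exists_mem_relSpectrum [CompleteSpace H] (hG : IsSelfAdj G) (hd : IsDissipative G)
    (happ : ∀ c : ℝ, 0 < c → ∃ x ∈ G, x.1 ≠ 0 ∧ ‖x.2‖ < c * ‖x.1‖ ∧
      ∀ ψ, (ψ, (0 : H)) ∈ G → ⟪ψ, x.1⟫_ℂ = 0) {ε : ℝ} (hε : 0 < ε) :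
    ∃ z ∈ relSpectrum G, z ≠ 0 ∧ ‖z‖ < ε := by
  by_contra hcon
  push Not at hcon
  obtain ⟨R, hR1, hR, hres⟩ := exists_resolvent hG hd
  have h0 := resolvent_nonneg hG hd hR
  have hsa : IsSelfAdjoint R := IsSelfAdjoint.of_nonneg h0
  set l : ℝ := (1 + ε)⁻¹ with hldef
  have hl0 : 0 < l := by positivity
  have hl1 : l < 1 := inv_lt_one_of_one_lt₀ (by linarith)
  -- the spectrum of `R` avoids the interval `(l, 1)`
  have hgap : ∀ x ∈ spectrum ℝ R, x ≤ l ∨ x = 1 := by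
    intro x hx
    by_contra hne
    push Not at hne
    have hx1 : x < 1 := lt_of_le_of_ne (spectrum_resolvent_subset h0 hR1 hx).2 hne.2
    have hx0 : 0 < x := hl0.trans hne.1
    refine notMem_spectrum_resolvent hR hG hres hx0 (fun hz => ?_) hx
    have hinv : 1 < x⁻¹ := (one_lt_inv₀ hx0).2 hx1
    have hinv2 : x⁻¹ < 1 + ε := by
      rw [inv_lt_comm₀ hx0 (by linarith)]
      exact hne.1
    have := hcon _ hz (by
      have : (1 - x⁻¹ : ℝ) ≠ 0 := by linarith
      exact_mod_cast this)
    rw [Complex.norm_real, Real.norm_eq_abs, abs_of_neg (by linarith)] at this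
    linarith
  -- hence `x * cutBump l x = cutBump l x` on the spectrum, and the range of `cutBump l R` is killed
  -- by `A`
  have hker : ∀ y, (cfc (cutBump l) R y, (0 : H)) ∈ G := by
    intro y
    have h1 : R * cfc (cutBump l) R = cfc (cutBump l) R := by
      conv_lhs => rw [← cfc_id' ℝ R, cfc_id' ℝ R]
      nth_rewrite 1 [← cfc_id' ℝ R]
      rw [← cfc_mul (fun x => x) (cutBump l) R (by fun_prop) continuous_cutBump.continuousOn]
      refine cfc_congr fun x hx => ?_
      rcases hgap x hx with h | h
      · have : cutBump l x = 0 := by simp [cutBump, max_eq_left (sub_nonpos.2 h)]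
        simp [this]
      · simp [h]
    have h2 : R (cfc (cutBump l) R y) = cfc (cutBump l) R y := by
      rw [← mul_apply_eq_comp, h1]
    have := hR (cfc (cutBump l) R y)
    rwa [h2, sub_self] at this
  obtain ⟨x, hx, hx0, hxc, hxk⟩ := happ ε hε
  have hBsa : IsSelfAdjoint (cfc (cutBump l) R) := cfc_predicate _ R
  have hB : cfc (cutBump l) R (x.1 - x.2) = 0 := by
    rw [← inner_self_eq_zero (𝕜 := ℂ)]
    set w := cfc (cutBump l) R (x.1 - x.2)
    have h1 : ⟪w, w⟫_ℂ = ⟪cfc (cutBump l) R w, x.1 - x.2⟫_ℂ := by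
      conv_rhs => rw [← hBsa.adjoint_eq, ContinuousLinearMap.adjoint_inner_left]
    rw [h1, inner_sub_right, hxk _ (hker w), ← hG.symm (hker w) hx, inner_zero_left, sub_zero]
  have h2 := domain_splitting h0 hres hl1 hx
  rw [hB, add_zero] at h2
  have h3 : l / (1 - l) = ε⁻¹ := by
    have : (1 : ℝ) + ε ≠ 0 := by positivity
    have h' : 1 - l = ε * l := by rw [hldef]; field_simp; ring
    rw [h']; field_simp
  have h4 := (cfc (cutQuot l) R).le_of_opNorm_le (norm_cfc_cutQuot_le h0 hR1 hl1 hl0.le) x.2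
  rw [← h2, h3] at h4
  have h5 : ε⁻¹ * ‖x.2‖ < ‖x.1‖ := by
    rw [inv_mul_lt_iff₀ hε]
    exact hxc
  linarith

/-- Mild solutions on `[0, ∞)` of `∂ₜ u = A u` for the operator `A` with graph `G`. -/
def IsMildSolution (G : Set (H × H)) (u : ℝ → H) : Prop :=
  ContinuousOn u (Ici 0) ∧ ∀ t : ℝ, 0 ≤ t → ((∫ τ in (0 : ℝ)..t, u τ), u t - u 0) ∈ G

theorem IsMildSolution.intervalIntegrable {u : ℝ → H} (hu : IsMildSolution G u) {a b : ℝ}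
    (ha : 0 ≤ a) (hb : 0 ≤ b) : IntervalIntegrable u volume a b :=
  (hu.1.mono fun _ hx => (le_min ha hb).trans hx.1).intervalIntegrable

/-- Mild solutions of a dissipative equation do not grow. The sliding averages
`∫ τ in t..t+h, u τ` are differentiable with values in the domain, so that dissipativity makes their
norm decrease; then `h → 0`. -/
theorem IsMildSolution.norm_le [CompleteSpace H] (hG : IsSelfAdj G) (hd : IsDissipative G)
    {u : ℝ → H} (hu : IsMildSolution G u) {t : ℝ} (ht : 0 ≤ t) : ‖u t‖ ≤ ‖u 0‖ := by
  set v : ℝ → H := fun t => ∫ τ in (0 : ℝ)..t, u τ with hv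
  have hder : ∀ t, 0 < t → HasDerivAt v (u t) t := fun t ht =>
    intervalIntegral.integral_hasDerivAt_right (hu.intervalIntegrable le_rfl ht.le)
      ((hu.1.mono Ioi_subset_Ici_self).stronglyMeasurableAtFilter isOpen_Ioi t ht)
      (hu.1.continuousAt (Ici_mem_nhds ht))
  have hder0 : ∀ t, 0 ≤ t → HasDerivWithinAt v (u t) (Ici t) t := fun t ht =>
    intervalIntegral.integral_hasDerivWithinAt_right (hu.intervalIntegrable le_rfl ht)
      (t := Ioi t)
      ((hu.1.mono fun x hx => ht.trans (le_of_lt hx)).stronglyMeasurableAtFilter_nhdsWithin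
        measurableSet_Ioi t)
      ((hu.1 t ht).mono fun x hx => ht.trans (le_of_lt hx))
  have havg : ∀ h, 0 < h → ‖v (t + h) - v t‖ ≤ ‖v (0 + h) - v 0‖ := by
    intro h hh
    set w : ℝ → H := fun t => v (t + h) - v t
    have hwder : ∀ s, 0 < s → HasDerivAt w (u (s + h) - u s) s := fun s hs =>
      (HasDerivAt.comp_add_const s h (hder (s + h) (by linarith))).sub (hder s hs)
    have hvc : ContinuousOn v (Ici 0) := fun s hs => by
      rcases (mem_Ici.1 hs).eq_or_lt with rfl | h0
      · exact (hder0 0 le_rfl).continuousWithinAt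
      · exact (hder s h0).continuousAt.continuousWithinAt
    have hwc : ContinuousOn w (Ici 0) := by
      refine ContinuousOn.sub (hvc.comp (by fun_prop) fun s hs => ?_) hvc
      have := mem_Ici.1 hs
      exact mem_Ici.2 (by linarith)
    have hw : ∀ s, 0 ≤ s → (w s, u (s + h) - u s) ∈ G := fun s hs => by
      have := hG.submodule.sub_mem (hu.2 (s + h) (by linarith)) (hu.2 s hs)
      simp only [Prod.mk_sub_mk, sub_sub_sub_cancel_right] at this
      exact this
    have hanti : AntitoneOn (fun s => ‖w s‖ ^ 2) (Ici 0) := by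
      refine antitoneOn_of_hasDerivWithinAt_nonpos (convex_Ici 0) (hwc.norm.pow 2)
        (f' := fun s => 2 * (⟪w s, u (s + h) - u s⟫_ℂ).re) (fun s hs => ?_) (fun s hs => ?_)
      · rw [interior_Ici] at hs
        let : InnerProductSpace ℝ H := InnerProductSpace.complexToReal
        exact (hwder s hs).norm_sq.hasDerivWithinAt
      · rw [interior_Ici] at hs
        have := hd _ (hw s (le_of_lt hs))
        simp only at this
        linarith
    have := hanti (mem_Ici.2 le_rfl) (mem_Ici.2 ht) ht
    exact le_of_sq_le_sq this (norm_nonneg _)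
  have hlim : ∀ s, 0 ≤ s → Tendsto (fun h => ‖h⁻¹ • (v (s + h) - v s)‖) (𝓝[>] 0) (𝓝 ‖u s‖) := by
    intro s hs
    have := (hder0 s hs).Ioi_of_Ici
    rw [hasDerivWithinAt_iff_tendsto_slope' (by simp)] at this
    have h2 : Tendsto (fun h => s + h) (𝓝[>] 0) (𝓝[>] s) := by
      refine tendsto_nhdsWithin_iff.2 ⟨?_, ?_⟩
      · have : Tendsto (fun h => s + h) (𝓝 0) (𝓝 (s + 0)) := by
          exact (continuous_const.add continuous_id).tendsto 0
        rw [add_zero] at this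
        exact this.mono_left nhdsWithin_le_nhds
      · filter_upwards [self_mem_nhdsWithin] with h hh
        have : 0 < h := hh
        exact mem_Ioi.2 (by linarith)
    have h3 := (this.comp h2).norm
    refine h3.congr fun h => ?_
    simp [slope]
  refine le_of_tendsto_of_tendsto (hlim t ht) (hlim 0 le_rfl) ?_
  filter_upwards [self_mem_nhdsWithin] with h hh
  rw [norm_smul, norm_smul]
  exact mul_le_mul_of_nonneg_left (havg h hh) (norm_nonneg _)

/-- If `A` has approximate null vectors, it has mild solutions that hardly decay up to a given time.
The initial value lies in the part of the spectrum of `A` in `[-ε, 0]`, where `A` coincides with a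
bounded operator `B` of norm at most `ε`. -/
theorem exists_slow_mildSolution [CompleteSpace H] (hG : IsSelfAdj G) (hd : IsDissipative G)
    (happ : ∀ c : ℝ, 0 < c → ∃ x ∈ G, x.1 ≠ 0 ∧ ‖x.2‖ < c * ‖x.1‖)
    {t ε : ℝ} (ht : 0 ≤ t) (hε : 0 < ε) :
    ∃ u : ℝ → H, IsMildSolution G u ∧ u 0 ≠ 0 ∧ Real.exp (-(t * ε)) * ‖u 0‖ ≤ ‖u t‖ := by
  obtain ⟨R, hR1, hR, hres⟩ := exists_resolvent hG hd
  have h0 := resolvent_nonneg hG hd hR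
  set l : ℝ := (1 + ε)⁻¹ with hldef
  have hl0 : 0 < l := by positivity
  have hl1 : l < 1 := inv_lt_one_of_one_lt₀ (by linarith)
  have hlinv : l⁻¹ = 1 + ε := by rw [hldef, inv_inv]
  have h3 : l / (1 - l) = ε⁻¹ := by
    have : (1 : ℝ) + ε ≠ 0 := by positivity
    have h' : 1 - l = ε * l := by rw [hldef]; field_simp; ring
    rw [h']; field_simp
  obtain ⟨x, hx, hx0, hxc⟩ := happ ε hε
  set T : H →L[ℂ] H := cfc (cutBump l) R with hT
  set w : H := T (x.1 - x.2) with hw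
  -- otherwise `A` would be bounded below by `ε` on `x`
  have hw0 : w ≠ 0 := by
    intro hB
    have h2 := domain_splitting h0 hres hl1 hx
    rw [← hT, ← hw, hB, add_zero] at h2
    have h4 := (cfc (cutQuot l) R).le_of_opNorm_le (norm_cfc_cutQuot_le h0 hR1 hl1 hl0.le) x.2
    rw [← h2, h3] at h4
    have h5 : ε⁻¹ * ‖x.2‖ < ‖x.1‖ := by
      rw [inv_mul_lt_iff₀ hε]
      exact hxc
    linarith
  -- the generator `1 - R⁻¹` with its spectral part below `-ε` replaced by `-ε`
  set b : ℝ → ℝ := fun x => 1 - (max x l)⁻¹ with hb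
  have hmax : ∀ x, 0 < max x l := fun x => hl0.trans_le (le_max_right _ _)
  have hbc : Continuous b := by
    refine continuous_const.sub (Continuous.inv₀ (by fun_prop) fun x => (hmax x).ne')
  set B : H →L[ℂ] H := cfc b R with hB
  have hBn : ‖B‖ ≤ ε := by
    refine norm_cfc_le hε.le fun x hx => ?_
    have hx' := spectrum_resolvent_subset h0 hR1 hx
    have e1 : 1 ≤ (max x l)⁻¹ := (one_le_inv₀ (hmax x)).2 (max_le hx'.2 hl1.le)
    have e2 : (max x l)⁻¹ ≤ l⁻¹ := inv_anti₀ hl0 (le_max_right _ _)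
    rw [hlinv] at e2
    rw [Real.norm_eq_abs, abs_le]
    constructor <;> simp only [hb] <;> linarith
  have hcomm : Commute T B := cfc_commute_cfc _ _ _
  have hRBT : R * (1 - B) * T = T := by
    have hsa : IsSelfAdjoint R := IsSelfAdjoint.of_nonneg h0
    have e1 : 1 - B = cfc (fun x => 1 - b x) R := by
      rw [cfc_sub (fun _ => (1 : ℝ)) b R (by fun_prop) hbc.continuousOn, cfc_const_one ℝ R]
    have e2 : R * (1 - B) = cfc (fun x => x * (1 - b x)) R := by
      rw [cfc_mul (fun x : ℝ => x) (fun x => 1 - b x) R (by fun_prop) (by fun_prop), cfc_id' ℝ R,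
        e1]
    rw [e2, hT, ← cfc_mul (fun x => x * (1 - b x)) (cutBump l) R (by fun_prop)
      continuous_cutBump.continuousOn]
    refine cfc_congr fun x _ => ?_
    simp only [hb, sub_sub_cancel]
    rcases le_total x l with h | h
    · simp [cutBump, max_eq_left (sub_nonpos.2 h)]
    · rw [max_eq_left h, mul_inv_cancel₀ (hl0.trans_le h).ne', one_mul]
  -- `A` coincides with `B` on the range of `T`
  have hgraph : ∀ y, (T y, B (T y)) ∈ G := fun y => by
    have e1 : R (T y - B (T y)) = T y := by
      have := congrArg (fun S : H →L[ℂ] H => S y) hRBT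
      simpa [mul_apply_eq_comp] using this
    have := hR (T y - B (T y))
    rw [e1] at this
    simpa using this
  -- the exponential is defined with rational coefficients
  let : NormedAlgebra ℚ (H →L[ℂ] H) := NormedAlgebra.restrictScalars ℚ ℂ _
  set U : ℝ → H →L[ℂ] H := fun s => NormedSpace.exp (s • B) with hU
  have hUder : ∀ s, HasDerivAt U (B * U s) s := fun s => hasDerivAt_exp_smul_const' B s
  have hUc : Continuous U := continuous_iff_continuousAt.2 fun s => (hUder s).continuousAt
  have hUT : ∀ s, Commute T (U s) := fun s => (hcomm.smul_right s).exp_right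
  set u : ℝ → H := fun s => U s w with hu
  have hu' : ∀ s, u s = T (U s (x.1 - x.2)) := fun s => by
    simp only [hu, hw]
    rw [← mul_apply_eq_comp, ← mul_apply_eq_comp, (hUT s).eq]
  have huder : ∀ s, HasDerivAt u (B (u s)) s := fun s => by
    have := ((ContinuousLinearMap.apply ℂ H w).restrictScalars ℝ).hasFDerivAt.comp_hasDerivAt s
      (hUder s)
    exact this
  have huc : Continuous u := continuous_iff_continuousAt.2 fun s => (huder s).continuousAt
  have hu0 : u 0 = w := by simp [hu, hU]
  refine ⟨u, ⟨huc.continuousOn, fun s _ => ?_⟩, by rwa [hu0], ?_⟩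
  · have e1 : ∫ τ in (0 : ℝ)..s, u τ = T (∫ τ in (0 : ℝ)..s, U τ (x.1 - x.2)) := by
      rw [← ContinuousLinearMap.intervalIntegral_comp_comm]
      · exact intervalIntegral.integral_congr fun τ _ => hu' τ
      · exact Continuous.intervalIntegrable (by fun_prop) _ _
    have e2 : B (∫ τ in (0 : ℝ)..s, u τ) = u s - u 0 := by
      rw [← ContinuousLinearMap.intervalIntegral_comp_comm _ (huc.intervalIntegrable _ _)]
      exact intervalIntegral.integral_eq_sub_of_hasDerivAt (fun τ _ => huder τ)
        (Continuous.intervalIntegrable (by fun_prop) _ _)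
    rw [← e2, e1]
    exact hgraph _
  · have hmono : Monotone fun s => Real.exp (2 * ε * s) * ‖u s‖ ^ 2 := by
      let : InnerProductSpace ℝ H := InnerProductSpace.complexToReal
      refine monotone_of_hasDerivAt_nonneg
        (f' := fun s => Real.exp (2 * ε * s) * (2 * ε) * ‖u s‖ ^ 2
          + Real.exp (2 * ε * s) * (2 * (⟪u s, B (u s)⟫_ℂ).re)) (fun s => ?_) fun s => ?_
      · have h1 : HasDerivAt (fun s => Real.exp (2 * ε * s)) (Real.exp (2 * ε * s) * (2 * ε))
            s := by
          simpa using ((hasDerivAt_id s).const_mul (2 * ε)).exp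
        exact h1.mul (huder s).norm_sq
      · have h1 : |(⟪u s, B (u s)⟫_ℂ).re| ≤ ε * ‖u s‖ ^ 2 := by
          refine (Complex.abs_re_le_norm _).trans ((norm_inner_le_norm _ _).trans ?_)
          have := mul_le_mul_of_nonneg_left (B.le_of_opNorm_le hBn (u s)) (norm_nonneg (u s))
          nlinarith
        have h2 := (abs_le.1 h1).1
        have h3 := Real.exp_pos (2 * ε * s)
        have h4 : 0 ≤ Real.exp (2 * ε * s) * (2 * (ε * ‖u s‖ ^ 2 + (⟪u s, B (u s)⟫_ℂ).re)) :=
          mul_nonneg h3.le (by linarith)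
        simp only [Pi.zero_apply]
        linarith
    have h1 := hmono ht
    simp only [mul_zero, Real.exp_zero, one_mul] at h1
    refine le_of_sq_le_sq ?_ (norm_nonneg _)
    have h2 : Real.exp (-(t * ε)) ^ 2 * Real.exp (2 * ε * t) = 1 := by
      rw [← Real.exp_nat_mul, ← Real.exp_add, ← Real.exp_zero]
      congr 1
      push_cast
      ring
    calc (Real.exp (-(t * ε)) * ‖u 0‖) ^ 2 = Real.exp (-(t * ε)) ^ 2 * ‖u 0‖ ^ 2 := by ring
      _ ≤ Real.exp (-(t * ε)) ^ 2 * (Real.exp (2 * ε * t) * ‖u t‖ ^ 2) := by gcongr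
      _ = ‖u t‖ ^ 2 := by rw [← mul_assoc, h2, one_mul]

/-- The part of a relation in a subspace. -/
def part (G : Set (H × H)) (K : Submodule ℂ H) : Set (K × K) :=
  {x | ((x.1 : H), (x.2 : H)) ∈ G}

theorem IsDissipative.part (hd : IsDissipative G) (K : Submodule ℂ H) :
    IsDissipative (part G K) := fun _ hx => hd _ hx

/-- The part of a self-adjoint operator in the orthogonal complement of a subspace of its kernel is
self-adjoint. -/
theorem IsSelfAdj.part (hG : IsSelfAdj G) (K : Submodule ℂ H) [K.HasOrthogonalProjection]
    (hK : ∀ h ∈ Kᗮ, (h, (0 : H)) ∈ G) : IsSelfAdj (part G K) := by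
  intro φ χ
  constructor
  · intro h x hx
    exact hG.symm (x := ((x.1 : H), (x.2 : H))) hx h
  · intro h
    refine (hG φ χ).2 fun y hy => ?_
    -- test vectors of the full operator split into one in `K` and one in the kernel
    obtain ⟨k, hk, n, hn, hkn⟩ := K.exists_add_mem_mem_orthogonal y.1
    have hn0 := hK n hn
    have hy2 : y.2 ∈ K := by
      rw [← Submodule.orthogonal_orthogonal K, Submodule.mem_orthogonal]
      intro m hm
      have := hG.symm (hK m hm) hy
      simpa using this.symm
    have hmem : (k, y.2) ∈ G := by
      have h1 := hG.submodule.sub_mem (show y ∈ hG.submodule from hy)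
        (show (n, (0 : H)) ∈ hG.submodule from hn0)
      have h2 : y - (n, (0 : H)) = (k, y.2) := by
        ext
        · simp [hkn]
        · simp
      rwa [h2] at h1
    have h3 : ⟪y.2, (φ : H)⟫_ℂ = ⟪k, (χ : H)⟫_ℂ := h (⟨k, hk⟩, ⟨y.2, hy2⟩) hmem
    rw [h3, hkn, inner_add_left, Submodule.inner_left_of_mem_orthogonal χ.2 hn, add_zero]

theorem IsMildSolution.of_part {K : Submodule ℂ H} [CompleteSpace K] [CompleteSpace H] {u : ℝ → K}
    (hu : IsMildSolution (part G K) u) : IsMildSolution G fun t => (u t : H) := by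
  refine ⟨continuous_subtype_val.comp_continuousOn hu.1, fun t ht => ?_⟩
  have h := hu.2 t ht
  have h1 := K.subtypeL.intervalIntegral_comp_comm (hu.intervalIntegrable le_rfl ht)
  simp only [Submodule.subtypeL_apply] at h1
  rw [h1]
  exact h

end SelfAdjointRelation

/-! ### Integration over the unit sphere -/

namespace SphereIntegral

open scoped Pointwise

/-- Polar coordinates for the Lebesgue integral. -/
theorem lintegral_polar {n : ℕ} {F : EuclideanSpace ℝ (Fin (n + 1)) → ENNReal} (hF : Measurable F) :
    ∫⁻ x, F x = ∫⁻ ω, (∫⁻ r in Ioi (0 : ℝ), ENNReal.ofReal (r ^ n) *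
      F (r • (ω : EuclideanSpace ℝ (Fin (n + 1)))))
      ∂((volume : Measure (EuclideanSpace ℝ (Fin (n + 1)))).toSphere) := by
  let E := EuclideanSpace ℝ (Fin (n + 1))
  have hdim : Module.finrank ℝ E - 1 = n := by simp [E]
  have hmp := (volume : Measure E).measurePreserving_homeomorphUnitSphereProd
  have h1 : ∫⁻ x, F x = ∫⁻ x : ({(0)}ᶜ : Set E), F x ∂((volume : Measure E).comap (↑)) := by
    rw [lintegral_subtype_comap (measurableSet_singleton _).compl, restrict_compl_singleton]
  have h2 : ∫⁻ x : ({(0)}ᶜ : Set E), F x ∂((volume : Measure E).comap (↑))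
      = ∫⁻ y, F (((homeomorphUnitSphereProd E).symm y : ({(0)}ᶜ : Set E)) : E)
        ∂((volume : Measure E).toSphere.prod (.volumeIoiPow (Module.finrank ℝ E - 1))) := by
    rw [← hmp.lintegral_comp_emb (homeomorphUnitSphereProd E).measurableEmbedding]
    simp
  have hm : Measurable fun y => F (((homeomorphUnitSphereProd E).symm y : ({(0)}ᶜ : Set E)) : E) :=
    hF.comp (measurable_subtype_coe.comp (homeomorphUnitSphereProd E).symm.measurable)
  rw [h1, h2, lintegral_prod _ hm.aemeasurable, hdim]
  refine lintegral_congr fun ω => ?_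
  have hm' : Measurable fun r : Ioi (0 : ℝ) => F ((r : ℝ) • (ω : E)) :=
    hF.comp (by fun_prop)
  simp only [homeomorphUnitSphereProd_symm_apply_coe]
  rw [Measure.volumeIoiPow, lintegral_withDensity_eq_lintegral_mul _ (by fun_prop) hm']
  simp only [Pi.mul_apply]
  rw [lintegral_subtype_comap measurableSet_Ioi
    fun r : ℝ => ENNReal.ofReal (r ^ n) * F (r • (ω : E))]

/-- The unit sphere of `ℝ³`. -/
abbrev S2 : Type := Metric.sphere (0 : MasslessGas.Mom) 1

/-- The surface measure of the unit sphere of `ℝ³`. -/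
noncomputable abbrev area : Measure S2 := (volume : Measure MasslessGas.Mom).toSphere

open MasslessGas

theorem area_univ : area univ = ENNReal.ofReal (4 * Real.pi) := by
  rw [Measure.toSphere_apply_univ, EuclideanSpace.volume_ball_fin_three]
  simp only [finrank_euclideanSpace, Fintype.card_fin, ENNReal.ofReal_one, one_pow, one_mul]
  rw [← ENNReal.ofReal_natCast, ← ENNReal.ofReal_mul (by positivity)]
  congr 1
  push_cast
  ring

/-- The action of a linear isometry on the unit sphere. -/
noncomputable def sphereMap (e : Mom ≃ₗᵢ[ℝ] Mom) (ω : S2) : S2 :=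
  ⟨e ω, by simp⟩

@[simp] theorem coe_sphereMap (e : Mom ≃ₗᵢ[ℝ] Mom) (ω : S2) : (sphereMap e ω : Mom) = e ω := rfl

theorem continuous_sphereMap (e : Mom ≃ₗᵢ[ℝ] Mom) : Continuous (sphereMap e) := by
  unfold sphereMap
  fun_prop

theorem injective_sphereMap (e : Mom ≃ₗᵢ[ℝ] Mom) : Function.Injective (sphereMap e) :=
  fun _ _ h => Subtype.ext (e.injective (congrArg Subtype.val h))

theorem measurableEmbedding_sphereMap (e : Mom ≃ₗᵢ[ℝ] Mom) :
    MeasurableEmbedding (sphereMap e) :=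
  ((continuous_sphereMap e).isClosedEmbedding (injective_sphereMap e)).measurableEmbedding

theorem measurePreserving_sphereMap (e : Mom ≃ₗᵢ[ℝ] Mom) :
    MeasurePreserving (sphereMap e) area area := by
  refine ⟨(continuous_sphereMap e).measurable, ?_⟩
  ext s hs
  rw [Measure.map_apply (continuous_sphereMap e).measurable hs, Measure.toSphere_apply' _ hs,
    Measure.toSphere_apply' _ ((continuous_sphereMap e).measurable hs)]
  congr 1
  have : Ioo (0 : ℝ) 1 • ((↑) '' (sphereMap e ⁻¹' s) : Set Mom)
      = e ⁻¹' (Ioo (0 : ℝ) 1 • ((↑) '' s)) := by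
    ext x
    simp only [Set.mem_smul, mem_preimage, mem_image]
    constructor
    · rintro ⟨r, hr, _, ⟨ω, hω, rfl⟩, rfl⟩
      exact ⟨r, hr, _, ⟨_, hω, rfl⟩, by simp⟩
    · rintro ⟨r, hr, _, ⟨ω, hω, rfl⟩, h⟩
      refine ⟨r, hr, _, ⟨sphereMap e.symm ω, ?_, rfl⟩, ?_⟩
      · have : sphereMap e (sphereMap e.symm ω) = ω := Subtype.ext (by simp)
        rwa [this]
      · apply e.injective
        simp [← h]
  rw [this]
  exact e.measurePreserving.measure_preimage_equiv (f := e.toMeasurableEquiv) _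

theorem integral_sphereMap {V : Type*} [NormedAddCommGroup V] [NormedSpace ℝ V]
    (e : Mom ≃ₗᵢ[ℝ] Mom) (F : S2 → V) :
    ∫ ω, F (sphereMap e ω) ∂area = ∫ ω, F ω ∂area :=
  (measurePreserving_sphereMap e).integral_comp (measurableEmbedding_sphereMap e) F

/-- Cylindrical coordinates about the first axis, for functions of the distance from the axis and
the height. -/
theorem lintegral_cylindrical {G : ℝ → ℝ → ENNReal} (hG : Measurable (Function.uncurry G)) :
    ∫⁻ x : Mom, G (x 0) (Real.sqrt (x 1 ^ 2 + x 2 ^ 2))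
      = ENNReal.ofReal (2 * Real.pi) *
        ∫⁻ z : ℝ, ∫⁻ ρ in Ioi (0 : ℝ), ENNReal.ofReal ρ * G z ρ := by
  have key : ∀ {X : Type} [MeasurableSpace X] {a b : X → ℝ}, Measurable a → Measurable b →
      Measurable fun x => G (a x) (b x) := fun ha hb => hG.comp (ha.prodMk hb)
  have h1 := (PiLp.volume_preserving_toLp (Fin 3)).lintegral_comp
    (f := fun x : Mom => G (x 0) (Real.sqrt (x 1 ^ 2 + x 2 ^ 2)))
    (key (by fun_prop) (by fun_prop))
  have h2 := (volume_preserving_piFinSuccAbove (fun _ : Fin 3 => ℝ) 0).symm.lintegral_comp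
    (f := fun x : Fin 3 → ℝ => G (x 0) (Real.sqrt (x 1 ^ 2 + x 2 ^ 2)))
    (key (by fun_prop) (by fun_prop))
  have h3 : ∀ z : ℝ, ∫⁻ y : Fin 2 → ℝ, G z (Real.sqrt (y 0 ^ 2 + y 1 ^ 2))
      = ENNReal.ofReal (2 * Real.pi) * ∫⁻ ρ in Ioi (0 : ℝ), ENNReal.ofReal ρ * G z ρ := by
    intro z
    have h4 := (PiLp.volume_preserving_toLp (Fin 2)).lintegral_comp
      (f := fun x : EuclideanSpace ℝ (Fin 2) => G z ‖x‖)
      (key (by fun_prop) (by fun_prop))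
    have h5 := lintegral_polar (n := 1) (F := fun x => G z ‖x‖) (key (by fun_prop) (by fun_prop))
    have h6 : ∀ y : Fin 2 → ℝ, ‖WithLp.toLp 2 y‖ = Real.sqrt (y 0 ^ 2 + y 1 ^ 2) := fun y => by
      rw [EuclideanSpace.norm_eq]
      simp
    have h8 : ∫⁻ y : Fin 2 → ℝ, G z (Real.sqrt (y 0 ^ 2 + y 1 ^ 2))
        = ∫⁻ x : EuclideanSpace ℝ (Fin (1 + 1)), G z ‖x‖ := by
      rw [← h4]
      exact lintegral_congr fun y => by rw [h6]
    rw [h8, h5]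
    have h7 : ∀ ω : Metric.sphere (0 : EuclideanSpace ℝ (Fin 2)) 1,
        ∫⁻ r in Ioi (0 : ℝ), ENNReal.ofReal (r ^ 1) * G z ‖r • (ω : EuclideanSpace ℝ (Fin 2))‖
        = ∫⁻ ρ in Ioi (0 : ℝ), ENNReal.ofReal ρ * G z ρ := fun ω => by
      refine setLIntegral_congr_fun measurableSet_Ioi fun r hr => ?_
      have hr' : 0 < r := hr
      simp [norm_smul, abs_of_pos hr']
    simp only [h7]
    rw [lintegral_const, Measure.toSphere_apply_univ, EuclideanSpace.volume_ball_fin_two, mul_comm]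
    congr 1
    simp only [finrank_euclideanSpace, Fintype.card_fin, ENNReal.ofReal_one, one_pow, one_mul]
    rw [← ENNReal.ofReal_natCast, ← ENNReal.ofReal_mul (by positivity)]
    norm_num
  rw [← h1]
  simp only
  rw [← h2]
  have hm := (MeasurableEquiv.piFinSuccAbove (fun _ : Fin 3 => ℝ) 0).symm.measurable
  have hm' : ∀ i, Measurable fun y =>
      (MeasurableEquiv.piFinSuccAbove (fun _ : Fin 3 => ℝ) 0).symm y i :=
    fun i => (measurable_pi_apply i).comp hm
  have hm2 : Measurable fun y => Real.sqrt
      ((MeasurableEquiv.piFinSuccAbove (fun _ : Fin 3 => ℝ) 0).symm y 1 ^ 2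
        + (MeasurableEquiv.piFinSuccAbove (fun _ : Fin 3 => ℝ) 0).symm y 2 ^ 2) :=
    (((hm' 1).pow_const 2).add ((hm' 2).pow_const 2)).sqrt
  rw [Measure.volume_eq_prod, lintegral_prod _ (key (hm' 0) hm2).aemeasurable]
  rw [← lintegral_const_mul' _ _ ENNReal.ofReal_ne_top]
  refine lintegral_congr fun z => ?_
  rw [← h3 z]
  rfl

/-- Archimedes' hat-box theorem for the first coordinate: comparing the integral of
`1_{‖x‖ < 1} F (x₀ / ‖x‖)` in spherical and in cylindrical coordinates. -/
theorem lintegral_sphere_coord {F : ℝ → ENNReal} (hF : Measurable F) :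
    ∫⁻ ω : S2, F ((ω : Mom) 0) ∂area
      = ENNReal.ofReal (2 * Real.pi) * ∫⁻ u in Ioo (-1 : ℝ) 1, F u := by
  have hthird : ∫⁻ r in Ioi (0 : ℝ), ENNReal.ofReal (r ^ 2) * (Iio (1 : ℝ)).indicator 1 r
      = ENNReal.ofReal (1 / 3) := by
    have h1 : ∀ r : ℝ, ENNReal.ofReal (r ^ 2) * (Iio (1 : ℝ)).indicator 1 r
        = (Iio (1 : ℝ)).indicator (fun r => ENNReal.ofReal (r ^ 2)) r := fun r => by
      by_cases hr : r ∈ Iio (1 : ℝ) <;> simp [hr]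
    simp only [h1]
    rw [setLIntegral_indicator measurableSet_Iio, inter_comm, Ioi_inter_Iio,
      Measure.restrict_congr_set Ioo_ae_eq_Ioc,
      ← ofReal_integral_eq_lintegral_ofReal (intervalIntegral.intervalIntegrable_pow 2).1
        (Eventually.of_forall fun r => sq_nonneg r),
      ← intervalIntegral.integral_of_le zero_le_one]
    norm_num
  have hcos : ∫⁻ u in Ioo (-1 : ℝ) 1, F u
      = ∫⁻ θ in Ioo (0 : ℝ) Real.pi, ENNReal.ofReal (Real.sin θ) * F (Real.cos θ) := by
    have h1 := lintegral_image_eq_lintegral_abs_deriv_mul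
      (measurableSet_Icc (a := 0) (b := Real.pi))
      (fun θ _ => (Real.hasDerivAt_cos θ).hasDerivWithinAt) Real.injOn_cos F
    rw [Real.bijOn_cos.image_eq] at h1
    rw [Measure.restrict_congr_set Ioo_ae_eq_Icc, h1, Measure.restrict_congr_set Ioo_ae_eq_Icc]
    refine setLIntegral_congr_fun measurableSet_Icc fun θ hθ => ?_
    simp only [abs_neg, abs_of_nonneg (Real.sin_nonneg_of_mem_Icc hθ)]
  -- the integral in spherical coordinates
  have hsph : ∫⁻ x : Mom, (Iio (1 : ℝ)).indicator 1 ‖x‖ * F (x 0 / ‖x‖)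
      = ENNReal.ofReal (1 / 3) * ∫⁻ ω : S2, F ((ω : Mom) 0) ∂area := by
    rw [lintegral_polar (n := 2) (by
      refine Measurable.mul ?_ (hF.comp (by fun_prop))
      exact (measurable_one.indicator measurableSet_Iio).comp measurable_norm)]
    rw [← lintegral_const_mul' _ _ ENNReal.ofReal_ne_top]
    refine lintegral_congr fun ω => ?_
    rw [← hthird, ← lintegral_mul_const _ (by
      exact Measurable.mul (by fun_prop) (measurable_one.indicator measurableSet_Iio))]
    refine setLIntegral_congr_fun measurableSet_Ioi fun r hr => ?_
    have hr' : 0 < r := hr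
    have h1 : ‖r • (ω : Mom)‖ = r := by simp [norm_smul, abs_of_pos hr']
    simp only [h1, mul_assoc]
    congr 3
    simp [hr'.ne']
  -- the integral in cylindrical coordinates
  have hcyl : ∫⁻ x : Mom, (Iio (1 : ℝ)).indicator 1 ‖x‖ * F (x 0 / ‖x‖)
      = ENNReal.ofReal (2 * Real.pi) * (ENNReal.ofReal (1 / 3) *
        ∫⁻ θ in Ioo (0 : ℝ) Real.pi, ENNReal.ofReal (Real.sin θ) * F (Real.cos θ)) := by
    set G : ℝ → ℝ → ENNReal := fun z ρ =>
      (Iio (1 : ℝ)).indicator 1 (Real.sqrt (z ^ 2 + ρ ^ 2)) * F (z / Real.sqrt (z ^ 2 + ρ ^ 2))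
      with hG
    have hGm : Measurable (Function.uncurry G) := by
      refine Measurable.mul ?_ (hF.comp (by fun_prop))
      exact (measurable_one.indicator measurableSet_Iio).comp (by fun_prop)
    have h1 : ∀ x : Mom, (Iio (1 : ℝ)).indicator 1 ‖x‖ * F (x 0 / ‖x‖)
        = G (x 0) (Real.sqrt (x 1 ^ 2 + x 2 ^ 2)) := fun x => by
      have : ‖x‖ = Real.sqrt (x 0 ^ 2 + Real.sqrt (x 1 ^ 2 + x 2 ^ 2) ^ 2) := by
        rw [EuclideanSpace.norm_eq, Real.sq_sqrt (by positivity), Fin.sum_univ_three]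
        simp [add_assoc]
      simp only [hG, this]
    simp only [h1]
    rw [lintegral_cylindrical hGm]
    congr 1
    have h2 : ∀ z, ∫⁻ ρ in Ioi (0 : ℝ), ENNReal.ofReal ρ * G z ρ
        = ∫⁻ ρ, (Ioi (0 : ℝ)).indicator (fun ρ => ENNReal.ofReal ρ * G z ρ) ρ := fun z => by
      rw [lintegral_indicator measurableSet_Ioi]
    set g : ℝ × ℝ → ENNReal := fun p =>
      (Ioi (0 : ℝ)).indicator (fun ρ => ENNReal.ofReal ρ * G p.1 ρ) p.2 with hg
    have hgm : Measurable g := by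
      have : g = (Prod.snd ⁻¹' (Ioi (0 : ℝ))).indicator
          fun p : ℝ × ℝ => ENNReal.ofReal p.2 * G p.1 p.2 := by
        ext p
        simp [hg, indicator]
      rw [this]
      exact Measurable.indicator (Measurable.mul (by fun_prop) hGm)
        (measurable_snd measurableSet_Ioi)
    simp only [h2]
    have h3 := lintegral_prod (μ := (volume : Measure ℝ)) (ν := (volume : Measure ℝ)) g
      hgm.aemeasurable
    rw [← Measure.volume_eq_prod] at h3
    rw [← h3, ← lintegral_comp_polarCoord_symm g, polarCoord_target]
    have hgp : Measurable fun p : ℝ × ℝ => g (polarCoord.symm p) := by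
      have : Measurable fun p : ℝ × ℝ => (p.1 * Real.cos p.2, p.1 * Real.sin p.2) := by fun_prop
      exact hgm.comp this
    have hgp2 : Measurable fun p : ℝ × ℝ => ENNReal.ofReal p.1 • g (polarCoord.symm p) :=
      Measurable.smul (by fun_prop : Measurable fun p : ℝ × ℝ => ENNReal.ofReal p.1) hgp
    rw [Measure.volume_eq_prod, ← Measure.prod_restrict, lintegral_prod _ hgp2.aemeasurable]
    rw [← hthird, ← lintegral_mul_const _ (by
      exact Measurable.mul (by fun_prop) (measurable_one.indicator measurableSet_Iio))]
    refine setLIntegral_congr_fun measurableSet_Ioi fun r hr => ?_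
    have hr' : 0 < r := hr
    have h4 : ∫⁻ θ in Ioo (0 : ℝ) Real.pi, ENNReal.ofReal (Real.sin θ) * F (Real.cos θ)
        = ∫⁻ θ in Ioo (-Real.pi) Real.pi, (Ioo (0 : ℝ) Real.pi).indicator
          (fun θ => ENNReal.ofReal (Real.sin θ) * F (Real.cos θ)) θ := by
      rw [setLIntegral_indicator measurableSet_Ioo, inter_eq_left.2]
      exact Ioo_subset_Ioo_left (by linarith [Real.pi_pos])
    simp only
    have h5 : Measurable fun θ => ENNReal.ofReal (Real.sin θ) * F (Real.cos θ) :=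
      Measurable.mul (by fun_prop) (hF.comp Real.measurable_cos)
    rw [h4, ← lintegral_const_mul _ (h5.indicator measurableSet_Ioo)]
    refine setLIntegral_congr_fun measurableSet_Ioo fun θ hθ => ?_
    have hnorm : Real.sqrt ((r * Real.cos θ) ^ 2 + (r * Real.sin θ) ^ 2) = r := by
      rw [show (r * Real.cos θ) ^ 2 + (r * Real.sin θ) ^ 2
        = r ^ 2 * (Real.cos θ ^ 2 + Real.sin θ ^ 2) by ring, Real.cos_sq_add_sin_sq, mul_one,
        Real.sqrt_sq hr'.le]
    simp only [polarCoord_symm_apply, hg, hG, smul_eq_mul]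
    by_cases hθ0 : θ ∈ Ioo (0 : ℝ) Real.pi
    · have hs : 0 < Real.sin θ := Real.sin_pos_of_mem_Ioo hθ0
      rw [indicator_of_mem (mem_Ioi.2 (mul_pos hr' hs)), indicator_of_mem hθ0, hnorm,
        mul_div_cancel_left₀ _ hr'.ne', ENNReal.ofReal_mul hr'.le, ENNReal.ofReal_pow hr'.le]
      ring
    · have hs : Real.sin θ ≤ 0 := by
        refine Real.sin_nonpos_of_nonpos_of_neg_pi_le ?_ hθ.1.le
        by_contra h
        exact hθ0 ⟨not_le.1 h, hθ.2⟩
      rw [indicator_of_notMem (notMem_Ioi.2 (mul_nonpos_of_nonneg_of_nonpos hr'.le hs)),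
        indicator_of_notMem hθ0]
      simp
  rw [hcos]
  have h := hsph.symm.trans hcyl
  rw [mul_left_comm] at h
  exact (ENNReal.mul_right_inj (by simp) ENNReal.ofReal_ne_top).1 h

theorem exists_orthonormalBasis_zero_eq {n : Mom} (hn : ‖n‖ = 1) :
    ∃ b : OrthonormalBasis (Fin 3) ℝ Mom, b 0 = n := by
  have h : Orthonormal ℝ (({0} : Set (Fin 3)).domRestrict fun _ => n) := by
    rw [orthonormal_iff_ite]
    rintro ⟨i, rfl⟩ ⟨j, rfl⟩
    simp [hn]
  obtain ⟨b, hb⟩ := h.exists_orthonormalBasis_extension_of_card_eq (by simp)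
  exact ⟨b, hb 0 rfl⟩

/-- Archimedes' hat-box theorem: the projection of the surface measure of the unit sphere to an axis
is uniform. -/
theorem map_inner_area {n : Mom} (hn : ‖n‖ = 1) :
    area.map (fun ω : S2 => ⟪n, (ω : Mom)⟫_ℝ)
      = ENNReal.ofReal (2 * Real.pi) • volume.restrict (Ioo (-1 : ℝ) 1) := by
  obtain ⟨b, hb⟩ := exists_orthonormalBasis_zero_eq hn
  refine Measure.ext_of_lintegral _ fun F hF => ?_
  rw [lintegral_map hF (by fun_prop), lintegral_smul_measure, smul_eq_mul,
    ← lintegral_sphere_coord hF,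
    ← (measurePreserving_sphereMap b.repr).lintegral_comp_emb (measurableEmbedding_sphereMap b.repr)
      fun ω : S2 => F ((ω : Mom) 0)]
  refine lintegral_congr fun ω => ?_
  rw [coe_sphereMap, b.repr_apply_apply, hb]

theorem lintegral_inner_area {n : Mom} (hn : ‖n‖ = 1) {F : ℝ → ENNReal} (hF : Measurable F) :
    ∫⁻ ω : S2, F ⟪n, (ω : Mom)⟫_ℝ ∂area
      = ENNReal.ofReal (2 * Real.pi) * ∫⁻ u in Ioo (-1 : ℝ) 1, F u := by
  rw [← lintegral_map hF (by fun_prop : Measurable fun ω : S2 => ⟪n, (ω : Mom)⟫_ℝ),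
    map_inner_area hn, lintegral_smul_measure, smul_eq_mul]

theorem integral_inner_area {n : Mom} (hn : ‖n‖ = 1) {F : ℝ → ℝ} (hF : Continuous F) :
    ∫ ω : S2, F ⟪n, (ω : Mom)⟫_ℝ ∂area = 2 * Real.pi * ∫ u in (-1 : ℝ)..1, F u := by
  rw [← integral_map (φ := fun ω : S2 => ⟪n, (ω : Mom)⟫_ℝ) (by fun_prop)
      hF.aestronglyMeasurable, map_inner_area hn, integral_smul_measure,
    ENNReal.toReal_ofReal (by positivity), smul_eq_mul,
    intervalIntegral.integral_of_le (by norm_num), Measure.restrict_congr_set Ioo_ae_eq_Ioc]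

theorem integrable_area_of_continuous {V : Type*} [NormedAddCommGroup V] {F : S2 → V}
    (hF : Continuous F) : Integrable F area :=
  hF.integrable_of_hasCompactSupport (HasCompactSupport.of_compactSpace F)

/-- The reflection changing the sign of the coordinate `k`. -/
noncomputable def flipIso (k : Fin 3) : Mom ≃ₗᵢ[ℝ] Mom :=
  LinearIsometryEquiv.piLpCongrRight 2 fun i =>
    if i = k then LinearIsometryEquiv.neg ℝ else LinearIsometryEquiv.refl ℝ ℝ

theorem flipIso_apply (k : Fin 3) (x : Mom) (i : Fin 3) :
    flipIso k x i = if i = k then -x i else x i := by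
  unfold flipIso
  by_cases h : i = k <;> simp [h]

/-- The exchange of two coordinates. -/
noncomputable def swapIso (k l : Fin 3) : Mom ≃ₗᵢ[ℝ] Mom :=
  LinearIsometryEquiv.piLpCongrLeft 2 ℝ ℝ (Equiv.swap k l)

theorem swapIso_apply (k l : Fin 3) (x : Mom) (i : Fin 3) :
    swapIso k l x i = x (Equiv.swap k l i) := by
  simp [swapIso, LinearIsometryEquiv.piLpCongrLeft_apply, Equiv.piCongrLeft'_apply]

/-- The Funk–Hecke formula for the spherical harmonic `ω_i ω_j` with `i ≠ j`. In a frame whose first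
axis is `n`, the matrix of second moments of `F ⟪n, ω⟫` is diagonal and symmetric under rotations
about `n`. -/
theorem integral_inner_mul_coord_mul_coord {n : Mom} (hn : ‖n‖ = 1) {F : ℝ → ℝ}
    (hF : Continuous F) {i j : Fin 3} (hij : i ≠ j) :
    ∫ ω : S2, F ⟪n, (ω : Mom)⟫_ℝ * ((ω : Mom) i * (ω : Mom) j) ∂area
      = n i * n j * (2 * Real.pi * ∫ u in (-1 : ℝ)..1, F u * ((3 * u ^ 2 - 1) / 2)) := by
  obtain ⟨b, hb⟩ := exists_orthonormalBasis_zero_eq hn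
  -- the second moments in a frame whose first axis is `n`
  set T : Fin 3 → Fin 3 → ℝ := fun k l => ∫ θ : S2, F ((θ : Mom) 0) * ((θ : Mom) k
      * (θ : Mom) l) ∂area
    with hT
  have hint : ∀ k l, Integrable (fun θ : S2 => F ((θ : Mom) 0) * ((θ : Mom) k
      * (θ : Mom) l)) area :=
    fun k l => integrable_area_of_continuous (by fun_prop)
  have hoff : ∀ k l : Fin 3, k ≠ 0 → k ≠ l → T k l = 0 := by
    intro k l hk hkl
    have h := integral_sphereMap (flipIso k)
      fun θ : S2 => F ((θ : Mom) 0) * ((θ : Mom) k * (θ : Mom) l)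
    simp only [coe_sphereMap, flipIso_apply, if_neg hk.symm, if_neg hkl.symm, if_true, neg_mul,
      mul_neg, integral_neg] at h
    simp only [hT]
    linarith
  have hsymm : ∀ k l, T k l = T l k := fun k l => by simp only [hT, mul_comm]
  have h22 : T 2 2 = T 1 1 := by
    have h := integral_sphereMap (swapIso 1 2)
      fun θ : S2 => F ((θ : Mom) 0) * ((θ : Mom) 1 * (θ : Mom) 1)
    simp only [coe_sphereMap, swapIso_apply] at h
    exact h
  have htr : T 0 0 + T 1 1 + T 2 2 = ∫ θ : S2, F ((θ : Mom) 0) ∂area := by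
    rw [← Fin.sum_univ_three fun k => T k k]
    simp only [hT]
    rw [← integral_finsetSum _ fun k _ => hint k k]
    refine integral_congr_ae (Eventually.of_forall fun θ => ?_)
    have h1 : ‖(θ : Mom)‖ ^ 2 = 1 := by simp
    rw [EuclideanSpace.norm_sq_eq, Fin.sum_univ_three] at h1
    simp only [Real.norm_eq_abs, sq_abs] at h1
    simp only [Fin.sum_univ_three]
    linear_combination F ((θ : Mom) 0) * h1
  have hcoord : ∀ (θ : Mom) (k : Fin 3), b.repr.symm θ k = ∑ l, θ l * b l k := fun θ k => by
    rw [← b.sum_repr (b.repr.symm θ)]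
    simp
  have hzero : ∀ θ : Mom, ⟪n, b.repr.symm θ⟫_ℝ = θ 0 := fun θ => by
    rw [← hb, ← b.repr_apply_apply, LinearIsometryEquiv.apply_symm_apply]
  have horth : ∑ k, b k i * b k j = 0 := by
    have :=
        b.sum_inner_mul_inner (EuclideanSpace.single i (1 : ℝ)) (EuclideanSpace.single j (1 : ℝ))
    simpa [EuclideanSpace.inner_single_left, EuclideanSpace.inner_single_right, hij, hij.symm]
      using this
  rw [← integral_sphereMap b.repr.symm]
  simp only [coe_sphereMap, hzero, hcoord]
  have hexp : ∀ θ : S2, F ((θ : Mom) 0) * ((∑ l, (θ : Mom) l * b l i) * ∑ l, (θ : Mom) l * b l j)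
      = ∑ k, ∑ l, (b k i * b l j) * (F ((θ : Mom) 0) * ((θ : Mom) k * (θ : Mom) l)) := fun θ => by
    rw [Finset.sum_mul_sum, Finset.mul_sum]
    refine Finset.sum_congr rfl fun k _ => ?_
    rw [Finset.mul_sum]
    exact Finset.sum_congr rfl fun l _ => by ring
  simp only [hexp]
  rw [integral_finsetSum _ fun k _ => integrable_finsetSum _ fun l _ => (hint k l).const_mul _]
  have hsum : ∀ k, ∫ θ : S2, ∑ l, (b k i * b l j) * (F ((θ : Mom) 0) * ((θ : Mom) k * (θ : Mom) l))
      ∂area = ∑ l, (b k i * b l j) * T k l := fun k => by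
    rw [integral_finsetSum _ fun l _ => (hint k l).const_mul _]
    exact Finset.sum_congr rfl fun l _ => integral_const_mul _ _
  simp only [hsum]
  have hint0 : Integrable (fun θ : S2 => F ((θ : Mom) 0)) area :=
    integrable_area_of_continuous (by fun_prop)
  have hP : T 0 0 - T 1 1 = 2 * Real.pi * ∫ u in (-1 : ℝ)..1, F u * ((3 * u ^ 2 - 1) / 2) := by
    rw [← integral_inner_area hn (F := fun u => F u * ((3 * u ^ 2 - 1) / 2)) (by fun_prop),
      ← integral_sphereMap b.repr.symm]
    simp only [coe_sphereMap, hzero]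
    have h1 : ∫ θ : S2, F ((θ : Mom) 0) * ((3 * (θ : Mom) 0 ^ 2 - 1) / 2) ∂area
        = (3 / 2) * T 0 0 - (1 / 2) * ∫ θ : S2, F ((θ : Mom) 0) ∂area := by
      simp only [hT]
      rw [← integral_const_mul, ← integral_const_mul, ← integral_sub ((hint 0 0).const_mul _)
        (hint0.const_mul _)]
      exact integral_congr_ae (Eventually.of_forall fun θ => by simp only; ring)
    rw [h1]
    linarith
  rw [← hP, Fin.sum_univ_three, Fin.sum_univ_three, Fin.sum_univ_three, Fin.sum_univ_three]
  rw [Fin.sum_univ_three] at horth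
  rw [hsymm 0 1, hsymm 0 2, hoff 1 0 (by decide) (by decide), hoff 2 0 (by decide) (by decide),
    hoff 1 2 (by decide) (by decide), hoff 2 1 (by decide) (by decide), h22, ← hb]
  linear_combination T 1 1 * horth

end SphereIntegral

/-! ### Collision kinematics -/

namespace Kinematics

open scoped Pointwise
open MasslessGas SphereIntegral

/-- The momentum of a massless particle emitted in the direction `ω`, in the rest frame, by a pair
of total energy `E` and total momentum `P`. -/
noncomputable def emission (E : ℝ) (P ω : Mom) : Mom :=
  (1 / 2 : ℝ) • (P + Real.sqrt (E ^ 2 - ‖P‖ ^ 2) • ω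
    + (⟪P, ω⟫_ℝ / (E + Real.sqrt (E ^ 2 - ‖P‖ ^ 2))) • P)

theorem outgoing_eq_emission (p p' : Mom) (ω : S2) :
    outgoing p p' ω = emission (‖p‖ + ‖p'‖) (p + p') ω := rfl

/-- The second particle is emitted in the opposite direction. -/
theorem sub_emission (E : ℝ) (P ω : Mom) : P - emission E P ω = emission E P (-ω) := by
  unfold emission
  rw [inner_neg_right]
  match_scalars <;> ring

theorem abs_inner_le_norm_of_unit {P ω : Mom} (hω : ‖ω‖ = 1) : |⟪P, ω⟫_ℝ| ≤ ‖P‖ := by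
  have := abs_real_inner_le_norm P ω
  rwa [hω, mul_one] at this

theorem norm_emission {E : ℝ} {P ω : Mom} (hP : ‖P‖ ≤ E) (hω : ‖ω‖ = 1) :
    ‖emission E P ω‖ = (E + ⟪P, ω⟫_ℝ) / 2 := by
  have hin := abs_le.1 (abs_inner_le_norm_of_unit (P := P) hω)
  have hE : 0 ≤ E := (norm_nonneg P).trans hP
  have h0 : 0 ≤ E ^ 2 - ‖P‖ ^ 2 := by nlinarith [norm_nonneg P]
  set R := Real.sqrt (E ^ 2 - ‖P‖ ^ 2) with hR
  have hR0 : 0 ≤ R := Real.sqrt_nonneg _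
  have hR2 : R ^ 2 = E ^ 2 - ‖P‖ ^ 2 := Real.sq_sqrt h0
  obtain ⟨c, hc⟩ : ∃ c, c = ⟪P, ω⟫_ℝ / (E + R) := ⟨_, rfl⟩
  -- for `E = 0` the quotient has the value `0`, and `P` vanishes as well
  have hcE : c * (E + R) = ⟪P, ω⟫_ℝ := by
    rcases (add_nonneg hE hR0).eq_or_lt with h | h
    · have hE0 : E = 0 := by linarith
      have : ⟪P, ω⟫_ℝ = 0 := by
        have := norm_nonneg P
        have h3 : ‖P‖ = 0 := by linarith
        rw [norm_eq_zero.1 h3, inner_zero_left]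
      rw [← h, this, mul_zero]
    · rw [hc, div_mul_cancel₀ _ h.ne']
  rw [← sq_eq_sq₀ (norm_nonneg _) (by linarith [hin.1])]
  have h1 : emission E P ω = (1 / 2 : ℝ) • ((1 + c) • P + R • ω) := by
    unfold emission
    rw [← hR, ← hc]
    match_scalars <;> ring
  rw [h1, norm_smul, mul_pow, norm_add_sq_real, norm_smul, norm_smul, inner_smul_left,
    inner_smul_right, hω]
  simp only [Real.norm_eq_abs, mul_pow, sq_abs, conj_trivial]
  rw [← hcE]
  linear_combination (1 / 4) * (1 + c) ^ 2 * hR2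

theorem norm_sub_emission {E : ℝ} {P ω : Mom} (hP : ‖P‖ ≤ E) (hω : ‖ω‖ = 1) :
    ‖P - emission E P ω‖ = (E - ⟪P, ω⟫_ℝ) / 2 := by
  rw [sub_emission, norm_emission hP (by rwa [norm_neg]), inner_neg_right]
  ring

/-- The total energy of a pair with invariant mass `√s = r`, that is with rest-frame momenta of
length `r / 2`, and total momentum `P`. -/
noncomputable def pairEnergy (r : ℝ) (P : Mom) : ℝ := Real.sqrt (r ^ 2 + ‖P‖ ^ 2)

theorem norm_lt_pairEnergy {r : ℝ} (hr : 0 < r) (P : Mom) : ‖P‖ < pairEnergy r P :=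
  Real.lt_sqrt_of_sq_lt (by nlinarith [sq_pos_of_pos hr])

theorem pairEnergy_sq (r : ℝ) (P : Mom) : pairEnergy r P ^ 2 = r ^ 2 + ‖P‖ ^ 2 :=
  Real.sq_sqrt (by positivity)

theorem pairEnergy_pos {r : ℝ} (hr : 0 < r) (P : Mom) : 0 < pairEnergy r P :=
  (norm_nonneg P).trans_lt (norm_lt_pairEnergy hr P)

/-- The coefficient of `P` in `fromRest`. -/
noncomputable def boostCoeff (P x : Mom) : ℝ :=
  ⟪P, x⟫_ℝ / (‖x‖ * (pairEnergy ‖x‖ P + ‖x‖))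

/-- The emitted momentum as a function of the vector `x = √s ω`, at fixed total momentum `P`. -/
noncomputable def fromRest (P x : Mom) : Mom := (1 / 2 : ℝ) • (P + x + boostCoeff P x • P)

theorem fromRest_smul (P : Mom) {ω : Mom} (hω : ‖ω‖ = 1) {r : ℝ} (hr : 0 < r) :
    fromRest P (r • ω) = emission (pairEnergy r P) P ω := by
  have h1 : ‖r • ω‖ = r := by rw [norm_smul, hω, Real.norm_eq_abs, abs_of_pos hr, mul_one]
  unfold fromRest emission boostCoeff
  rw [h1, pairEnergy_sq, add_sub_cancel_right, Real.sqrt_sq hr.le, inner_smul_right,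
    mul_div_mul_left _ _ hr.ne']

theorem fromRest_eq {P x : Mom} (hx : x ≠ 0) :
    fromRest P x = emission (pairEnergy ‖x‖ P) P (‖x‖⁻¹ • x) := by
  have hr : 0 < ‖x‖ := norm_pos_iff.2 hx
  have h1 : ‖‖x‖⁻¹ • x‖ = 1 := by rw [norm_smul, norm_inv, norm_norm, inv_mul_cancel₀ hr.ne']
  rw [← fromRest_smul P h1 hr, smul_smul, mul_inv_cancel₀ hr.ne', one_smul]

theorem norm_fromRest {P x : Mom} (hx : x ≠ 0) :
    ‖fromRest P x‖ = (pairEnergy ‖x‖ P + ⟪P, x⟫_ℝ / ‖x‖) / 2 := by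
  have hr : 0 < ‖x‖ := norm_pos_iff.2 hx
  rw [fromRest_eq hx, norm_emission (norm_lt_pairEnergy hr P).le
    (by rw [norm_smul, norm_inv, norm_norm, inv_mul_cancel₀ hr.ne']), inner_smul_right]
  ring

theorem norm_sub_fromRest {P x : Mom} (hx : x ≠ 0) :
    ‖P - fromRest P x‖ = (pairEnergy ‖x‖ P - ⟪P, x⟫_ℝ / ‖x‖) / 2 := by
  have hr : 0 < ‖x‖ := norm_pos_iff.2 hx
  rw [fromRest_eq hx, norm_sub_emission (norm_lt_pairEnergy hr P).le
    (by rw [norm_smul, norm_inv, norm_norm, inv_mul_cancel₀ hr.ne']), inner_smul_right]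
  ring

theorem abs_inner_div_norm_lt (P : Mom) {x : Mom} (hx : x ≠ 0) :
    |⟪P, x⟫_ℝ / ‖x‖| < pairEnergy ‖x‖ P := by
  have hr : 0 < ‖x‖ := norm_pos_iff.2 hx
  refine lt_of_le_of_lt ?_ (norm_lt_pairEnergy hr P)
  rw [abs_div, abs_of_pos hr, div_le_iff₀ hr]
  exact abs_real_inner_le_norm P x

theorem injOn_fromRest (P : Mom) : InjOn (fromRest P) {0}ᶜ := by
  intro x hx y hy h
  have hx0 : x ≠ 0 := hx
  have hy0 : y ≠ 0 := hy
  have h1 := norm_fromRest (P := P) hx0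
  have h2 := norm_sub_fromRest (P := P) hx0
  rw [h, norm_fromRest hy0] at h1
  rw [h, norm_sub_fromRest hy0] at h2
  have h3 : pairEnergy ‖x‖ P = pairEnergy ‖y‖ P := by linarith
  have h4 : ⟪P, x⟫_ℝ / ‖x‖ = ⟪P, y⟫_ℝ / ‖y‖ := by linarith
  have h5 : ‖x‖ = ‖y‖ := by
    have a := pairEnergy_sq ‖x‖ P
    rw [h3, pairEnergy_sq] at a
    exact (sq_eq_sq₀ (norm_nonneg _) (norm_nonneg _)).1 (by linarith)
  have h6 : boostCoeff P x = boostCoeff P y := by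
    unfold boostCoeff
    rw [← div_div, ← div_div, h4, h5]
  unfold fromRest at h
  rw [h6] at h
  have := smul_right_injective Mom (by norm_num : (1 / 2 : ℝ) ≠ 0) h
  simpa using this

/-- Every momentum off the segment from `0` to `P` is emitted by some pair of total momentum `P`. -/
theorem image_fromRest (P : Mom) :
    fromRest P '' {0}ᶜ = {q | ‖P‖ < ‖q‖ + ‖P - q‖} := by
  ext q
  constructor
  · rintro ⟨x, hx, rfl⟩
    have hx0 : x ≠ 0 := hx
    rw [mem_ofPred_eq, norm_fromRest hx0, norm_sub_fromRest hx0]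
    have := norm_lt_pairEnergy (norm_pos_iff.2 hx0) P
    linarith
  · intro hq
    rw [mem_ofPred_eq] at hq
    obtain ⟨E, hE⟩ : ∃ E, E = ‖q‖ + ‖P - q‖ := ⟨_, rfl⟩
    obtain ⟨d, hd⟩ : ∃ d, d = ‖q‖ - ‖P - q‖ := ⟨_, rfl⟩
    rw [← hE] at hq
    have hP0 := norm_nonneg P
    have h0 : 0 < E ^ 2 - ‖P‖ ^ 2 := by nlinarith
    obtain ⟨r, hr⟩ : ∃ r, r = Real.sqrt (E ^ 2 - ‖P‖ ^ 2) := ⟨_, rfl⟩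
    have hr0 : 0 < r := hr ▸ Real.sqrt_pos.2 h0
    have hr2 : r ^ 2 = E ^ 2 - ‖P‖ ^ 2 := hr ▸ Real.sq_sqrt h0.le
    obtain ⟨c, hc⟩ : ∃ c, c = d / (E + r) := ⟨_, rfl⟩
    have hcE : c * (E + r) = d := by
      rw [hc]
      exact div_mul_cancel₀ _ (by linarith)
    have hPq : 2 * ⟪P, q⟫_ℝ = E * d + ‖P‖ ^ 2 := by
      have := norm_sub_sq_real P q
      have h2 : E * d = ‖q‖ ^ 2 - ‖P - q‖ ^ 2 := by rw [hE, hd]; ring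
      rw [h2, this]; ring
    set x : Mom := (2 : ℝ) • q - (1 + c) • P with hx
    have hPx : ⟪P, x⟫_ℝ = r * d := by
      rw [hx, inner_sub_right, inner_smul_right, inner_smul_right, real_inner_self_eq_norm_sq, hPq]
      linear_combination (r - E) * hcE - c * hr2
    have hxr : ‖x‖ = r := by
      rw [← sq_eq_sq₀ (norm_nonneg _) hr0.le]
      rw [hx, norm_sub_sq_real, norm_smul, norm_smul, inner_smul_left, inner_smul_right,
        real_inner_comm]
      simp only [Real.norm_eq_abs, mul_pow, sq_abs, conj_trivial]
      have h4 : ‖q‖ = (E + d) / 2 := by rw [hE, hd]; ring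
      rw [h4]
      have h5 : ⟪P, q⟫_ℝ = (E * d + ‖P‖ ^ 2) / 2 := by linarith
      rw [h5, ← hcE]
      linear_combination (c ^ 2 - 1) * hr2
    have hEp : pairEnergy r P = E := by
      unfold pairEnergy
      rw [hr2, sub_add_cancel, Real.sqrt_sq (hP0.trans hq.le)]
    refine ⟨x, ?_, ?_⟩
    · rw [mem_compl_singleton_iff, ← norm_pos_iff, hxr]
      exact hr0
    · unfold fromRest boostCoeff
      rw [hxr, hEp, hPx, mul_div_mul_left _ _ hr0.ne', ← hc, hx]
      match_scalars <;> ring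

/-- Equality in the triangle inequality forces `q` to be a multiple of `P`. -/
theorem volume_segment_eq_zero (P : Mom) : volume {q : Mom | ‖P‖ < ‖q‖ + ‖P - q‖}ᶜ = 0 := by
  have hne : (Submodule.span ℝ {P} : Submodule ℝ Mom) ≠ ⊤ := by
    intro h
    have h1 := finrank_span_le_card (R := ℝ) ({P} : Set Mom)
    rw [h, finrank_top] at h1
    simp at h1
  refine measure_mono_null (fun q hq => ?_) (Measure.addHaar_submodule volume _ hne)
  rw [mem_compl_iff, mem_ofPred_eq, not_lt] at hq
  have h1 : ‖q + (P - q)‖ = ‖q‖ + ‖P - q‖ := by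
    refine le_antisymm (norm_add_le _ _) ?_
    rwa [add_sub_cancel]
  obtain ⟨a, b, -, -, -, h, -⟩ := (sameRay_iff_norm_add.2 h1).exists_eq_smul_add
  rw [add_sub_cancel] at h
  rw [SetLike.mem_coe, h]
  exact Submodule.smul_mem _ _ (Submodule.mem_span_singleton_self P)

theorem differentiableAt_boostCoeff (P : Mom) {x : Mom} (hx : x ≠ 0) :
    DifferentiableAt ℝ (boostCoeff P) x := by
  have hr : 0 < ‖x‖ := norm_pos_iff.2 hx
  have h1 : DifferentiableAt ℝ (fun y : Mom => ‖y‖) x := differentiableAt_id.norm ℝ hx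
  have h2 : DifferentiableAt ℝ (fun y : Mom => pairEnergy ‖y‖ P) x := by
    unfold pairEnergy
    have h3 : DifferentiableAt ℝ (fun y : Mom => ‖y‖ ^ 2 + ‖P‖ ^ 2) x := (h1.pow 2).add_const _
    exact h3.sqrt (by positivity)
  unfold boostCoeff
  have h4 : DifferentiableAt ℝ (fun y : Mom => ⟪P, y⟫_ℝ) x :=
    (differentiableAt_const P).inner ℝ differentiableAt_id
  have h5 : DifferentiableAt ℝ (fun y : Mom => ‖y‖ * (pairEnergy ‖y‖ P + ‖y‖)) x :=
    h1.mul (h2.add h1)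
  have h6 : ‖x‖ * (pairEnergy ‖x‖ P + ‖x‖) ≠ 0 := by
    have := pairEnergy_pos hr P
    positivity
  simp only [div_eq_mul_inv]
  exact h4.mul (h5.inv h6)

/-- The derivative of `boostCoeff P` in the direction `P`. -/
theorem fderiv_boostCoeff_apply (P : Mom) {x : Mom} (hx : x ≠ 0) :
    1 + fderiv ℝ (boostCoeff P) x P
      = (pairEnergy ‖x‖ P ^ 2 - (⟪P, x⟫_ℝ / ‖x‖) ^ 2) / (‖x‖ * pairEnergy ‖x‖ P) := by
  have hr : 0 < ‖x‖ := norm_pos_iff.2 hx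
  have hE := pairEnergy_pos hr P
  have hE2 := pairEnergy_sq ‖x‖ P
  have hline : HasDerivAt (fun t : ℝ => x + t • P) P 0 := by
    simpa using ((hasDerivAt_id (0 : ℝ)).smul_const P).const_add x
  have h1 : HasDerivAt (fun t : ℝ => boostCoeff P (x + t • P)) (fderiv ℝ (boostCoeff P) x P) 0 := by
    have h := (differentiableAt_boostCoeff P hx).hasFDerivAt
    have h' : HasFDerivAt (boostCoeff P) (fderiv ℝ (boostCoeff P) x) (x + (0 : ℝ) • P) := by
      simpa using h
    exact h'.comp_hasDerivAt 0 hline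
  have hn : HasDerivAt (fun t : ℝ => ‖x + t • P‖) (⟪x, P⟫_ℝ / ‖x‖) 0 := by
    have h := (hline.norm_sq).sqrt (by simpa using hr.ne')
    simp only [Real.sqrt_sq (norm_nonneg _), zero_smul, add_zero] at h
    convert! h using 1
    field_simp
  have hEd : HasDerivAt (fun t : ℝ => pairEnergy ‖x + t • P‖ P)
      (⟪x, P⟫_ℝ / pairEnergy ‖x‖ P) 0 := by
    unfold pairEnergy at hE ⊢
    have h := ((hn.pow 2).add_const (‖P‖ ^ 2)).sqrt (by simp; positivity)
    simp only [zero_smul, add_zero, Pi.pow_apply] at h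
    convert! h using 1
    field_simp
    push_cast
    ring
  have hin : HasDerivAt (fun t : ℝ => ⟪P, x + t • P⟫_ℝ) (‖P‖ ^ 2) 0 := by
    have h := (hasDerivAt_const (0 : ℝ) P).inner ℝ hline
    simpa using h
  have h2 := hin.div (hn.mul (hEd.add hn)) (by simp; exact ⟨hx, by positivity⟩)
  have h3 := h1.unique h2
  rw [h3]
  simp only [Pi.add_apply, Pi.mul_apply, zero_smul, add_zero]
  rw [real_inner_comm P x]
  obtain ⟨E, hEdef⟩ : ∃ E, E = pairEnergy ‖x‖ P := ⟨_, rfl⟩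
  rw [← hEdef] at hE hE2 ⊢
  have hP2 : ‖P‖ ^ 2 = E ^ 2 - ‖x‖ ^ 2 := by linarith
  rw [hP2]
  have : E + ‖x‖ ≠ 0 := by positivity
  field_simp
  ring

theorem hasFDerivAt_fromRest (P : Mom) {x : Mom} (hx : x ≠ 0) :
    HasFDerivAt (fromRest P) ((1 / 2 : ℝ) • (ContinuousLinearMap.id ℝ Mom
      + (fderiv ℝ (boostCoeff P) x).smulRight P)) x := by
  unfold fromRest
  have h := ((hasFDerivAt_id (𝕜 := ℝ) x).const_add P).add
    ((differentiableAt_boostCoeff P hx).hasFDerivAt.smul_const P)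
  exact h.const_smul (1 / 2 : ℝ)

/-- The Jacobian of `fromRest P`. The derivative is half of a transvection `id + dc ⊗ P`, whose
determinant is `1 + dc P`. -/
theorem det_fromRest (P : Mom) {x : Mom} (hx : x ≠ 0) :
    ((1 / 2 : ℝ) • (ContinuousLinearMap.id ℝ Mom
      + (fderiv ℝ (boostCoeff P) x).smulRight P)).det
      = ‖fromRest P x‖ * ‖P - fromRest P x‖ / (2 * ‖x‖ * pairEnergy ‖x‖ P) := by
  have h1 : (((1 / 2 : ℝ) • (ContinuousLinearMap.id ℝ Mom
      + (fderiv ℝ (boostCoeff P) x).smulRight P) : Mom →L[ℝ] Mom) : Mom →ₗ[ℝ] Mom)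
      = (1 / 2 : ℝ) • LinearMap.transvection (fderiv ℝ (boostCoeff P) x : Mom →ₗ[ℝ] ℝ) P := by
    ext v : 1
    simp [LinearMap.transvection.apply]
  rw [ContinuousLinearMap.det, h1, LinearMap.det_smul, LinearMap.transvection.det]
  have h2 := fderiv_boostCoeff_apply P hx
  simp only [ContinuousLinearMap.coe_coe]
  rw [h2, norm_fromRest hx, norm_sub_fromRest hx]
  simp only [finrank_euclideanSpace, Fintype.card_fin]
  have hr : 0 < ‖x‖ := norm_pos_iff.2 hx
  have hE := pairEnergy_pos hr P
  obtain ⟨u, hu⟩ : ∃ u, u = ⟪P, x⟫_ℝ / ‖x‖ := ⟨_, rfl⟩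
  rw [← hu]
  field_simp
  ring

theorem measurable_pairEnergy (P : Mom) : Measurable fun r : ℝ => pairEnergy r P := by
  unfold pairEnergy
  fun_prop

theorem measurable_fromRest (P : Mom) : Measurable (fromRest P) := by
  unfold fromRest boostCoeff pairEnergy
  fun_prop

/-- The change of variables from the momentum `q` to the rest frame of the pair `(q, P - q)`. -/
theorem lintegral_pair (P : Mom) {Ψ : Mom → ENNReal} (hΨ : Measurable Ψ) :
    ∫⁻ q, ENNReal.ofReal (1 / (‖q‖ * ‖P - q‖)) * Ψ q
      = ∫⁻ ω : S2, (∫⁻ r in Ioi (0 : ℝ), ENNReal.ofReal (r / (2 * pairEnergy r P))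
          * Ψ (emission (pairEnergy r P) P ω)) ∂area := by
  have h1 : ∫⁻ q, ENNReal.ofReal (1 / (‖q‖ * ‖P - q‖)) * Ψ q
      = ∫⁻ q in fromRest P '' {0}ᶜ, ENNReal.ofReal (1 / (‖q‖ * ‖P - q‖)) * Ψ q := by
    rw [image_fromRest, Measure.restrict_eq_self_of_ae_mem]
    exact mem_ae_iff.2 (volume_segment_eq_zero P)
  rw [h1, lintegral_image_eq_lintegral_abs_det_fderiv_mul volume
    (measurableSet_singleton (0 : Mom)).compl
    (fun x hx => (hasFDerivAt_fromRest P hx).hasFDerivWithinAt) (injOn_fromRest P)]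
  have h2 : ∀ x ∈ ({0}ᶜ : Set Mom), ENNReal.ofReal |((1 / 2 : ℝ) • (ContinuousLinearMap.id ℝ Mom
      + (fderiv ℝ (boostCoeff P) x).smulRight P)).det|
      * (ENNReal.ofReal (1 / (‖fromRest P x‖ * ‖P - fromRest P x‖)) * Ψ (fromRest P x))
      = ENNReal.ofReal (1 / (2 * ‖x‖ * pairEnergy ‖x‖ P)) * Ψ (fromRest P x) := by
    intro x hx
    have hx0 : x ≠ 0 := hx
    have hr : 0 < ‖x‖ := norm_pos_iff.2 hx0
    have hE := pairEnergy_pos hr P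
    have hu := abs_lt.1 (abs_inner_div_norm_lt P hx0)
    have hq1 : 0 < ‖fromRest P x‖ := by rw [norm_fromRest hx0]; linarith [hu.1]
    have hq2 : 0 < ‖P - fromRest P x‖ := by rw [norm_sub_fromRest hx0]; linarith [hu.2]
    rw [det_fromRest P hx0, ← mul_assoc, ← ENNReal.ofReal_mul (abs_nonneg _),
      abs_of_pos (by positivity)]
    congr 2
    field_simp
  rw [setLIntegral_congr_fun (measurableSet_singleton (0 : Mom)).compl h2, restrict_compl_singleton,
    lintegral_polar (n := 2) (by
      refine Measurable.mul ?_ (hΨ.comp (measurable_fromRest P))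
      have : Measurable fun x : Mom => pairEnergy ‖x‖ P :=
        (measurable_pairEnergy P).comp measurable_norm
      fun_prop)]
  refine lintegral_congr fun ω => setLIntegral_congr_fun measurableSet_Ioi fun r hr => ?_
  have hr' : 0 < r := hr
  have hω : ‖(ω : Mom)‖ = 1 := by simp
  have hE := pairEnergy_pos hr' P
  have h3 : ‖r • (ω : Mom)‖ = r := by rw [norm_smul, hω, Real.norm_eq_abs, abs_of_pos hr', mul_one]
  rw [h3, fromRest_smul P hω hr', ← mul_assoc, ← ENNReal.ofReal_mul (by positivity)]
  congr 2
  field_simp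

theorem measurable_emission {X : Type*} [MeasurableSpace X] {E : X → ℝ} {P ω : X → Mom}
    (hE : Measurable E) (hP : Measurable P) (hω : Measurable ω) :
    Measurable fun x => emission (E x) (P x) (ω x) := by
  unfold emission
  fun_prop

/-- Detailed balance at fixed total momentum. In the rest frame both pairs are parametrised by their
direction, with the same weight. -/
theorem lintegral_emission_symm (P : Mom) {F : Mom → Mom → ENNReal}
    (hF : Measurable (Function.uncurry F)) :
    ∫⁻ q, ENNReal.ofReal (1 / (‖q‖ * ‖P - q‖)) *
        ∫⁻ ω : S2, F q (emission (‖q‖ + ‖P - q‖) P ω) ∂area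
      = ∫⁻ q, ENNReal.ofReal (1 / (‖q‖ * ‖P - q‖)) *
        ∫⁻ ω : S2, F (emission (‖q‖ + ‖P - q‖) P ω) q ∂area := by
  have key : ∀ F : Mom → Mom → ENNReal, Measurable (Function.uncurry F) →
      ∫⁻ q, ENNReal.ofReal (1 / (‖q‖ * ‖P - q‖)) *
        ∫⁻ ω : S2, F q (emission (‖q‖ + ‖P - q‖) P ω) ∂area
      = ∫⁻ r in Ioi (0 : ℝ), ENNReal.ofReal (r / (2 * pairEnergy r P)) *
        ∫⁻ ω' : S2, (∫⁻ ω : S2, F (emission (pairEnergy r P) P ω') (emission (pairEnergy r P) P ω)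
          ∂area) ∂area := by
    intro F hF
    have hm1 : Measurable fun q : Mom => ∫⁻ ω : S2, F q (emission (‖q‖ + ‖P - q‖) P ω) ∂area := by
      refine Measurable.lintegral_prod_right' (f := fun x : Mom × S2 =>
        F x.1 (emission (‖x.1‖ + ‖P - x.1‖) P x.2)) ?_
      exact hF.comp (measurable_fst.prodMk (measurable_emission (by fun_prop) (by fun_prop)
        (by fun_prop)))
    rw [lintegral_pair P hm1]
    have hpe := measurable_pairEnergy P
    have hm2 : Measurable fun x : S2 × ℝ => ENNReal.ofReal (x.2 / (2 * pairEnergy x.2 P)) *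
        ∫⁻ ω : S2,
            F (emission (pairEnergy x.2 P) P x.1) (emission (pairEnergy x.2 P) P ω) ∂area := by
      have hpe2 : Measurable fun x : S2 × ℝ => pairEnergy x.2 P := hpe.comp measurable_snd
      refine Measurable.mul (by fun_prop) ?_
      refine Measurable.lintegral_prod_right' (f := fun x : (S2 × ℝ) × S2 =>
        F (emission (pairEnergy x.1.2 P) P x.1.1) (emission (pairEnergy x.1.2 P) P x.2)) ?_
      have hpe3 : Measurable fun x : (S2 × ℝ) × S2 => pairEnergy x.1.2 P :=
        hpe2.comp measurable_fst
      exact hF.comp ((measurable_emission hpe3 (by fun_prop) (by fun_prop)).prodMk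
        (measurable_emission hpe3 (by fun_prop) (by fun_prop)))
    have h1 : ∀ ω' : S2, ∫⁻ r in Ioi (0 : ℝ), ENNReal.ofReal (r / (2 * pairEnergy r P)) *
        ∫⁻ ω : S2, F (emission (pairEnergy r P) P ω') (emission (‖emission (pairEnergy r P) P ω'‖
          + ‖P - emission (pairEnergy r P) P ω'‖) P ω) ∂area
        = ∫⁻ r in Ioi (0 : ℝ), ENNReal.ofReal (r / (2 * pairEnergy r P)) *
        ∫⁻ ω : S2, F (emission (pairEnergy r P) P ω') (emission (pairEnergy r P) P ω) ∂area := by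
      intro ω'
      refine setLIntegral_congr_fun measurableSet_Ioi fun r hr => ?_
      have hω : ‖(ω' : Mom)‖ = 1 := by simp
      have hP := (norm_lt_pairEnergy hr P).le
      rw [norm_emission hP hω, norm_sub_emission hP hω]
      congr! 5
      ring
    simp only [h1]
    rw [lintegral_lintegral_swap hm2.aemeasurable]
    refine lintegral_congr fun r => ?_
    rw [lintegral_const_mul' _ _ ENNReal.ofReal_ne_top]
  rw [key F hF]
  have := key (fun a b => F b a) (hF.comp measurable_swap)
  rw [this]
  refine lintegral_congr fun r => ?_
  congr 1
  refine lintegral_lintegral_swap (Measurable.aemeasurable ?_)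
  exact hF.comp ((measurable_emission measurable_const measurable_const (by fun_prop)).prodMk
        (measurable_emission measurable_const measurable_const (by fun_prop)))

theorem lintegral_lintegral_eq_total {g : Mom → Mom → ENNReal}
    (hg : Measurable (Function.uncurry g)) :
    ∫⁻ p, ∫⁻ p', g p p' = ∫⁻ P, ∫⁻ p, g p (P - p) := by
  have h1 : ∀ p, ∫⁻ p', g p p' = ∫⁻ P, g p (P - p) := fun p =>
    (lintegral_sub_right_eq_self (fun p' => g p p') p).symm
  simp only [h1]
  refine lintegral_lintegral_swap (Measurable.aemeasurable ?_)
  exact hg.comp (measurable_fst.prodMk (measurable_snd.sub measurable_fst))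

theorem measurable_outgoing : Measurable fun x : (Mom × Mom) × S2 => outgoing x.1.1 x.1.2 x.2 := by
  have : (fun x : (Mom × Mom) × S2 => outgoing x.1.1 x.1.2 x.2)
      = fun x => emission (‖x.1.1‖ + ‖x.1.2‖) (x.1.1 + x.1.2) x.2 := rfl
  rw [this]
  exact measurable_emission (by fun_prop) (by fun_prop) (by fun_prop)

/-- Detailed balance: the invariant measure on collisions does not change when the incoming and the
outgoing pair are exchanged. -/
theorem lintegral_collision_symm {F : Mom × Mom → Mom × Mom → ENNReal}
    (hF : Measurable (Function.uncurry F)) :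
    ∫⁻ p : Mom, ∫⁻ p' : Mom, ENNReal.ofReal (1 / (‖p‖ * ‖p'‖)) *
        ∫⁻ ω : S2, F (p, p') (outgoing p p' ω, p + p' - outgoing p p' ω) ∂area
      = ∫⁻ p : Mom, ∫⁻ p' : Mom, ENNReal.ofReal (1 / (‖p‖ * ‖p'‖)) *
        ∫⁻ ω : S2, F (outgoing p p' ω, p + p' - outgoing p p' ω) (p, p') ∂area := by
  have hout := measurable_outgoing
  have hpair : Measurable fun x : (Mom × Mom) × S2 =>
      (outgoing x.1.1 x.1.2 x.2, x.1.1 + x.1.2 - outgoing x.1.1 x.1.2 x.2) :=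
    hout.prodMk ((by fun_prop : Measurable fun x : (Mom × Mom) × S2 => x.1.1 + x.1.2).sub hout)
  have hm : ∀ G : Mom × Mom → Mom × Mom → ENNReal, Measurable (Function.uncurry G) →
      Measurable (Function.uncurry fun p p' : Mom => ENNReal.ofReal (1 / (‖p‖ * ‖p'‖)) *
        ∫⁻ ω : S2, G (p, p') (outgoing p p' ω, p + p' - outgoing p p' ω) ∂area) := by
    intro G hG
    have h : Measurable fun x : Mom × Mom => ∫⁻ ω : S2, G x
        (outgoing x.1 x.2 ω, x.1 + x.2 - outgoing x.1 x.2 ω) ∂area :=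
      Measurable.lintegral_prod_right' (f := fun x : (Mom × Mom) × S2 => G x.1
        (outgoing x.1.1 x.1.2 x.2, x.1.1 + x.1.2 - outgoing x.1.1 x.1.2 x.2))
        (hG.comp (measurable_fst.prodMk hpair))
    exact Measurable.mul (by fun_prop) h
  rw [lintegral_lintegral_eq_total (hm F hF),
    lintegral_lintegral_eq_total (hm (fun a b => F b a) (hF.comp measurable_swap))]
  refine lintegral_congr fun P => ?_
  simp only [add_sub_cancel, outgoing_eq_emission]
  have := lintegral_emission_symm P (F := fun a b => F (a, P - a) (b, P - b))
    (hF.comp (by fun_prop : Measurable fun x : Mom × Mom => ((x.1, P - x.1), (x.2, P - x.2))))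
  exact this

end Kinematics

/-! ### The measure on collisions -/

namespace Collision

open MasslessGas SphereIntegral Kinematics

theorem integrableOn_pow_mul_exp {β : ℝ} (hβ : 0 < β) (k : ℕ) :
    IntegrableOn (fun r : ℝ => r ^ k * Real.exp (-(β * r))) (Ioi 0) := by
  have h := integrableOn_rpow_mul_exp_neg_mul_rpow (p := 1) (s := k) (b := β)
    (by have := Nat.cast_nonneg (α := ℝ) k; linarith) zero_lt_one hβ
  refine h.congr_fun (fun r _ => ?_) measurableSet_Ioi
  simp [Real.rpow_natCast]

theorem integral_pow_mul_exp {β : ℝ} (hβ : 0 < β) (k : ℕ) :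
    ∫ r in Ioi (0 : ℝ), r ^ k * Real.exp (-(β * r)) = k.factorial / β ^ (k + 1) := by
  have h := Real.integral_rpow_mul_exp_neg_mul_Ioi (a := (k : ℝ) + 1) (r := β) (by positivity) hβ
  rw [Real.Gamma_nat_eq_factorial] at h
  have h2 : ((1 : ℝ) / β) ^ ((k : ℝ) + 1) = 1 / β ^ (k + 1) := by
    rw [← Nat.cast_succ, Real.rpow_natCast, div_pow, one_pow]
  rw [h2] at h
  rw [div_eq_inv_mul, ← one_div, ← h]
  refine setIntegral_congr_fun measurableSet_Ioi fun r _ => ?_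
  simp

theorem lintegral_pow_mul_exp {β : ℝ} (hβ : 0 < β) (k : ℕ) :
    ∫⁻ r in Ioi (0 : ℝ), ENNReal.ofReal (r ^ k * Real.exp (-(β * r)))
      = ENNReal.ofReal (k.factorial / β ^ (k + 1)) := by
  rw [← integral_pow_mul_exp hβ,
      ofReal_integral_eq_lintegral_ofReal (integrableOn_pow_mul_exp hβ k)]
  filter_upwards [ae_restrict_mem measurableSet_Ioi] with r hr
  have : 0 < r := hr
  positivity

/-- The density of the invariant one-particle measure `f^eq_p d³p / ((2π)³ p⁰)`. -/
noncomputable def invDens (α β : ℝ) (p : Mom) : ℝ := feq α β p / ((2 * Real.pi) ^ 3 * ‖p‖)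

/-- The invariant one-particle measure `f^eq_p d³p / ((2π)³ p⁰)`. -/
noncomputable def invMeasure (α β : ℝ) : Measure Mom :=
  (volume : Measure Mom).withDensity fun p => ENNReal.ofReal (invDens α β p)

/-- The uniform probability measure on the unit sphere. -/
noncomputable def unif : Measure S2 := ENNReal.ofReal (4 * Real.pi)⁻¹ • area

variable {α β : ℝ}

theorem invDens_nonneg (p : Mom) : 0 ≤ invDens α β p := by
  unfold invDens feq
  positivity

@[fun_prop]
theorem measurable_invDens : Measurable (invDens α β) := by
  unfold invDens feq
  fun_prop

instance : IsProbabilityMeasure unif := by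
  constructor
  rw [unif, Measure.smul_apply, area_univ, smul_eq_mul, ← ENNReal.ofReal_mul (by positivity),
    inv_mul_cancel₀ (by positivity), ENNReal.ofReal_one]

instance : SFinite (invMeasure α β) := by
  unfold invMeasure
  infer_instance

/-- Integration of a function of the energy times a function of the direction, against the
invariant measure. -/
theorem lintegral_invMeasure_polar {F : Mom → ENNReal} (hF : Measurable F) :
    ∫⁻ p, F p ∂(invMeasure α β) = ∫⁻ ω : S2, (∫⁻ r in Ioi (0 : ℝ),
      ENNReal.ofReal (Real.exp α / (2 * Real.pi) ^ 3 * (r * Real.exp (-(β * r))))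
        * F (r • (ω : Mom))) ∂area := by
  rw [invMeasure, lintegral_withDensity_eq_lintegral_mul _ (by fun_prop) hF,
    lintegral_polar (n := 2) (by fun_prop)]
  refine lintegral_congr fun ω => setLIntegral_congr_fun measurableSet_Ioi fun r hr => ?_
  have hr' : 0 < r := hr
  simp only [Pi.mul_apply]
  rw [← mul_assoc, ← ENNReal.ofReal_mul (by positivity)]
  congr 2
  have h1 : ‖r • (ω : Mom)‖ = r := by
    rw [norm_smul, Real.norm_eq_abs, abs_of_pos hr']
    simp
  rw [invDens, feq, h1, sub_eq_add_neg, Real.exp_add]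
  field_simp

theorem lintegral_invMeasure_pow_mul (hβ : 0 < β) (k : ℕ) {n : Mom} (hn : ‖n‖ = 1)
    {h : ℝ → ℝ} (hh : Measurable h) :
    ∫⁻ p, ENNReal.ofReal (‖p‖ ^ k) * ENNReal.ofReal (h (⟪n, p⟫_ℝ / ‖p‖)) ∂(invMeasure α β)
      = ENNReal.ofReal (Real.exp α / (2 * Real.pi) ^ 3 * ((k + 1).factorial / β ^ (k + 2))) *
        (ENNReal.ofReal (2 * Real.pi) * ∫⁻ u in Ioo (-1 : ℝ) 1, ENNReal.ofReal (h u)) := by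
  rw [lintegral_invMeasure_polar (by fun_prop), ← lintegral_inner_area hn (by fun_prop),
    ← lintegral_const_mul' _ _ ENNReal.ofReal_ne_top]
  refine lintegral_congr fun ω => ?_
  rw [ENNReal.ofReal_mul (by positivity), ← lintegral_pow_mul_exp hβ,
    ← lintegral_const_mul' _ _ ENNReal.ofReal_ne_top, ← lintegral_mul_const _ (by fun_prop)]
  refine setLIntegral_congr_fun measurableSet_Ioi fun r hr => ?_
  have hr' : 0 < r := hr
  have h1 : ‖r • (ω : Mom)‖ = r := by
    rw [norm_smul, Real.norm_eq_abs, abs_of_pos hr']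
    simp
  simp only [h1, inner_smul_right]
  have h2 : ENNReal.ofReal (Real.exp α / (2 * Real.pi) ^ 3 * (r * Real.exp (-(β * r))))
      * ENNReal.ofReal (r ^ k) = ENNReal.ofReal (Real.exp α / (2 * Real.pi) ^ 3)
      * ENNReal.ofReal (r ^ (k + 1) * Real.exp (-(β * r))) := by
    rw [← ENNReal.ofReal_mul (by positivity), ← ENNReal.ofReal_mul (by positivity)]
    congr 1
    ring
  rw [mul_div_cancel_left₀ _ hr'.ne', ← mul_assoc, h2]

theorem exists_unit : ∃ n : Mom, ‖n‖ = 1 := ⟨EuclideanSpace.single 0 1, by simp⟩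

theorem lintegral_invMeasure_pow (hβ : 0 < β) (k : ℕ) :
    ∫⁻ p, ENNReal.ofReal (‖p‖ ^ k) ∂(invMeasure α β)
      = ENNReal.ofReal (Real.exp α / (2 * Real.pi) ^ 3 * ((k + 1).factorial / β ^ (k + 2))
          * (4 * Real.pi)) := by
  obtain ⟨n, hn⟩ := exists_unit
  have h := lintegral_invMeasure_pow_mul (α := α) hβ k hn (h := fun _ => 1) measurable_const
  simp only [ENNReal.ofReal_one, mul_one] at h
  rw [h, setLIntegral_const, one_mul, Real.volume_Ioo, ← ENNReal.ofReal_mul (by positivity),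
    ← ENNReal.ofReal_mul (by positivity)]
  congr 1
  ring

theorem isFiniteMeasure_invMeasure (hβ : 0 < β) : IsFiniteMeasure (invMeasure α β) := by
  constructor
  have := lintegral_invMeasure_pow (α := α) hβ 0
  simp only [pow_zero, ENNReal.ofReal_one, lintegral_one] at this
  rw [this]
  exact ENNReal.ofReal_lt_top

theorem invDensity_eq (α β : ℝ) : invDensity α β = (invMeasure α β).real univ := by
  rw [invDensity, Measure.real, invMeasure, withDensity_apply _ MeasurableSet.univ,
    setLIntegral_univ, integral_eq_lintegral_of_nonneg_ae]
  · rfl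
  · exact Eventually.of_forall fun p => invDens_nonneg p
  · exact (measurable_invDens (α := α) (β := β)).aestronglyMeasurable

theorem invDensity_val (hβ : 0 < β) :
    invDensity α β = Real.exp α / (2 * Real.pi) ^ 3 * (1 / β ^ 2) * (4 * Real.pi) := by
  have := lintegral_invMeasure_pow (α := α) hβ 0
  simp only [pow_zero, ENNReal.ofReal_one, lintegral_one] at this
  rw [invDensity_eq, Measure.real, this, ENNReal.toReal_ofReal (by positivity)]
  simp

theorem invMeasure_absolutelyContinuous : invMeasure α β ≪ volume :=
  withDensity_absolutelyContinuous _ _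

theorem ae_volume_ne_zero : ∀ᵐ p : Mom, p ≠ 0 :=
  compl_mem_ae_iff.2 (measure_singleton 0)

theorem ae_invMeasure_ne_zero : ∀ᵐ p ∂(invMeasure α β), p ≠ 0 :=
  invMeasure_absolutelyContinuous.ae_le ae_volume_ne_zero

theorem eqMeasure_eq : eqMeasure α β
    = (invMeasure α β).withDensity fun p => ENNReal.ofReal ‖p‖ := by
  rw [eqMeasure, invMeasure, ← withDensity_mul _ (by fun_prop) (by fun_prop)]
  refine withDensity_congr_ae ?_
  filter_upwards [ae_volume_ne_zero] with p hp
  have hp' := norm_pos_iff.2 hp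
  rw [Pi.mul_apply, ← ENNReal.ofReal_mul (invDens_nonneg p), invDens]
  congr 1
  field_simp

theorem integral_eqMeasure (F : Mom → ℂ) :
    ∫ p, F p ∂(eqMeasure α β) = ∫ p, (‖p‖ : ℂ) * F p ∂(invMeasure α β) := by
  rw [eqMeasure_eq, integral_withDensity_eq_integral_toReal_smul (by fun_prop)
    (Eventually.of_forall fun _ => ENNReal.ofReal_lt_top)]
  refine integral_congr_ae (Eventually.of_forall fun p => ?_)
  simp

theorem eqMeasure_absolutelyContinuous : eqMeasure α β ≪ invMeasure α β := by
  rw [eqMeasure_eq]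
  exact withDensity_absolutelyContinuous _ _

theorem invMeasure_absolutelyContinuous_eqMeasure : invMeasure α β ≪ eqMeasure α β := by
  rw [eqMeasure_eq]
  refine withDensity_absolutelyContinuous' (by fun_prop) ?_
  filter_upwards [ae_invMeasure_ne_zero] with p hp
  simpa using hp

theorem ae_eqMeasure_ne_zero : ∀ᵐ p ∂(eqMeasure α β), p ≠ 0 :=
  eqMeasure_absolutelyContinuous.ae_le ae_invMeasure_ne_zero

theorem norm_outgoing_add (p p' : Mom) (ω : S2) :
    ‖outgoing p p' ω‖ + ‖p + p' - outgoing p p' ω‖ = ‖p‖ + ‖p'‖ := by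
  have hω : ‖(ω : Mom)‖ = 1 := by simp
  rw [outgoing_eq_emission, norm_emission (norm_add_le _ _) hω,
      norm_sub_emission (norm_add_le _ _) hω]
  ring

theorem outgoing_comm (p p' : Mom) (ω : S2) : outgoing p' p ω = outgoing p p' ω := by
  rw [outgoing_eq_emission, outgoing_eq_emission, add_comm p, add_comm ‖p‖]

theorem outgoing_neg (p p' : Mom) (ω : S2) :
    outgoing p p' (-ω) = p + p' - outgoing p p' ω := by
  rw [outgoing_eq_emission, outgoing_eq_emission, sub_emission]
  rfl

/-- The momenta `((p, p'), (q, q'))` of a collision, as a function of `p`, `p'` and the direction of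
the first outgoing particle. -/
noncomputable def quad (x : Mom × (Mom × S2)) : (Mom × Mom) × (Mom × Mom) :=
  ((x.1, x.2.1), (outgoing x.1 x.2.1 x.2.2, x.1 + x.2.1 - outgoing x.1 x.2.1 x.2.2))

@[fun_prop]
theorem measurable_quad : Measurable quad := by
  have h1 : Measurable fun x : Mom × (Mom × S2) => outgoing x.1 x.2.1 x.2.2 := by
    simp only [outgoing_eq_emission]
    exact measurable_emission (by fun_prop) (by fun_prop) (by fun_prop)
  have h2 : Measurable fun x : Mom × (Mom × S2) => x.1 + x.2.1 := by fun_prop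
  exact (measurable_fst.prodMk (measurable_fst.comp measurable_snd)).prodMk
    (h1.prodMk (h2.sub h1))

/-- The measure on the momenta `((p, p'), (q, q'))` of collisions with isotropic scattering. -/
noncomputable def collMeasure (α β : ℝ) : Measure ((Mom × Mom) × (Mom × Mom)) :=
  ((invMeasure α β).prod ((invMeasure α β).prod unif)).map quad

theorem lintegral_collMeasure {F : (Mom × Mom) × (Mom × Mom) → ENNReal} (hF : Measurable F) :
    ∫⁻ z, F z ∂(collMeasure α β) = ∫⁻ p, ∫⁻ y, F (quad (p, y)) ∂((invMeasure α β).prod unif)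
      ∂(invMeasure α β) := by
  have h : Measurable fun x => F (quad x) := hF.comp measurable_quad
  rw [collMeasure, lintegral_map hF measurable_quad, lintegral_prod _ h.aemeasurable]

theorem lintegral_collMeasure' {F : (Mom × Mom) × (Mom × Mom) → ENNReal} (hF : Measurable F) :
    ∫⁻ z, F z ∂(collMeasure α β) = ∫⁻ p, ∫⁻ p', ∫⁻ ω, F (quad (p, p', ω)) ∂unif ∂(invMeasure α β)
      ∂(invMeasure α β) := by
  rw [lintegral_collMeasure hF]
  refine lintegral_congr fun p => ?_
  have h : Measurable fun y => F (quad (p, y)) :=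
    hF.comp (measurable_quad.comp (measurable_const.prodMk measurable_id))
  rw [lintegral_prod _ h.aemeasurable]

/-- The Boltzmann weights of the incoming and of the outgoing pair agree, by energy conservation. -/
theorem invDens_mul_invDens (p p' : Mom) :
    ENNReal.ofReal (invDens α β p) * ENNReal.ofReal (invDens α β p')
      = ENNReal.ofReal (1 / (‖p‖ * ‖p'‖))
        * ENNReal.ofReal (Real.exp (2 * α - β * (‖p‖ + ‖p'‖)) / (2 * Real.pi) ^ 6) := by
  rw [← ENNReal.ofReal_mul (invDens_nonneg p), ← ENNReal.ofReal_mul (by positivity)]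
  congr 1
  have h : Real.exp (2 * α - β * (‖p‖ + ‖p'‖)) = feq α β p * feq α β p' := by
    rw [feq, feq, ← Real.exp_add]
    congr 1
    ring
  rw [h, invDens, invDens]
  have := Real.pi_ne_zero
  rcases eq_or_ne p 0 with rfl | h1
  · simp
  rcases eq_or_ne p' 0 with rfl | h2
  · simp
  have h1' := norm_ne_zero_iff.2 h1
  have h2' := norm_ne_zero_iff.2 h2
  field_simp

theorem lintegral_collMeasure_volume {F : Mom × Mom → Mom × Mom → ENNReal}
    (hF : Measurable (Function.uncurry F)) :
    ∫⁻ z, F z.1 z.2 ∂(collMeasure α β)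
      = ∫⁻ p : Mom, ∫⁻ p' : Mom, ENNReal.ofReal (1 / (‖p‖ * ‖p'‖)) *
        ∫⁻ ω : S2, (ENNReal.ofReal (4 * Real.pi)⁻¹ *
          ENNReal.ofReal (Real.exp (2 * α - β * (‖p‖ + ‖p'‖)) / (2 * Real.pi) ^ 6)) *
          F (p, p') (outgoing p p' ω, p + p' - outgoing p p' ω) ∂area := by
  have hq : Measurable fun x : (Mom × Mom) × S2 => F x.1
      (outgoing x.1.1 x.1.2 x.2, x.1.1 + x.1.2 - outgoing x.1.1 x.1.2 x.2) :=
    hF.comp (measurable_quad.comp (by fun_prop :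
      Measurable fun x : (Mom × Mom) × S2 => (x.1.1, (x.1.2, x.2))))
  have hm : Measurable fun x : Mom × Mom => ∫⁻ ω : S2, F x
      (outgoing x.1 x.2 ω, x.1 + x.2 - outgoing x.1 x.2 ω) ∂unif :=
    Measurable.lintegral_prod_right' hq
  have hF' : Measurable fun z : (Mom × Mom) × (Mom × Mom) => F z.1 z.2 := hF
  rw [lintegral_collMeasure' hF']
  simp only [quad]
  rw [invMeasure, lintegral_withDensity_eq_lintegral_mul _ (by fun_prop)
    (Measurable.lintegral_prod_right' hm)]
  refine lintegral_congr fun p => ?_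
  have hm' : Measurable fun p' : Mom => ∫⁻ ω : S2, F (p, p')
      (outgoing (p, p').1 (p, p').2 ω, (p, p').1 + (p, p').2 - outgoing (p, p').1 (p, p').2 ω)
      ∂unif := hm.comp (measurable_const.prodMk measurable_id)
  rw [Pi.mul_apply, lintegral_withDensity_eq_lintegral_mul _ (by fun_prop) hm',
    ← lintegral_const_mul' _ _ ENNReal.ofReal_ne_top]
  refine lintegral_congr fun p' => ?_
  rw [Pi.mul_apply, ← mul_assoc, invDens_mul_invDens, unif, lintegral_smul_measure,
    lintegral_const_mul' _ _ (ENNReal.mul_ne_top ENNReal.ofReal_ne_top ENNReal.ofReal_ne_top),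
    smul_eq_mul]
  ring

/-- Detailed balance: the collision measure is invariant under time reversal. -/
theorem measurePreserving_swap : MeasurePreserving Prod.swap (collMeasure α β)
    (collMeasure α β) := by
  refine ⟨measurable_swap, Measure.ext_of_lintegral _ fun F hF => ?_⟩
  rw [lintegral_map hF measurable_swap,
    lintegral_collMeasure_volume (F := fun a b => F (Prod.swap (a, b))) (hF.comp measurable_swap),
    lintegral_collMeasure_volume (F := fun a b => F (a, b)) hF]
  have h := lintegral_collision_symm (F := fun a b => (ENNReal.ofReal (4 * Real.pi)⁻¹ *
          ENNReal.ofReal (Real.exp (2 * α - β * (‖a.1‖ + ‖a.2‖)) / (2 * Real.pi) ^ 6)) * F (a, b))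
    (by
      have : Measurable fun x : (Mom × Mom) × (Mom × Mom) => F x := hF
      exact Measurable.mul (by fun_prop) this)
  rw [h]
  simp only [norm_outgoing_add]
  rfl

theorem measurePreserving_in :
    MeasurePreserving (Prod.map Prod.swap id) (collMeasure α β) (collMeasure α β) := by
  have hm : Measurable (Prod.map Prod.swap id : (Mom × Mom) × (Mom × Mom) → _) := by fun_prop
  refine ⟨hm, Measure.ext_of_lintegral _ fun F hF => ?_⟩
  have hF' : Measurable fun z => F (Prod.map Prod.swap id z) := hF.comp hm
  rw [lintegral_map hF hm, lintegral_collMeasure' hF', lintegral_collMeasure' hF,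
    lintegral_lintegral_swap]
  · refine lintegral_congr fun p' => lintegral_congr fun p => lintegral_congr fun ω => ?_
    simp only [quad, Prod.map, Prod.swap, id, outgoing_comm p p', add_comm p' p]
  · refine Measurable.aemeasurable ?_
    exact Measurable.lintegral_prod_right' (f := fun x : (Mom × Mom) × S2 =>
      F (Prod.map Prod.swap id (quad (x.1.1, x.1.2, x.2))))
      (hF'.comp (measurable_quad.comp (by fun_prop :
        Measurable fun x : (Mom × Mom) × S2 => (x.1.1, (x.1.2, x.2)))))

theorem measurePreserving_out :
    MeasurePreserving (Prod.map id Prod.swap) (collMeasure α β) (collMeasure α β) := by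
  have h := (measurePreserving_swap (α := α) (β := β)).comp
    ((measurePreserving_in (α := α) (β := β)).comp (measurePreserving_swap (α := α) (β := β)))
  exact h

theorem measurableEmbedding_swap :
    MeasurableEmbedding (Prod.swap : (Mom × Mom) × (Mom × Mom) → _) :=
  MeasurableEquiv.prodComm.measurableEmbedding

theorem measurableEmbedding_in :
    MeasurableEmbedding (Prod.map Prod.swap id : (Mom × Mom) × (Mom × Mom) → _) :=
  (MeasurableEquiv.prodCongr MeasurableEquiv.prodComm
    (MeasurableEquiv.refl (Mom × Mom))).measurableEmbedding

/-- The uniform measure is invariant under the antipodal map. -/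
theorem measurePreserving_neg_unif : MeasurePreserving (fun ω : S2 => -ω) unif unif := by
  have h : (fun ω : S2 => -ω) = sphereMap (LinearIsometryEquiv.neg ℝ) := by
    ext ω : 2
    simp
  rw [h, unif]
  exact (measurePreserving_sphereMap _).smul_measure _

theorem lintegral_collMeasure_fst {h : Mom → ENNReal} (hh : Measurable h) :
    ∫⁻ z, h z.1.1 ∂(collMeasure α β) = (invMeasure α β) univ * ∫⁻ p, h p ∂(invMeasure α β) := by
  rw [lintegral_collMeasure (by fun_prop)]
  have h1 : ((invMeasure α β).prod unif) univ = (invMeasure α β) univ := by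
    rw [← univ_prod_univ, Measure.prod_prod, measure_univ (μ := unif), mul_one]
  simp only [quad, lintegral_const, h1]
  rw [lintegral_mul_const _ hh, mul_comm]

/-! ### Schur test for the gain term -/

theorem mandelstam_eq (p p' : Mom) : mandelstam p p' = 2 * (‖p‖ * ‖p'‖ - ⟪p, p'⟫_ℝ) := by
  rw [mandelstam, norm_add_sq_real]
  ring

/-- The invariant `s` vanishes only for parallel momenta. -/
theorem ae_mandelstam_pos {p : Mom} (hp : p ≠ 0) : ∀ᵐ p' : Mom, 0 < mandelstam p p' := by
  have hne : (Submodule.span ℝ {p} : Submodule ℝ Mom) ≠ ⊤ := by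
    intro h
    have h1 := finrank_span_le_card (R := ℝ) ({p} : Set Mom)
    rw [h, finrank_top] at h1
    simp at h1
  have h0 : volume ((Submodule.span ℝ {p} : Submodule ℝ Mom) : Set Mom) = 0 :=
    Measure.addHaar_submodule volume _ hne
  filter_upwards [compl_mem_ae_iff.2 h0] with p' hp'
  have h1 : ⟪p, p'⟫_ℝ < ‖p‖ * ‖p'‖ := by
    rw [inner_lt_norm_mul_iff_real]
    intro h
    refine hp' (Submodule.mem_span_singleton.2 ⟨‖p'‖ / ‖p‖, ?_⟩)
    rw [div_eq_inv_mul, mul_smul, h, smul_smul, inv_mul_cancel₀ (norm_ne_zero_iff.2 hp), one_smul]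
  rw [mandelstam_eq]
  linarith

theorem lintegral_inv_mul_sqrt {E P : ℝ} (hP : 0 ≤ P) (hE : P < E) :
    ∫⁻ u in Ioo (-1 : ℝ) 1,
        ENNReal.ofReal (1 / ((E ^ 2 - (P * u) ^ 2) * √(E ^ 2 - (P * u) ^ 2)))
      = ENNReal.ofReal (2 / (E ^ 2 * √(E ^ 2 - P ^ 2))) := by
  have hpos : ∀ u ∈ Icc (-1 : ℝ) 1, 0 < E ^ 2 - (P * u) ^ 2 := by
    intro u hu
    have h1 : u ^ 2 ≤ 1 := by nlinarith [hu.1, hu.2]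
    have h2 : (P * u) ^ 2 ≤ P ^ 2 := by
      rw [mul_pow]
      exact mul_le_of_le_one_right (sq_nonneg _) h1
    nlinarith
  have hE0 : 0 < E := hP.trans_lt hE
  have hcont : ContinuousOn (fun u : ℝ => 1 / ((E ^ 2 - (P * u) ^ 2) * √(E ^ 2 - (P * u) ^ 2)))
      (Icc (-1) 1) := by
    refine ContinuousOn.div (by fun_prop) (by fun_prop) fun u hu => ?_
    exact (mul_pos (hpos u hu) (Real.sqrt_pos.2 (hpos u hu))).ne'
  have hderiv : ∀ u ∈ uIcc (-1 : ℝ) 1, HasDerivAt (fun u => u / (E ^ 2 * √(E ^ 2 - (P * u) ^ 2)))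
      (1 / ((E ^ 2 - (P * u) ^ 2) * √(E ^ 2 - (P * u) ^ 2))) u := by
    intro u hu
    rw [uIcc_of_le (by norm_num)] at hu
    have h1 := hpos u hu
    have h2 : HasDerivAt (fun u => E ^ 2 - (P * u) ^ 2) (-(2 * (P * u) * P)) u := by
      have := (((hasDerivAt_id u).const_mul P).pow 2).const_sub (E ^ 2)
      simpa using this
    have h3 := (h2.sqrt h1.ne').const_mul (E ^ 2)
    have h4 := (hasDerivAt_id u).div h3 (by have := Real.sqrt_pos.2 h1; positivity)
    refine h4.congr_deriv ?_
    obtain ⟨r, hr⟩ : ∃ r, r = √(E ^ 2 - (P * u) ^ 2) := ⟨_, rfl⟩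
    have hr0 : 0 < r := hr ▸ Real.sqrt_pos.2 h1
    have hr2 : E ^ 2 - (P * u) ^ 2 = r ^ 2 := by rw [hr, Real.sq_sqrt h1.le]
    rw [← hr, hr2]
    simp only [id]
    field_simp
    linear_combination -hr2
  have hint : IntervalIntegrable
      (fun u : ℝ => 1 / ((E ^ 2 - (P * u) ^ 2) * √(E ^ 2 - (P * u) ^ 2))) volume (-1) 1 := by
    refine ContinuousOn.intervalIntegrable ?_
    rwa [uIcc_of_le (by norm_num)]
  have hval := intervalIntegral.integral_eq_sub_of_hasDerivAt hderiv hint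
  rw [intervalIntegral.integral_of_le (by norm_num), integral_Ioc_eq_integral_Ioo] at hval
  rw [← ofReal_integral_eq_lintegral_ofReal]
  · rw [hval]
    congr 1
    simp only [mul_one, mul_neg, even_two.neg_pow]
    ring
  · exact (hint.1).mono_set Ioo_subset_Ioc_self
  · filter_upwards [ae_restrict_mem measurableSet_Ioo] with u hu
    have h1 := hpos u (Ioo_subset_Icc_self hu)
    simp only [Pi.zero_apply]
    positivity

/-- The weight of the Schur test. It is inverted when incoming and outgoing momenta are exchanged;
the exponent `3 / 2` is chosen because the integral over the scattering angle is then elementary. -/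
noncomputable def weight (z : (Mom × Mom) × (Mom × Mom)) : ℝ :=
  (‖z.1.1‖ * ‖z.1.2‖ / (‖z.2.1‖ * ‖z.2.2‖)) * √(‖z.1.1‖ * ‖z.1.2‖ / (‖z.2.1‖ * ‖z.2.2‖))

@[fun_prop]
theorem measurable_weight : Measurable weight := by
  unfold weight
  fun_prop

theorem weight_swap (z : (Mom × Mom) × (Mom × Mom)) : weight z.swap = (weight z)⁻¹ := by
  simp only [weight, Prod.fst_swap, Prod.snd_swap]
  rw [mul_inv, ← Real.sqrt_inv, inv_div]

theorem weight_quad (p p' : Mom) (ω : S2) :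
    weight (quad (p, p', ω)) = 8 * (‖p‖ * ‖p'‖ * √(‖p‖ * ‖p'‖)) *
      (1 / (((‖p‖ + ‖p'‖) ^ 2 - ⟪p + p', (ω : Mom)⟫_ℝ ^ 2)
        * √((‖p‖ + ‖p'‖) ^ 2 - ⟪p + p', (ω : Mom)⟫_ℝ ^ 2))) := by
  have hω : ‖(ω : Mom)‖ = 1 := by simp
  have h : ‖outgoing p p' ω‖ * ‖p + p' - outgoing p p' ω‖
      = ((‖p‖ + ‖p'‖) ^ 2 - ⟪p + p', (ω : Mom)⟫_ℝ ^ 2) / 2 ^ 2 := by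
    rw [outgoing_eq_emission, norm_emission (norm_add_le _ _) hω,
      norm_sub_emission (norm_add_le _ _) hω]
    ring
  simp only [weight, quad]
  have h0 : 0 ≤ (‖p‖ + ‖p'‖) ^ 2 - ⟪p + p', (ω : Mom)⟫_ℝ ^ 2 := by
    have : 0 ≤ ((‖p‖ + ‖p'‖) ^ 2 - ⟪p + p', (ω : Mom)⟫_ℝ ^ 2) / 2 ^ 2 := h ▸ by positivity
    linarith
  rw [h, Real.sqrt_div (by positivity), Real.sqrt_div h0, Real.sqrt_sq (by norm_num)]
  obtain ⟨a, ha⟩ : ∃ a, a = (‖p‖ + ‖p'‖) ^ 2 - ⟪p + p', (ω : Mom)⟫_ℝ ^ 2 := ⟨_, rfl⟩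
  obtain ⟨b, hb⟩ : ∃ b, b = √a := ⟨_, rfl⟩
  rw [← ha, ← hb]
  simp only [div_eq_mul_inv, mul_inv, inv_inv]
  ring

theorem lintegral_unif_inner {P : Mom} {F : ℝ → ENNReal} (hF : Measurable F) :
    ∫⁻ ω : S2, F ⟪P, (ω : Mom)⟫_ℝ ∂unif
      = ENNReal.ofReal (1 / 2) * ∫⁻ u in Ioo (-1 : ℝ) 1, F (‖P‖ * u) := by
  obtain ⟨n, hn, hP⟩ : ∃ n : Mom, ‖n‖ = 1 ∧ P = ‖P‖ • n := by
    rcases eq_or_ne P 0 with rfl | h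
    · obtain ⟨n, hn⟩ := exists_unit
      exact ⟨n, hn, by simp⟩
    · have h' := norm_ne_zero_iff.2 h
      exact ⟨‖P‖⁻¹ • P, by rw [norm_smul, norm_inv, norm_norm, inv_mul_cancel₀ h'],
        by rw [smul_smul, mul_inv_cancel₀ h', one_smul]⟩
  have h1 : ∀ ω : S2, F ⟪P, (ω : Mom)⟫_ℝ = F (‖P‖ * ⟪n, (ω : Mom)⟫_ℝ) := by
    intro ω
    conv_lhs => rw [hP, real_inner_smul_left]
  simp only [h1]
  rw [unif, lintegral_smul_measure,
    lintegral_inner_area hn (F := fun u => F (‖P‖ * u)) (by fun_prop), smul_eq_mul, ← mul_assoc,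
    ← ENNReal.ofReal_mul (by positivity)]
  congr 2
  have := Real.pi_ne_zero
  field_simp
  norm_num

theorem lintegral_weight_unif {p p' : Mom} (h : 0 < mandelstam p p') :
    ∫⁻ ω : S2, ENNReal.ofReal (weight (quad (p, p', ω))) ∂unif
      ≤ ENNReal.ofReal ‖p‖ * ENNReal.ofReal (8 / (‖p'‖ * √(1 - ⟪‖p‖⁻¹ • p, p'⟫_ℝ / ‖p'‖))) := by
  have hs := mandelstam_eq p p'
  have hp : p ≠ 0 := by
    rintro rfl
    simp [hs] at h
  have hp' : p' ≠ 0 := by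
    rintro rfl
    simp [hs] at h
  have h1 := norm_pos_iff.2 hp
  have h2 := norm_pos_iff.2 hp'
  have hE : ‖p + p'‖ < ‖p‖ + ‖p'‖ := by
    have : ‖p + p'‖ ^ 2 < (‖p‖ + ‖p'‖) ^ 2 := by
      unfold mandelstam at h
      linarith
    exact lt_of_pow_lt_pow_left₀ 2 (by positivity) this
  simp only [weight_quad, ENNReal.ofReal_mul (by positivity : 0 ≤ 8 * (‖p‖ * ‖p'‖ * √(‖p‖ * ‖p'‖)))]
  rw [lintegral_const_mul' _ _ ENNReal.ofReal_ne_top,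
    lintegral_unif_inner (F := fun x => ENNReal.ofReal (1 / (((‖p‖ + ‖p'‖) ^ 2 - x ^ 2)
        * √((‖p‖ + ‖p'‖) ^ 2 - x ^ 2)))) (by fun_prop),
    lintegral_inv_mul_sqrt (norm_nonneg _) hE, ← ENNReal.ofReal_mul (by norm_num),
    ← ENNReal.ofReal_mul (by positivity), ← ENNReal.ofReal_mul (by positivity)]
  refine ENNReal.ofReal_le_ofReal ?_
  obtain ⟨c, hc⟩ : ∃ c, c = ⟪‖p‖⁻¹ • p, p'⟫_ℝ / ‖p'‖ := ⟨_, rfl⟩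
  have hs' : mandelstam p p' = 2 * (‖p‖ * ‖p'‖) * (1 - c) := by
    rw [hs, hc, real_inner_smul_left]
    field_simp
  have hc1 : 0 < 1 - c := by
    rw [hs'] at h
    exact pos_of_mul_pos_right h (by positivity)
  have hm : (‖p‖ + ‖p'‖) ^ 2 - ‖p + p'‖ ^ 2 = (‖p‖ * ‖p'‖) * (2 * (1 - c)) := by
    rw [← mandelstam, hs']
    ring
  rw [← hc, hm, Real.sqrt_mul (by positivity : 0 ≤ ‖p‖ * ‖p'‖) (2 * (1 - c))]
  obtain ⟨r, hr⟩ : ∃ r, r = √(‖p‖ * ‖p'‖) := ⟨_, rfl⟩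
  have hr0 : 0 < r := hr ▸ Real.sqrt_pos.2 (by positivity)
  have hd0 : 0 < √(1 - c) := Real.sqrt_pos.2 hc1
  have hd : √(1 - c) ≤ √(2 * (1 - c)) := Real.sqrt_le_sqrt (by linarith)
  rw [← hr]
  calc 8 * (‖p‖ * ‖p'‖ * r) * (1 / 2 * (2 / ((‖p‖ + ‖p'‖) ^ 2 * (r * √(2 * (1 - c))))))
      = 8 * (‖p‖ * ‖p'‖) / ((‖p‖ + ‖p'‖) ^ 2 * √(2 * (1 - c))) := by
        have : 0 < √(2 * (1 - c)) := hd0.trans_le hd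
        field_simp
    _ ≤ 8 * (‖p‖ * ‖p'‖) / (‖p'‖ ^ 2 * √(1 - c)) := by
        gcongr
        linarith
    _ = ‖p‖ * (8 / (‖p'‖ * √(1 - c))) := by
        field_simp

theorem lintegral_inv_sqrt_lt_top :
    ∫⁻ u in Ioo (-1 : ℝ) 1, ENNReal.ofReal (8 / √(1 - u)) < ⊤ := by
  have h1 : IntervalIntegrable (fun u : ℝ => u ^ (-(1 / 2) : ℝ)) volume 0 2 :=
    intervalIntegral.intervalIntegrable_rpow' (by norm_num)
  have h2 := (h1.comp_sub_left 1).const_mul 8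
  norm_num at h2
  have h3 : IntegrableOn (fun u : ℝ => 8 * (1 - u) ^ (-(1 / 2) : ℝ)) (Ioo (-1) 1) :=
    (h2.symm.1).mono_set Ioo_subset_Ioc_self
  refine lt_of_eq_of_lt ?_ h3.hasFiniteIntegral
  refine setLIntegral_congr_fun measurableSet_Ioo fun u hu => ?_
  have hu1 : 0 < 1 - u := by linarith [hu.2]
  have h4 : 8 * (1 - u) ^ (-(1 / 2) : ℝ) = 8 / √(1 - u) := by
    rw [Real.rpow_neg hu1.le, ← Real.sqrt_eq_rpow, div_eq_mul_inv]
  simp only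
  rw [h4, Real.enorm_eq_ofReal (by positivity)]

/-- The bound of the Schur test: the weight, integrated over the partner and the scattering angle,
is at most a constant times the energy. -/
theorem exists_lintegral_weight_le (hβ : 0 < β) : ∃ C : NNReal, ∀ p : Mom, p ≠ 0 →
    ∫⁻ y, ENNReal.ofReal (weight (quad (p, y))) ∂((invMeasure α β).prod unif)
      ≤ C * ENNReal.ofReal ‖p‖ := by
  obtain ⟨J, hJ⟩ : ∃ J, J = ∫⁻ u in Ioo (-1 : ℝ) 1, ENNReal.ofReal (8 / √(1 - u)) := ⟨_, rfl⟩
  have hJt : J ≠ ⊤ := hJ ▸ lintegral_inv_sqrt_lt_top.ne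
  obtain ⟨K, hK⟩ : ∃ K, K = ENNReal.ofReal (Real.exp α / (2 * Real.pi) ^ 3 * (1 / β))
    * (ENNReal.ofReal (2 * Real.pi) * J) := ⟨_, rfl⟩
  have hKt : K ≠ ⊤ := by
    rw [hK]
    exact ENNReal.mul_ne_top ENNReal.ofReal_ne_top (ENNReal.mul_ne_top ENNReal.ofReal_ne_top hJt)
  refine ⟨K.toNNReal, fun p hp => ?_⟩
  rw [ENNReal.coe_toNNReal hKt]
  obtain ⟨n, hn⟩ : ∃ n, n = ‖p‖⁻¹ • p := ⟨_, rfl⟩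
  have hn1 : ‖n‖ = 1 := by
    rw [hn, norm_smul, norm_inv, norm_norm, inv_mul_cancel₀ (norm_ne_zero_iff.2 hp)]
  have hm : Measurable fun y : Mom × S2 => ENNReal.ofReal (weight (quad (p, y))) := by fun_prop
  rw [lintegral_prod _ hm.aemeasurable]
  calc ∫⁻ p', ∫⁻ ω, ENNReal.ofReal (weight (quad (p, p', ω))) ∂unif ∂(invMeasure α β)
      ≤ ∫⁻ p', ENNReal.ofReal ‖p‖ * ENNReal.ofReal (8 / (‖p'‖ * √(1 - ⟪n, p'⟫_ℝ / ‖p'‖)))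
          ∂(invMeasure α β) := by
        refine lintegral_mono_ae ?_
        filter_upwards [invMeasure_absolutelyContinuous.ae_le (ae_mandelstam_pos hp)] with p' h
        rw [hn]
        exact lintegral_weight_unif h
    _ = ENNReal.ofReal ‖p‖ * K := by
        rw [lintegral_const_mul' _ _ ENNReal.ofReal_ne_top, hK, hJ,
          lintegral_invMeasure_polar (by fun_prop), ← lintegral_inner_area hn1 (by fun_prop)]
        congr 1
        rw [← lintegral_const_mul' _ _ ENNReal.ofReal_ne_top]
        refine lintegral_congr fun ω => ?_
        have hω : ‖(ω : Mom)‖ = 1 := by simp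
        have hexp := lintegral_pow_mul_exp hβ 0
        simp only [pow_zero, one_mul, Nat.factorial_zero, Nat.cast_one, zero_add, pow_one] at hexp
        rw [ENNReal.ofReal_mul (by positivity), ← hexp, mul_assoc,
          ← lintegral_mul_const' _ _ ENNReal.ofReal_ne_top,
          ← lintegral_const_mul' _ _ ENNReal.ofReal_ne_top]
        refine setLIntegral_congr_fun measurableSet_Ioi fun r hr => ?_
        have hr0 : (0 : ℝ) < r := hr
        rw [norm_smul, hω, inner_smul_right, mul_one, Real.norm_eq_abs, abs_of_pos hr0,
          mul_div_cancel_left₀ _ hr0.ne', ← ENNReal.ofReal_mul (by positivity),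
          ← ENNReal.ofReal_mul (by positivity), ← ENNReal.ofReal_mul (by positivity)]
        congr 1
        field_simp
    _ = K * ENNReal.ofReal ‖p‖ := mul_comm _ _

/-! ### Integrability over collisions -/

theorem measurePreserving_quad :
    MeasurePreserving quad ((invMeasure α β).prod ((invMeasure α β).prod unif))
      (collMeasure α β) :=
  measurable_quad.measurePreserving _

instance : SFinite (collMeasure α β) := by
  unfold collMeasure
  infer_instance

/-- Each of the four momenta of a collision is distributed according to a multiple of the invariant
measure. -/
theorem measurePreserving_fst_fst :
    MeasurePreserving (fun z : (Mom × Mom) × (Mom × Mom) => z.1.1) (collMeasure α β)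
      ((invMeasure α β) univ • invMeasure α β) := by
  refine ⟨by fun_prop, Measure.ext_of_lintegral _ fun F hF => ?_⟩
  rw [lintegral_map hF (by fun_prop), lintegral_collMeasure_fst hF, lintegral_smul_measure,
    smul_eq_mul]

theorem measurePreserving_fst_snd :
    MeasurePreserving (fun z : (Mom × Mom) × (Mom × Mom) => z.1.2) (collMeasure α β)
      ((invMeasure α β) univ • invMeasure α β) :=
  measurePreserving_fst_fst.comp measurePreserving_in

theorem measurePreserving_snd_fst :
    MeasurePreserving (fun z : (Mom × Mom) × (Mom × Mom) => z.2.1) (collMeasure α β)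
      ((invMeasure α β) univ • invMeasure α β) :=
  measurePreserving_fst_fst.comp measurePreserving_swap

theorem measurePreserving_snd_snd :
    MeasurePreserving (fun z : (Mom × Mom) × (Mom × Mom) => z.2.2) (collMeasure α β)
      ((invMeasure α β) univ • invMeasure α β) :=
  measurePreserving_fst_snd.comp measurePreserving_swap

theorem ae_collMeasure {Q : Mom → Prop} (h : ∀ᵐ p ∂(invMeasure α β), Q p) :
    ∀ᵐ z ∂(collMeasure α β), Q z.1.1 ∧ Q z.1.2 ∧ Q z.2.1 ∧ Q z.2.2 := by
  have h' : ∀ᵐ p ∂((invMeasure α β) univ • invMeasure α β), Q p := Measure.ae_smul_measure h _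
  filter_upwards [measurePreserving_fst_fst.quasiMeasurePreserving.ae h',
    measurePreserving_fst_snd.quasiMeasurePreserving.ae h',
    measurePreserving_snd_fst.quasiMeasurePreserving.ae h',
    measurePreserving_snd_snd.quasiMeasurePreserving.ae h'] with z h1 h2 h3 h4
  exact ⟨h1, h2, h3, h4⟩

theorem ae_quad {Q : Mom → Prop} (h : ∀ᵐ p ∂(invMeasure α β), Q p) :
    ∀ᵐ p ∂(invMeasure α β), ∀ᵐ y ∂((invMeasure α β).prod unif),
      Q (quad (p, y)).1.1 ∧ Q (quad (p, y)).1.2 ∧ Q (quad (p, y)).2.1 ∧ Q (quad (p, y)).2.2 :=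
  Measure.ae_ae_of_ae_prod (measurePreserving_quad.quasiMeasurePreserving.ae (ae_collMeasure h))

theorem ae_weight_pos : ∀ᵐ z ∂(collMeasure α β), 0 < weight z := by
  filter_upwards [ae_collMeasure ae_invMeasure_ne_zero] with z hz
  obtain ⟨h1, h2, h3, h4⟩ := hz
  have h1 := norm_pos_iff.2 h1
  have h2 := norm_pos_iff.2 h2
  have h3 := norm_pos_iff.2 h3
  have h4 := norm_pos_iff.2 h4
  unfold weight
  have : 0 < ‖z.1.1‖ * ‖z.1.2‖ / (‖z.2.1‖ * ‖z.2.2‖) := by positivity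
  exact mul_pos this (Real.sqrt_pos.2 this)

/-- The norm of the Hilbert space is that of `L²` with the additional weight `p⁰` against the
invariant measure. -/
theorem memLp_eqMeasure_iff {φ : Mom → ℂ} : MemLp φ 2 (eqMeasure α β) ↔
    AEStronglyMeasurable φ (invMeasure α β)
      ∧ Integrable (fun p => ‖p‖ * ‖φ p‖ ^ 2) (invMeasure α β) := by
  have h1 : AEStronglyMeasurable φ (eqMeasure α β) ↔ AEStronglyMeasurable φ (invMeasure α β) :=
    ⟨fun h => h.mono_ac invMeasure_absolutelyContinuous_eqMeasure,
      fun h => h.mono_ac eqMeasure_absolutelyContinuous⟩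
  have h2 : Integrable (fun p => ‖φ p‖ ^ 2) (eqMeasure α β)
      ↔ Integrable (fun p => ‖p‖ * ‖φ p‖ ^ 2) (invMeasure α β) := by
    rw [eqMeasure_eq, integrable_withDensity_iff_integrable_smul' (by fun_prop)
      (Eventually.of_forall fun _ => ENNReal.ofReal_lt_top)]
    simp
  constructor
  · intro h
    exact ⟨h1.1 h.1, h2.1 ((memLp_two_iff_integrable_sq_norm h.1).1 h)⟩
  · rintro ⟨h, h'⟩
    exact (memLp_two_iff_integrable_sq_norm (h1.2 h)).2 (h2.2 h')

theorem integrable_inv_norm (hβ : 0 < β) : Integrable (fun p : Mom => ‖p‖⁻¹) (invMeasure α β) := by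
  refine ⟨by fun_prop, ?_⟩
  have h : ∀ p : Mom, ‖‖p‖⁻¹‖ₑ = ENNReal.ofReal ‖p‖⁻¹ := fun p =>
    Real.enorm_eq_ofReal (by positivity)
  rw [HasFiniteIntegral]
  simp only [h]
  rw [lintegral_invMeasure_polar (by fun_prop)]
  have h1 : ∀ ω : S2, ∫⁻ r in Ioi (0 : ℝ),
      ENNReal.ofReal (Real.exp α / (2 * Real.pi) ^ 3 * (r * Real.exp (-(β * r))))
        * ENNReal.ofReal ‖r • (ω : Mom)‖⁻¹
      = ENNReal.ofReal (Real.exp α / (2 * Real.pi) ^ 3) * ENNReal.ofReal (1 / β) := by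
    intro ω
    have hω : ‖(ω : Mom)‖ = 1 := by simp
    have hexp := lintegral_pow_mul_exp hβ 0
    simp only [pow_zero, one_mul, Nat.factorial_zero, Nat.cast_one, zero_add, pow_one] at hexp
    rw [← hexp, ← lintegral_const_mul' _ _ ENNReal.ofReal_ne_top]
    refine setLIntegral_congr_fun measurableSet_Ioi fun r hr => ?_
    have hr0 : (0 : ℝ) < r := hr
    rw [norm_smul, hω, mul_one, Real.norm_eq_abs, abs_of_pos hr0,
      ← ENNReal.ofReal_mul (by positivity), ← ENNReal.ofReal_mul (by positivity)]
    congr 1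
    field_simp
  simp only [h1, lintegral_const, area_univ]
  exact ENNReal.mul_lt_top (ENNReal.mul_lt_top ENNReal.ofReal_lt_top ENNReal.ofReal_lt_top)
    ENNReal.ofReal_lt_top

theorem integrable_invMeasure_of_memLp (hβ : 0 < β) {φ : Mom → ℂ}
    (hφ : MemLp φ 2 (eqMeasure α β)) : Integrable φ (invMeasure α β) := by
  obtain ⟨h1, h2⟩ := memLp_eqMeasure_iff.1 hφ
  refine (h2.add (integrable_inv_norm hβ)).mono' h1 ?_
  filter_upwards [ae_invMeasure_ne_zero] with p hp
  have hp := norm_pos_iff.2 hp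
  obtain ⟨a, ha⟩ : ∃ a, a = ‖φ p‖ := ⟨_, rfl⟩
  simp only [Pi.add_apply]
  rw [← ha]
  -- `a ≤ ‖p‖ a² + ‖p‖⁻¹`, by the inequality of the means
  have h3 : 0 ≤ ‖p‖⁻¹ * ((‖p‖ * a - 1) ^ 2 + ‖p‖ * a) := by
    have : 0 ≤ a := ha ▸ norm_nonneg _
    positivity
  have h4 : ‖p‖⁻¹ * ((‖p‖ * a - 1) ^ 2 + ‖p‖ * a) = ‖p‖ * a ^ 2 + ‖p‖⁻¹ - a := by
    field_simp
    ring
  linarith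

/-- A measurable function of collisions that is square integrable against the inverse Schur
weight. -/
structure GainBound (α β : ℝ) (F : (Mom × Mom) × (Mom × Mom) → ℂ) : Prop where
  measurable : Measurable F
  finite : ∫⁻ z, ‖F z‖ₑ ^ 2 * ENNReal.ofReal (weight z)⁻¹ ∂(collMeasure α β) < ⊤

/-- One half of the Schur test: square integrability against the Schur weight, for functions of the
incoming momentum. -/
theorem lintegral_sq_mul_weight_lt_top (hβ : 0 < β) {ψ : Mom → ℂ} (hm : Measurable ψ)
    (hψ : MemLp ψ 2 (eqMeasure α β)) :
    ∫⁻ z, ‖ψ z.1.1‖ₑ ^ 2 * ENNReal.ofReal (weight z) ∂(collMeasure α β) < ⊤ := by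
  obtain ⟨C, hC⟩ := exists_lintegral_weight_le (α := α) hβ
  have h1 : ∫⁻ z, ‖ψ z.1.1‖ₑ ^ 2 * ENNReal.ofReal (weight z) ∂(collMeasure α β)
      ≤ ∫⁻ p, C * ‖‖p‖ * ‖ψ p‖ ^ 2‖ₑ ∂(invMeasure α β) := by
    rw [lintegral_collMeasure (by fun_prop)]
    refine lintegral_mono_ae ?_
    filter_upwards [ae_invMeasure_ne_zero] with p hp
    have h2 : (fun y : Mom × S2 => ‖ψ (quad (p, y)).1.1‖ₑ ^ 2 * ENNReal.ofReal
          (weight (quad (p, y))))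
        = fun y => ‖ψ p‖ₑ ^ 2 * ENNReal.ofReal (weight (quad (p, y))) := rfl
    rw [h2, lintegral_const_mul' _ _ (by finiteness)]
    calc ‖ψ p‖ₑ ^ 2 * ∫⁻ y, ENNReal.ofReal (weight (quad (p, y))) ∂((invMeasure α β).prod unif)
        ≤ ‖ψ p‖ₑ ^ 2 * (C * ENNReal.ofReal ‖p‖) := by gcongr; exact hC p hp
      _ = C * ‖‖p‖ * ‖ψ p‖ ^ 2‖ₑ := by
        rw [enorm_mul, enorm_pow, enorm_norm, enorm_norm, ofReal_norm]
        ring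
  refine h1.trans_lt ?_
  rw [lintegral_const_mul' _ _ ENNReal.coe_ne_top]
  exact ENNReal.mul_lt_top ENNReal.coe_lt_top (memLp_eqMeasure_iff.1 hψ).2.hasFiniteIntegral

theorem gainBound_snd_fst (hβ : 0 < β) {φ : Mom → ℂ} (hm : Measurable φ)
    (hφ : MemLp φ 2 (eqMeasure α β)) : GainBound α β fun z => φ z.2.1 := by
  refine ⟨by fun_prop, ?_⟩
  rw [← measurePreserving_swap.lintegral_comp (by fun_prop)]
  simp only [weight_swap, inv_inv]
  exact lintegral_sq_mul_weight_lt_top hβ hm hφ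

theorem gainBound_snd_snd (hβ : 0 < β) {φ : Mom → ℂ} (hm : Measurable φ)
    (hφ : MemLp φ 2 (eqMeasure α β)) : GainBound α β fun z => φ z.2.2 := by
  refine ⟨by fun_prop, ?_⟩
  rw [← measurePreserving_out.lintegral_comp (by fun_prop)]
  have h : ∀ z : (Mom × Mom) × (Mom × Mom), weight (Prod.map id Prod.swap z) = weight z := by
    intro z
    simp [weight, mul_comm ‖z.2.2‖]
  simp only [h]
  exact (gainBound_snd_fst hβ hm hφ).finite

theorem GainBound.integrable_mul (hβ : 0 < β) {ψ : Mom → ℂ} (hm : Measurable ψ)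
    (hψ : MemLp ψ 2 (eqMeasure α β)) {F : (Mom × Mom) × (Mom × Mom) → ℂ} (hF : GainBound α β F) :
    Integrable (fun z => ψ z.1.1 * F z) (collMeasure α β) := by
  have hFm := hF.measurable
  refine ⟨by fun_prop, ?_⟩
  have h1 : ∫⁻ z, ‖ψ z.1.1 * F z‖ₑ ∂(collMeasure α β)
      ≤ ∫⁻ z, (‖ψ z.1.1‖ₑ ^ 2 * ENNReal.ofReal (weight z)
        + ‖F z‖ₑ ^ 2 * ENNReal.ofReal (weight z)⁻¹) ∂(collMeasure α β) := by
    refine lintegral_mono_ae ?_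
    filter_upwards [ae_weight_pos] with z hz
    rw [← ofReal_norm, ← ofReal_norm, ← ofReal_norm, ← ENNReal.ofReal_pow (norm_nonneg _),
      ← ENNReal.ofReal_pow (norm_nonneg _), ← ENNReal.ofReal_mul (by positivity),
      ← ENNReal.ofReal_mul (by positivity), ← ENNReal.ofReal_add (by positivity) (by positivity),
      norm_mul]
    refine ENNReal.ofReal_le_ofReal ?_
    obtain ⟨a, ha⟩ : ∃ a, a = ‖ψ z.1.1‖ := ⟨_, rfl⟩
    obtain ⟨b, hb⟩ : ∃ b, b = ‖F z‖ := ⟨_, rfl⟩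
    have ha0 : 0 ≤ a := ha ▸ norm_nonneg _
    have hb0 : 0 ≤ b := hb ▸ norm_nonneg _
    rw [← ha, ← hb]
    have h3 : 0 ≤ (weight z)⁻¹ * ((weight z * a - b) ^ 2 + weight z * (a * b)) := by positivity
    have h4 : (weight z)⁻¹ * ((weight z * a - b) ^ 2 + weight z * (a * b))
        = a ^ 2 * weight z + b ^ 2 * (weight z)⁻¹ - a * b := by
      field_simp
      ring
    linarith
  refine h1.trans_lt ?_
  rw [lintegral_add_left (by fun_prop)]
  exact ENNReal.add_lt_top.2 ⟨lintegral_sq_mul_weight_lt_top hβ hm hψ, hF.finite⟩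

/-- The Cauchy-Schwarz inequality with a weight. -/
theorem sq_lintegral_enorm_le {Y : Type*} [MeasurableSpace Y] {μ : Measure Y} {F : Y → ℂ}
    {w : Y → ℝ} (hF : Measurable F) (hw : Measurable w) (hpos : ∀ᵐ y ∂μ, 0 < w y) :
    (∫⁻ y, ‖F y‖ₑ ∂μ) ^ 2
      ≤ (∫⁻ y, ENNReal.ofReal (w y) ∂μ) * ∫⁻ y, ‖F y‖ₑ ^ 2 * ENNReal.ofReal (w y)⁻¹ ∂μ := by
  have h := ENNReal.lintegral_mul_le_Lp_mul_Lq μ Real.HolderConjugate.two_two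
    (f := fun y => ENNReal.ofReal √(w y)) (g := fun y => ‖F y‖ₑ * ENNReal.ofReal (√(w y))⁻¹)
    (by fun_prop) (by fun_prop)
  have h1 : ∫⁻ y, ‖F y‖ₑ ∂μ = ∫⁻ y, ((fun y => ENNReal.ofReal √(w y))
      * fun y => ‖F y‖ₑ * ENNReal.ofReal (√(w y))⁻¹) y ∂μ := by
    refine lintegral_congr_ae ?_
    filter_upwards [hpos] with y hy
    have hs := Real.sqrt_pos.2 hy
    rw [Pi.mul_apply, mul_left_comm, ← ENNReal.ofReal_mul hs.le, mul_inv_cancel₀ hs.ne',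
      ENNReal.ofReal_one, mul_one]
  have h2 : ∫⁻ y, ENNReal.ofReal √(w y) ^ (2 : ℝ) ∂μ = ∫⁻ y, ENNReal.ofReal (w y) ∂μ := by
    refine lintegral_congr_ae ?_
    filter_upwards [hpos] with y hy
    rw [ENNReal.rpow_two, ← ENNReal.ofReal_pow (Real.sqrt_nonneg _), Real.sq_sqrt hy.le]
  have h3 : ∫⁻ y, (‖F y‖ₑ * ENNReal.ofReal (√(w y))⁻¹) ^ (2 : ℝ) ∂μ
      = ∫⁻ y, ‖F y‖ₑ ^ 2 * ENNReal.ofReal (w y)⁻¹ ∂μ := by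
    refine lintegral_congr_ae ?_
    filter_upwards [hpos] with y hy
    rw [ENNReal.rpow_two, mul_pow, ← ENNReal.ofReal_pow (by positivity), inv_pow,
      Real.sq_sqrt hy.le]
  rw [h2, h3] at h
  rw [h1]
  refine (pow_le_pow_left' h 2).trans_eq ?_
  rw [mul_pow, ← ENNReal.rpow_natCast, ← ENNReal.rpow_natCast, ← ENNReal.rpow_mul,
    ← ENNReal.rpow_mul]
  norm_num

/-- Averaging over the partner and the scattering angle, followed by division by the energy, maps
into the Hilbert space. -/
theorem GainBound.memLp (hβ : 0 < β) {F : (Mom × Mom) × (Mom × Mom) → ℂ} (hF : GainBound α β F) :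
    MemLp (fun p => ((‖p‖⁻¹ : ℝ) : ℂ) * ∫ y, F (quad (p, y)) ∂((invMeasure α β).prod unif)) 2
      (eqMeasure α β) := by
  obtain ⟨C, hC⟩ := exists_lintegral_weight_le (α := α) hβ
  have hFq : Measurable fun x => F (quad x) := hF.measurable.comp measurable_quad
  have hm : Measurable fun p => ∫ y, F (quad (p, y)) ∂((invMeasure α β).prod unif) :=
    (StronglyMeasurable.integral_prod_right' hFq.stronglyMeasurable).measurable
  refine memLp_eqMeasure_iff.2 ⟨by fun_prop, by fun_prop, ?_⟩
  have h1 : ∫⁻ p : Mom, ‖‖p‖ * ‖((‖p‖⁻¹ : ℝ) : ℂ) * ∫ y, F (quad (p, y))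
        ∂((invMeasure α β).prod unif)‖ ^ 2‖ₑ ∂(invMeasure α β)
      ≤ ∫⁻ p, C * (∫⁻ y, ‖F (quad (p, y))‖ₑ ^ 2 * ENNReal.ofReal (weight (quad (p, y)))⁻¹
          ∂((invMeasure α β).prod unif)) ∂(invMeasure α β) := by
    refine lintegral_mono_ae ?_
    filter_upwards [ae_invMeasure_ne_zero,
      Measure.ae_ae_of_ae_prod (measurePreserving_quad.quasiMeasurePreserving.ae ae_weight_pos)]
      with p hp hpos
    have hFp : Measurable fun y => F (quad (p, y)) := hFq.comp (by fun_prop)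
    have hcs := sq_lintegral_enorm_le hFp (w := fun y => weight (quad (p, y))) (by fun_prop) hpos
    have hn := norm_pos_iff.2 hp
    obtain ⟨T, hT⟩ : ∃ T, T = ∫ y, F (quad (p, y)) ∂((invMeasure α β).prod unif) := ⟨_, rfl⟩
    obtain ⟨D, hD⟩ : ∃ D, D = ∫⁻ y, ‖F (quad (p, y))‖ₑ ^ 2
      * ENNReal.ofReal (weight (quad (p, y)))⁻¹ ∂((invMeasure α β).prod unif) := ⟨_, rfl⟩
    have hT2 : ‖T‖ₑ ^ 2 ≤ C * ENNReal.ofReal ‖p‖ * D := by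
      rw [hT, hD]
      refine (pow_le_pow_left' (enorm_integral_le_lintegral_enorm _) 2).trans (hcs.trans ?_)
      gcongr
      exact hC p hp
    rw [← hT, ← hD]
    have h3 : ‖‖p‖ * ‖((‖p‖⁻¹ : ℝ) : ℂ) * T‖ ^ 2‖ₑ = ENNReal.ofReal ‖p‖⁻¹ * ‖T‖ₑ ^ 2 := by
      rw [norm_mul, mul_pow, Complex.norm_real, Real.norm_eq_abs, abs_of_pos (inv_pos.2 hn),
        ← mul_assoc, enorm_mul, enorm_pow, enorm_norm, Real.enorm_eq_ofReal (by positivity)]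
      congr 2
      field_simp
    rw [h3]
    calc ENNReal.ofReal ‖p‖⁻¹ * ‖T‖ₑ ^ 2 ≤ ENNReal.ofReal ‖p‖⁻¹ * (C * ENNReal.ofReal ‖p‖ * D) := by
          gcongr
      _ = (ENNReal.ofReal ‖p‖⁻¹ * ENNReal.ofReal ‖p‖) * (C * D) := by ring
      _ = C * D := by
        rw [← ENNReal.ofReal_mul (by positivity), inv_mul_cancel₀ hn.ne', ENNReal.ofReal_one,
          one_mul]
  refine h1.trans_lt ?_
  rw [lintegral_const_mul' _ _ ENNReal.coe_ne_top]
  have hmeas := hF.measurable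
  have h4 := lintegral_collMeasure (α := α) (β := β)
    (F := fun z => ‖F z‖ₑ ^ 2 * ENNReal.ofReal (weight z)⁻¹) (by fun_prop)
  rw [← h4]
  exact ENNReal.mul_lt_top ENNReal.coe_lt_top hF.finite

/-! ### The collision operator in terms of the gain operator -/

/-- The change `φ_q + φ_q' - φ_p - φ_p'` of an additive quantity in a collision. -/
noncomputable def defect (φ : Mom → ℂ) (z : (Mom × Mom) × (Mom × Mom)) : ℂ :=
  φ z.2.1 + φ z.2.2 - φ z.1.1 - φ z.1.2

/-- The integrand `φ_q + φ_q' - φ_p'` of the part of the collision operator that is not a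
multiplication operator. -/
noncomputable def gainKernel (φ : Mom → ℂ) (z : (Mom × Mom) × (Mom × Mom)) : ℂ :=
  φ z.2.1 + φ z.2.2 - φ z.1.2

/-- The part of the collision operator that is not a multiplication operator, up to `g / 2`. -/
noncomputable def gain (α β : ℝ) (φ : Mom → ℂ) (p : Mom) : ℂ :=
  ∫ y, gainKernel φ (quad (p, y)) ∂((invMeasure α β).prod unif)

theorem collision_zero (g : ℝ) (φ : Mom → ℂ) : collision α β g φ 0 = 0 := by
  simp [collision, mandelstam]

theorem collision_eq (g : ℝ) (φ : Mom → ℂ) {p : Mom} (hp : p ≠ 0) :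
    collision α β g φ p
      = (g / 2 : ℝ) * ∫ p', (∫ ω, defect φ (quad (p, p', ω)) ∂unif) ∂(invMeasure α β) := by
  rw [collision, invMeasure, integral_withDensity_eq_integral_toReal_smul (by fun_prop)
    (Eventually.of_forall fun _ => ENNReal.ofReal_lt_top), ← integral_const_mul]
  refine integral_congr_ae ?_
  filter_upwards [ae_mandelstam_pos hp] with p' h
  rw [ENNReal.toReal_ofReal (invDens_nonneg _), unif, integral_smul_measure,
    ENNReal.toReal_ofReal (by positivity)]
  have h1 : mandelstam p p' * crossSection g (mandelstam p p') / 2 = g / 2 := by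
    rw [crossSection, mul_div_cancel₀ _ h.ne']
  rw [h1]
  simp only [quad, defect, invDens, Complex.real_smul]
  push_cast
  ring

/-- The collision operator does not depend on the choice of a representative. -/
theorem collision_congr_ae (g : ℝ) {φ ψ : Mom → ℂ} (h : φ =ᵐ[invMeasure α β] ψ) :
    collision α β g φ =ᵐ[invMeasure α β] collision α β g ψ := by
  filter_upwards [ae_quad h, ae_invMeasure_ne_zero] with p hp hp0
  rw [collision_eq g φ hp0, collision_eq g ψ hp0]
  congr 1
  refine integral_congr_ae ?_
  filter_upwards [Measure.ae_ae_of_ae_prod hp] with p' hp'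
  refine integral_congr_ae ?_
  filter_upwards [hp'] with ω hω
  simp only [defect, hω.1, hω.2.1, hω.2.2.1, hω.2.2.2]

theorem integrable_collMeasure_comp {φ : Mom → ℂ} (hβ : 0 < β)
    (hφ : Integrable φ (invMeasure α β)) :
    Integrable (fun z => φ z.1.1) (collMeasure α β)
    ∧ Integrable (fun z => φ z.1.2) (collMeasure α β)
    ∧ Integrable (fun z => φ z.2.1) (collMeasure α β)
    ∧ Integrable (fun z => φ z.2.2) (collMeasure α β) := by
  have := isFiniteMeasure_invMeasure (α := α) hβ
  have h : Integrable φ ((invMeasure α β) univ • invMeasure α β) :=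
    hφ.smul_measure (measure_ne_top _ _)
  exact ⟨measurePreserving_fst_fst.integrable_comp_of_integrable h,
    measurePreserving_fst_snd.integrable_comp_of_integrable h,
    measurePreserving_snd_fst.integrable_comp_of_integrable h,
    measurePreserving_snd_snd.integrable_comp_of_integrable h⟩

theorem ae_integrable_quad {F : (Mom × Mom) × (Mom × Mom) → ℂ}
    (hF : Integrable F (collMeasure α β)) : ∀ᵐ p ∂(invMeasure α β),
      Integrable (fun y => F (quad (p, y))) ((invMeasure α β).prod unif) :=
  (measurePreserving_quad.integrable_comp_of_integrable hF).prod_right_ae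

theorem integral_collMeasure {F : (Mom × Mom) × (Mom × Mom) → ℂ}
    (hF : Integrable F (collMeasure α β)) :
    ∫ z, F z ∂(collMeasure α β)
      = ∫ p, (∫ y, F (quad (p, y)) ∂((invMeasure α β).prod unif)) ∂(invMeasure α β) := by
  have h1 : ∫ z, F z ∂(collMeasure α β)
      = ∫ x, F (quad x) ∂((invMeasure α β).prod ((invMeasure α β).prod unif)) := by
    rw [collMeasure] at hF ⊢
    exact integral_map measurable_quad.aemeasurable hF.1
  rw [h1, integral_prod]
  exact measurePreserving_quad.integrable_comp_of_integrable hF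

theorem integral_prod_unif_fst (φ : Mom → ℂ) :
    ∫ y : Mom × S2, φ y.1 ∂((invMeasure α β).prod unif) = ∫ p, φ p ∂(invMeasure α β) := by
  rw [integral_fun_fst]
  simp

theorem collision_eq_integral_defect (hβ : 0 < β) (g : ℝ) {φ : Mom → ℂ}
    (hφ : Integrable φ (invMeasure α β)) :
    collision α β g φ =ᵐ[invMeasure α β]
      fun p => (g / 2 : ℝ) * ∫ y, defect φ (quad (p, y)) ∂((invMeasure α β).prod unif) := by
  obtain ⟨h1, h2, h3, h4⟩ := integrable_collMeasure_comp hβ hφ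
  filter_upwards [ae_invMeasure_ne_zero, ae_integrable_quad (((h3.add h4).sub h1).sub h2)]
    with p hp hd
  have hd' : Integrable (fun y => defect φ (quad (p, y))) ((invMeasure α β).prod unif) := hd
  rw [collision_eq g φ hp, ← integral_prod (fun y => defect φ (quad (p, y))) hd']

/-- The loss term `-φ_p` integrates to `-M φ_p`: the collision frequency is constant. -/
theorem collision_eq_gain (hβ : 0 < β) (g : ℝ) {φ : Mom → ℂ}
    (hφ : Integrable φ (invMeasure α β)) :
    collision α β g φ =ᵐ[invMeasure α β]
      fun p => (g / 2 : ℝ) * (gain α β φ p - (invDensity α β : ℝ) * φ p) := by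
  have := isFiniteMeasure_invMeasure (α := α) hβ
  obtain ⟨h1, h2, h3, h4⟩ := integrable_collMeasure_comp hβ hφ
  filter_upwards [collision_eq_integral_defect hβ g hφ, ae_integrable_quad ((h3.add h4).sub h2)]
    with p hp hi
  have hi' : Integrable (fun y => gainKernel φ (quad (p, y))) ((invMeasure α β).prod unif) := hi
  rw [hp, gain]
  congr 1
  have h : ∀ y, defect φ (quad (p, y)) = gainKernel φ (quad (p, y)) - φ p := by
    intro y
    simp only [defect, gainKernel, quad]
    ring
  simp only [h]
  rw [integral_sub hi' (integrable_const _), integral_const, invDensity_eq]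
  congr 1
  have h5 : ((invMeasure α β).prod unif).real univ = (invMeasure α β).real univ := by
    rw [Measure.real, Measure.real, ← univ_prod_univ, Measure.prod_prod,
      measure_univ (μ := unif), mul_one]
  rw [h5, Complex.real_smul]

theorem memLp_gain (hβ : 0 < β) {φ : Mom → ℂ} (hm : Measurable φ)
    (hφ : MemLp φ 2 (eqMeasure α β)) :
    MemLp (fun p => ((‖p‖⁻¹ : ℝ) : ℂ) * gain α β φ p) 2 (eqMeasure α β) := by
  have hφ1 := integrable_invMeasure_of_memLp hβ hφ
  obtain ⟨h1, h2, h3, h4⟩ := integrable_collMeasure_comp hβ hφ1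
  have hc : MemLp (fun p : Mom => ((‖p‖⁻¹ : ℝ) : ℂ) * ∫ p, φ p ∂(invMeasure α β)) 2
      (eqMeasure α β) := by
    refine memLp_eqMeasure_iff.2 ⟨by fun_prop, ?_⟩
    refine ((integrable_inv_norm hβ).mul_const (‖∫ p, φ p ∂(invMeasure α β)‖ ^ 2)).congr ?_
    filter_upwards [ae_invMeasure_ne_zero] with p hp
    have hp := norm_pos_iff.2 hp
    rw [norm_mul, mul_pow, Complex.norm_real, Real.norm_eq_abs, abs_of_pos (inv_pos.2 hp)]
    field_simp
  refine MemLp.ae_eq ?_ (((gainBound_snd_fst hβ hm hφ).memLp hβ).add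
    ((gainBound_snd_snd hβ hm hφ).memLp hβ) |>.sub hc)
  refine eqMeasure_absolutelyContinuous.ae_le ?_
  filter_upwards [ae_integrable_quad h2, ae_integrable_quad h3, ae_integrable_quad h4]
    with p i2 i3 i4
  simp only [Pi.add_apply, Pi.sub_apply]
  rw [gain]
  simp only [gainKernel]
  have i34 : Integrable (fun y => φ (quad (p, y)).2.1 + φ (quad (p, y)).2.2)
    ((invMeasure α β).prod unif) := i3.add i4
  rw [integral_sub i34 i2, integral_add i3 i4, ← integral_prod_unif_fst φ]
  simp only [quad]
  ring

theorem integrable_mul_gainKernel (hβ : 0 < β) {φ ψ : Mom → ℂ} (hmφ : Measurable φ)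
    (hφ : MemLp φ 2 (eqMeasure α β)) (hmψ : Measurable ψ) (hψ : MemLp ψ 2 (eqMeasure α β)) :
    Integrable (fun z => ψ z.1.1 * φ z.2.1) (collMeasure α β) ∧
    Integrable (fun z => ψ z.1.1 * φ z.2.2) (collMeasure α β) ∧
    Integrable (fun z => ψ z.1.1 * φ z.1.2) (collMeasure α β) := by
  refine ⟨(gainBound_snd_fst hβ hmφ hφ).integrable_mul hβ hmψ hψ,
    (gainBound_snd_snd hβ hmφ hφ).integrable_mul hβ hmψ hψ, ?_⟩
  have hφ1 := integrable_invMeasure_of_memLp hβ hφ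
  have hψ1 := integrable_invMeasure_of_memLp hβ hψ
  have h1 : Integrable (fun y : Mom × S2 => φ y.1) ((invMeasure α β).prod unif) := hφ1.comp_fst _
  have h2 : Integrable (fun x : Mom × (Mom × S2) => ψ x.1 * φ x.2.1)
      ((invMeasure α β).prod ((invMeasure α β).prod unif)) := hψ1.mul_prod h1
  rw [collMeasure, integrable_map_measure (by fun_prop) measurable_quad.aemeasurable]
  exact h2

/-- The gain operator is symmetric: exchanging the roles of the momenta in a collision preserves the
measure. -/
theorem integral_gain_symm (hβ : 0 < β) {φ ψ : Mom → ℂ} (hmφ : Measurable φ)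
    (hφ : MemLp φ 2 (eqMeasure α β)) (hmψ : Measurable ψ) (hψ : MemLp ψ 2 (eqMeasure α β)) :
    ∫ p, ψ p * gain α β φ p ∂(invMeasure α β) = ∫ p, φ p * gain α β ψ p ∂(invMeasure α β) := by
  have key : ∀ {φ ψ : Mom → ℂ}, Measurable φ → MemLp φ 2 (eqMeasure α β) → Measurable ψ →
      MemLp ψ 2 (eqMeasure α β) → ∫ p, ψ p * gain α β φ p ∂(invMeasure α β)
        = ∫ z, ψ z.1.1 * φ z.2.1 ∂(collMeasure α β) + ∫ z, ψ z.1.1 * φ z.2.2 ∂(collMeasure α β)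
          - ∫ z, ψ z.1.1 * φ z.1.2 ∂(collMeasure α β) := by
    intro φ ψ hmφ hφ hmψ hψ
    obtain ⟨h1, h2, h3⟩ := integrable_mul_gainKernel hβ hmφ hφ hmψ hψ
    have h12 : Integrable (fun z => ψ z.1.1 * φ z.2.1 + ψ z.1.1 * φ z.2.2) (collMeasure α β) :=
      h1.add h2
    have h123 : Integrable (fun z => ψ z.1.1 * φ z.2.1 + ψ z.1.1 * φ z.2.2 - ψ z.1.1 * φ z.1.2)
      (collMeasure α β) := h12.sub h3
    rw [← integral_add h1 h2, ← integral_sub h12 h3, integral_collMeasure h123]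
    refine integral_congr_ae (Eventually.of_forall fun p => ?_)
    simp only [gain, ← integral_const_mul]
    congr 1 with y
    simp only [gainKernel, quad]
    ring
  rw [key hmφ hφ hmψ hψ, key hmψ hψ hmφ hφ]
  have e1 : ∫ z, ψ z.1.1 * φ z.2.1 ∂(collMeasure α β) = ∫ z, φ z.1.1
      * ψ z.2.1 ∂(collMeasure α β) := by
    rw [← measurePreserving_swap.integral_comp measurableEmbedding_swap]
    simp only [Prod.fst_swap, Prod.snd_swap, mul_comm]
  have e2 : ∫ z, ψ z.1.1 * φ z.2.2 ∂(collMeasure α β) = ∫ z, φ z.1.1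
      * ψ z.2.2 ∂(collMeasure α β) := by
    rw [← measurePreserving_in.integral_comp measurableEmbedding_in,
      ← measurePreserving_swap.integral_comp measurableEmbedding_swap,
      ← measurePreserving_in.integral_comp measurableEmbedding_in]
    simp only [Prod.map, Prod.swap, id, mul_comm]
  have e3 : ∫ z, ψ z.1.1 * φ z.1.2 ∂(collMeasure α β) = ∫ z, φ z.1.1
      * ψ z.1.2 ∂(collMeasure α β) := by
    rw [← measurePreserving_in.integral_comp measurableEmbedding_in]
    simp only [Prod.map, Prod.swap, id, mul_comm]
  rw [e1, e2, e3]

theorem gain_conj (φ : Mom → ℂ) (p : Mom) :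
    gain α β (fun p => (starRingEnd ℂ) (φ p)) p = (starRingEnd ℂ) (gain α β φ p) := by
  rw [gain, gain, ← integral_conj]
  simp only [gainKernel, map_add, map_sub]

/-! ### Self-adjointness and dissipativity of the generator -/

variable {g : ℝ}

theorem invDensity_pos (hβ : 0 < β) : 0 < invDensity α β := by
  rw [invDensity_val hβ]
  positivity

theorem measurable_state (φ : State α β) : Measurable (φ : Mom → ℂ) :=
  (Lp.stronglyMeasurable φ).measurable

theorem integrable_state (hβ : 0 < β) (φ : State α β) :
    Integrable (φ : Mom → ℂ) (invMeasure α β) :=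
  integrable_invMeasure_of_memLp hβ (Lp.memLp φ)

/-- The bounded part of the generator, as a map of the Hilbert space. -/
noncomputable def gainState (hβ : 0 < β) (φ : State α β) : State α β :=
  (memLp_gain hβ (measurable_state φ) (Lp.memLp φ)).toLp _

theorem coe_gainState (hβ : 0 < β) (φ : State α β) :
    gainState hβ φ =ᵐ[eqMeasure α β] fun p => ((‖p‖⁻¹ : ℝ) : ℂ) * gain α β φ p :=
  MemLp.coeFn_toLp _

theorem inner_gainState (hβ : 0 < β) (φ ψ : State α β) :
    ⟪gainState hβ φ, ψ⟫_ℂ = ⟪φ, gainState hβ ψ⟫_ℂ := by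
  have hc : Measurable fun p => (starRingEnd ℂ) (φ p) :=
    Complex.continuous_conj.measurable.comp (measurable_state φ)
  have hcm : MemLp (fun p => (starRingEnd ℂ) (φ p)) 2 (eqMeasure α β) := (Lp.memLp φ).star
  have h := integral_gain_symm hβ hc hcm (measurable_state ψ) (Lp.memLp ψ)
  have h1 : ⟪gainState hβ φ, ψ⟫_ℂ
      = ∫ p, ψ p * gain α β (fun p => (starRingEnd ℂ) (φ p)) p ∂(invMeasure α β) := by
    rw [L2.inner_def, integral_congr_ae (g := fun p => ψ p *
      (starRingEnd ℂ) (((‖p‖⁻¹ : ℝ) : ℂ) * gain α β φ p)), integral_eqMeasure]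
    · refine integral_congr_ae ?_
      filter_upwards [ae_invMeasure_ne_zero] with p hp
      have hp := Complex.ofReal_ne_zero.2 (norm_ne_zero_iff.2 hp)
      rw [gain_conj, map_mul, Complex.conj_ofReal]
      push_cast
      field_simp
    · filter_upwards [coe_gainState hβ φ] with p hp
      rw [RCLike.inner_apply, hp]
  have h2 : ⟪φ, gainState hβ ψ⟫_ℂ
      = ∫ p, (starRingEnd ℂ) (φ p) * gain α β ψ p ∂(invMeasure α β) := by
    rw [L2.inner_def, integral_congr_ae (g := fun p => (((‖p‖⁻¹ : ℝ) : ℂ) * gain α β ψ p) *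
      (starRingEnd ℂ) (φ p)), integral_eqMeasure]
    · refine integral_congr_ae ?_
      filter_upwards [ae_invMeasure_ne_zero] with p hp
      have hp := Complex.ofReal_ne_zero.2 (norm_ne_zero_iff.2 hp)
      push_cast
      field_simp
    · filter_upwards [coe_gainState hβ ψ] with p hp
      rw [RCLike.inner_apply, hp]
  rw [h1, h2, h]

/-- Multiplication by a real function is symmetric. -/
theorem inner_of_mul_real {r : Mom → ℝ} {φ φ' ψ ψ' : State α β}
    (hφ : φ' =ᵐ[eqMeasure α β] fun p => (r p : ℂ) * φ p)
    (hψ : ψ' =ᵐ[eqMeasure α β] fun p => (r p : ℂ) * ψ p) : ⟪φ', ψ⟫_ℂ = ⟪φ, ψ'⟫_ℂ := by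
  rw [L2.inner_def, L2.inner_def]
  refine integral_congr_ae ?_
  filter_upwards [hφ, hψ] with p h1 h2
  rw [RCLike.inner_apply, RCLike.inner_apply, h1, h2, map_mul, Complex.conj_ofReal]
  ring

theorem exists_mul_real {r : Mom → ℝ} (hr : Measurable r) (hb : ∀ p, |r p| ≤ 1) (φ : State α β) :
    ∃ φ' : State α β, φ' =ᵐ[eqMeasure α β] fun p => (r p : ℂ) * φ p := by
  have hm := measurable_state φ
  have h : MemLp (fun p => (r p : ℂ) * φ p) 2 (eqMeasure α β) := by
    refine (Lp.memLp φ).of_le (by fun_prop) (Eventually.of_forall fun p => ?_)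
    rw [norm_mul, Complex.norm_real, Real.norm_eq_abs]
    exact mul_le_of_le_one_left (norm_nonneg _) (hb p)
  exact ⟨h.toLp _, MemLp.coeFn_toLp _⟩

theorem collision_eq_gain' (hβ : 0 < β) (g : ℝ) (φ : State α β) :
    (fun p => ((‖p‖⁻¹ : ℝ) : ℂ) * collision α β g (φ : Mom → ℂ) p) =ᵐ[eqMeasure α β]
      fun p => ((g / 2 : ℝ) : ℂ) * gainState hβ φ p
        - ((g * invDensity α β / 2 : ℝ) : ℂ) * (((‖p‖⁻¹ : ℝ) : ℂ) * φ p) := by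
  filter_upwards [eqMeasure_absolutelyContinuous.ae_le
    (collision_eq_gain hβ g (integrable_state hβ φ)), coe_gainState hβ φ] with p h1 h2
  rw [h1, h2]
  push_cast
  ring

/-- The domain of the generator consists of the `φ` such that `φ / p⁰` is in the Hilbert space, and
there the generator is a multiplication operator plus a bounded operator. -/
theorem mem_generator_iff (hβ : 0 < β) (hg : 0 < g) (φ χ : State α β) :
    (φ, χ) ∈ generator α β g ↔ ∃ μ : State α β,
      (μ =ᵐ[eqMeasure α β] fun p => ((‖p‖⁻¹ : ℝ) : ℂ) * φ p) ∧
      χ = ((g / 2 : ℝ) : ℂ) • gainState hβ φ - ((g * invDensity α β / 2 : ℝ) : ℂ) • μ := by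
  have hM := invDensity_pos (α := α) hβ
  have hc : ((g * invDensity α β / 2 : ℝ) : ℂ) ≠ 0 := Complex.ofReal_ne_zero.2 (by positivity)
  constructor
  · intro h
    have h' : (χ : Mom → ℂ) =ᵐ[eqMeasure α β] fun p => ((‖p‖⁻¹ : ℝ) : ℂ) * collision α β g φ p := h
    refine ⟨((g * invDensity α β / 2 : ℝ) : ℂ)⁻¹ • (((g / 2 : ℝ) : ℂ) • gainState hβ φ - χ), ?_, ?_⟩
    · filter_upwards [h', collision_eq_gain' hβ g φ,
        Lp.coeFn_smul ((g * invDensity α β / 2 : ℝ) : ℂ)⁻¹ (((g / 2 : ℝ) : ℂ) • gainState hβ φ - χ),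
        Lp.coeFn_sub (((g / 2 : ℝ) : ℂ) • gainState hβ φ) χ,
        Lp.coeFn_smul ((g / 2 : ℝ) : ℂ) (gainState hβ φ)] with p h1 h2 h3 h4 h5
      rw [h3, Pi.smul_apply, h4, Pi.sub_apply, h5, Pi.smul_apply, h1, h2, smul_eq_mul, smul_eq_mul]
      field_simp
      ring
    · rw [smul_smul, mul_inv_cancel₀ hc, one_smul]
      abel
  · rintro ⟨μ, hμ, rfl⟩
    change ((_ - _ : State α β) : Mom → ℂ) =ᵐ[eqMeasure α β] _
    filter_upwards [hμ, collision_eq_gain' hβ g φ,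
      Lp.coeFn_sub (((g / 2 : ℝ) : ℂ) • gainState hβ φ) (((g * invDensity α β / 2 : ℝ) : ℂ) • μ),
      Lp.coeFn_smul ((g / 2 : ℝ) : ℂ) (gainState hβ φ),
      Lp.coeFn_smul ((g * invDensity α β / 2 : ℝ) : ℂ) μ] with p h1 h2 h3 h4 h5
    rw [h2, h3, Pi.sub_apply, h4, h5, Pi.smul_apply, Pi.smul_apply, h1, smul_eq_mul, smul_eq_mul]

/-- The multiplication operator by `1 / p⁰` is self-adjoint on its natural domain, and so is its sum
with a bounded symmetric operator. -/
theorem isSelfAdj_generator (hβ : 0 < β) (hg : 0 < g) :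
    SelfAdjointRelation.IsSelfAdj (generator α β g) := by
  have hM := invDensity_pos (α := α) hβ
  have hc : ((g * invDensity α β / 2 : ℝ) : ℂ) ≠ 0 := Complex.ofReal_ne_zero.2 (by positivity)
  intro φ χ
  constructor
  · intro h x hx
    obtain ⟨μ, hμ, rfl⟩ := (mem_generator_iff hβ hg φ χ).1 h
    obtain ⟨μ', hμ', hx2⟩ := (mem_generator_iff hβ hg x.1 x.2).1 hx
    rw [hx2, inner_sub_left, inner_sub_right, inner_smul_left, inner_smul_left, inner_smul_right,
      inner_smul_right, Complex.conj_ofReal, Complex.conj_ofReal, inner_gainState,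
      inner_of_mul_real hμ' hμ]
  · intro h
    -- the test vectors `ψ p⁰ / (1 + p⁰)`, for arbitrary `ψ`, are in the domain of the generator
    have h1p : ∀ p : Mom, 0 < 1 + ‖p‖ := fun p => by positivity
    have hs : Measurable fun p : Mom => ‖p‖ / (1 + ‖p‖) := by fun_prop
    have hr : Measurable fun p : Mom => 1 / (1 + ‖p‖) := by fun_prop
    have hsb : ∀ p : Mom, |‖p‖ / (1 + ‖p‖)| ≤ 1 := fun p => by
      rw [abs_of_nonneg (by positivity), div_le_one (h1p p)]
      linarith
    have hrb : ∀ p : Mom, |1 / (1 + ‖p‖)| ≤ 1 := fun p => by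
      rw [abs_of_nonneg (by positivity), div_le_one (h1p p)]
      linarith [norm_nonneg p]
    obtain ⟨ζ, hζ⟩ : ∃ ζ : State α β, ζ = ((g / 2 : ℝ) : ℂ) • gainState hβ φ - χ := ⟨_, rfl⟩
    obtain ⟨ζ', hζ'⟩ := exists_mul_real hs hsb ζ
    obtain ⟨φ', hφ'⟩ := exists_mul_real hr hrb φ
    -- `p⁰ ζ / (1 + p⁰) = (g M / 2) φ / (1 + p⁰)`, so `ζ` is `(g M / 2) φ / p⁰`
    have key : ζ' = ((g * invDensity α β / 2 : ℝ) : ℂ) • φ' := by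
      refine ext_inner_left ℂ fun ψ => ?_
      obtain ⟨ψs, hψs⟩ := exists_mul_real hs hsb ψ
      obtain ⟨ψr, hψr⟩ := exists_mul_real hr hrb ψ
      have hμ : ψr =ᵐ[eqMeasure α β] fun p => ((‖p‖⁻¹ : ℝ) : ℂ) * ψs p := by
        filter_upwards [hψs, hψr, ae_eqMeasure_ne_zero] with p h1 h2 hp
        rw [h1, h2, ← mul_assoc, ← Complex.ofReal_mul]
        congr 2
        have := norm_pos_iff.2 hp
        field_simp
      have hmem := (mem_generator_iff hβ hg ψs _).2 ⟨ψr, hμ, rfl⟩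
      have h2 := h _ hmem
      simp only at h2
      rw [inner_sub_left, inner_smul_left, inner_smul_left, Complex.conj_ofReal,
        Complex.conj_ofReal, inner_gainState, inner_of_mul_real hψr hφ'] at h2
      rw [← inner_of_mul_real hψs hζ', hζ, inner_sub_right, inner_smul_right, inner_smul_right,
        ← h2]
      ring
    refine (mem_generator_iff hβ hg φ χ).2
      ⟨((g * invDensity α β / 2 : ℝ) : ℂ)⁻¹ • ζ, ?_, ?_⟩
    · filter_upwards [hζ', hφ', Lp.coeFn_smul ((g * invDensity α β / 2 : ℝ) : ℂ)⁻¹ ζ,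
        Lp.coeFn_smul ((g * invDensity α β / 2 : ℝ) : ℂ) φ', ae_eqMeasure_ne_zero]
        with p h1 h2 h3 h4 hp
      have hp0 := norm_pos_iff.2 hp
      have hpc : ((‖p‖ : ℝ) : ℂ) ≠ 0 := Complex.ofReal_ne_zero.2 hp0.ne'
      have h1pc : (1 : ℂ) + ((‖p‖ : ℝ) : ℂ) ≠ 0 := by
        have := Complex.ofReal_ne_zero.2 (h1p p).ne'
        simpa using this
      rw [key, h4, Pi.smul_apply, h2, smul_eq_mul] at h1
      rw [h3, Pi.smul_apply, smul_eq_mul, inv_mul_eq_iff_eq_mul₀ hc]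
      push_cast at h1 ⊢
      field_simp at h1 ⊢
      linear_combination -h1
    · rw [smul_smul, mul_inv_cancel₀ hc, one_smul, hζ]
      abel

/-- A state `φ` for which `φ / p⁰` is a state has finite energy form: interpolation between the
weights `p⁰` and `1 / p⁰`. -/
theorem memLp_invMeasure_of_mem_domain {φ μ : State α β}
    (hμ : μ =ᵐ[eqMeasure α β] fun p => ((‖p‖⁻¹ : ℝ) : ℂ) * φ p) :
    MemLp (φ : Mom → ℂ) 2 (invMeasure α β) := by
  obtain ⟨h1, h2⟩ := memLp_eqMeasure_iff.1 (Lp.memLp φ)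
  obtain ⟨-, h3⟩ := memLp_eqMeasure_iff.1 (Lp.memLp μ)
  refine (memLp_two_iff_integrable_sq_norm h1).2 ((h2.add h3).mono' (h1.norm.pow 2) ?_)
  filter_upwards [invMeasure_absolutelyContinuous_eqMeasure.ae_le hμ, ae_invMeasure_ne_zero]
    with p h4 hp
  have hp0 := norm_pos_iff.2 hp
  simp only [Pi.add_apply]
  rw [h4, norm_mul, Complex.norm_real, norm_pow, norm_norm, norm_inv, norm_norm]
  obtain ⟨a, ha⟩ : ∃ a, a = ‖φ p‖ := ⟨_, rfl⟩
  rw [← ha]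
  have h5 : 0 ≤ ‖p‖⁻¹ * a ^ 2 * ((‖p‖ - 1) ^ 2 + ‖p‖) := by positivity
  have h6 : ‖p‖⁻¹ * a ^ 2 * ((‖p‖ - 1) ^ 2 + ‖p‖) = ‖p‖ * a ^ 2 + ‖p‖ * (‖p‖⁻¹ * a) ^ 2 - a ^ 2
      := by
    field_simp
    ring
  linarith

theorem memLp_collMeasure_comp {φ : Mom → ℂ} (hβ : 0 < β) (hφ : MemLp φ 2 (invMeasure α β)) :
    MemLp (fun z => φ z.1.1) 2 (collMeasure α β) ∧ MemLp (fun z => φ z.1.2) 2 (collMeasure α β)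
    ∧ MemLp (fun z => φ z.2.1) 2 (collMeasure α β)
    ∧ MemLp (fun z => φ z.2.2) 2 (collMeasure α β) := by
  have := isFiniteMeasure_invMeasure (α := α) hβ
  have h : MemLp φ 2 ((invMeasure α β) univ • invMeasure α β) :=
    hφ.smul_measure (measure_ne_top _ _)
  exact ⟨h.comp_measurePreserving measurePreserving_fst_fst,
    h.comp_measurePreserving measurePreserving_fst_snd,
    h.comp_measurePreserving measurePreserving_snd_fst,
    h.comp_measurePreserving measurePreserving_snd_snd⟩

/-- The weak form of the collision operator, symmetrised over the four momenta. -/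
theorem integral_conj_mul_defect {φ : Mom → ℂ} (hβ : 0 < β) (hφ : MemLp φ 2 (invMeasure α β)) :
    ∫ z, (starRingEnd ℂ) (φ z.1.1) * defect φ z ∂(collMeasure α β)
      = -(((1 / 4) * ∫ z, ‖defect φ z‖ ^ 2 ∂(collMeasure α β) : ℝ) : ℂ) := by
  obtain ⟨h1, h2, h3, h4⟩ := memLp_collMeasure_comp hβ hφ
  have hd : MemLp (defect φ) 2 (collMeasure α β) := ((h3.add h4).sub h1).sub h2
  have hint : ∀ {f : (Mom × Mom) × (Mom × Mom) → ℂ}, MemLp f 2 (collMeasure α β) →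
      Integrable (fun z => (starRingEnd ℂ) (f z) * defect φ z) (collMeasure α β) :=
    fun hf => hf.star.integrable_mul hd
  obtain ⟨I, hI⟩ : ∃ I, I = ∫ z, (starRingEnd ℂ) (φ z.1.1) * defect φ z ∂(collMeasure α β) :=
    ⟨_, rfl⟩
  have e2 : ∫ z, (starRingEnd ℂ) (φ z.1.2) * defect φ z ∂(collMeasure α β) = I := by
    rw [hI, ← measurePreserving_in.integral_comp measurableEmbedding_in]
    refine integral_congr_ae (Eventually.of_forall fun z => ?_)
    simp only [Prod.map, Prod.swap, id, defect]
    ring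
  have e3 : ∫ z, (starRingEnd ℂ) (φ z.2.1) * defect φ z ∂(collMeasure α β) = -I := by
    rw [hI, ← measurePreserving_swap.integral_comp measurableEmbedding_swap, ← integral_neg]
    refine integral_congr_ae (Eventually.of_forall fun z => ?_)
    simp only [Prod.swap, defect]
    ring
  have e4 : ∫ z, (starRingEnd ℂ) (φ z.2.2) * defect φ z ∂(collMeasure α β) = -I := by
    rw [← e2, ← measurePreserving_swap.integral_comp measurableEmbedding_swap, ← integral_neg]
    refine integral_congr_ae (Eventually.of_forall fun z => ?_)
    simp only [Prod.swap, defect]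
    ring
  have key : ((∫ z, ‖defect φ z‖ ^ 2 ∂(collMeasure α β) : ℝ) : ℂ) = -I + -I - I - I := by
    rw [← integral_complex_ofReal]
    have h5 : ∀ z, ((‖defect φ z‖ ^ 2 : ℝ) : ℂ) = (starRingEnd ℂ) (φ z.2.1) * defect φ z
        + (starRingEnd ℂ) (φ z.2.2) * defect φ z - (starRingEnd ℂ) (φ z.1.1) * defect φ z
        - (starRingEnd ℂ) (φ z.1.2) * defect φ z := by
      intro z
      rw [Complex.ofReal_pow, ← Complex.conj_mul', defect, map_sub, map_sub, map_add]
      ring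
    simp only [h5]
    have i34 : Integrable (fun z => (starRingEnd ℂ) (φ z.2.1) * defect φ z
        + (starRingEnd ℂ) (φ z.2.2) * defect φ z) (collMeasure α β) := (hint h3).add (hint h4)
    have i341 : Integrable (fun z => (starRingEnd ℂ) (φ z.2.1) * defect φ z
        + (starRingEnd ℂ) (φ z.2.2) * defect φ z - (starRingEnd ℂ) (φ z.1.1) * defect φ z)
        (collMeasure α β) := i34.sub (hint h1)
    rw [integral_sub i341 (hint h2), integral_sub i34 (hint h1), integral_add (hint h3) (hint h4),
      e2, e3, e4, ← hI]
  rw [← hI, Complex.ofReal_mul, key]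
  push_cast
  ring

/-- The quadratic form of the generator is `-(g / 8) ∫ |φ_q + φ_q' - φ_p - φ_p'|²`. -/
theorem isDissipative_generator (hβ : 0 < β) (hg : 0 < g) :
    SelfAdjointRelation.IsDissipative (generator α β g) := by
  rintro ⟨φ, χ⟩ h
  obtain ⟨μ, hμ, -⟩ := (mem_generator_iff hβ hg φ χ).1 h
  have hφ := memLp_invMeasure_of_mem_domain hμ
  obtain ⟨h1, h2, h3, h4⟩ := memLp_collMeasure_comp hβ hφ
  have hd : MemLp (defect φ) 2 (collMeasure α β) := ((h3.add h4).sub h1).sub h2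
  have hint : Integrable (fun z => (starRingEnd ℂ) (φ z.1.1) * defect φ z) (collMeasure α β) :=
    h1.star.integrable_mul hd
  have h' : (χ : Mom → ℂ) =ᵐ[eqMeasure α β] fun p => ((‖p‖⁻¹ : ℝ) : ℂ) * collision α β g φ p := h
  have key : ⟪φ, χ⟫_ℂ = ((g / 2 : ℝ) : ℂ) *
      ∫ z, (starRingEnd ℂ) (φ z.1.1) * defect φ z ∂(collMeasure α β) := by
    rw [integral_collMeasure hint, L2.inner_def, integral_congr_ae (g := fun p =>
      (((‖p‖⁻¹ : ℝ) : ℂ) * collision α β g φ p) * (starRingEnd ℂ) (φ p)), integral_eqMeasure,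
      ← integral_const_mul]
    · refine integral_congr_ae ?_
      filter_upwards [ae_invMeasure_ne_zero,
        collision_eq_integral_defect hβ g (integrable_state hβ φ)] with p hp hc
      have hp := Complex.ofReal_ne_zero.2 (norm_ne_zero_iff.2 hp)
      have h5 : ∫ y, (starRingEnd ℂ) (φ (quad (p, y)).1.1) * defect φ (quad (p, y))
          ∂((invMeasure α β).prod unif)
          = (starRingEnd ℂ) (φ p) * ∫ y, defect φ (quad (p, y)) ∂((invMeasure α β).prod unif) := by
        rw [← integral_const_mul]
        rfl
      rw [h5, hc]
      push_cast
      field_simp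
    · filter_upwards [h'] with p hp
      rw [RCLike.inner_apply, hp]
  simp only
  rw [key, integral_conj_mul_defect hβ hφ, ← Complex.ofReal_neg, ← Complex.ofReal_mul,
    Complex.ofReal_re]
  have : 0 ≤ ∫ z, ‖defect φ z‖ ^ 2 ∂(collMeasure α β) := integral_nonneg fun z => by positivity
  nlinarith

/-! ### The hydrodynamic states -/

/-- Quantities that are conserved in each collision are in the kernel of the collision operator. -/
theorem collision_eq_zero_of_defect {f : Mom → ℂ}
    (hf : ∀ p p' : Mom, ∀ ω : S2, defect f (quad (p, p', ω)) = 0) (p : Mom) :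
    collision α β g f p = 0 := by
  rcases eq_or_ne p 0 with rfl | hp
  · exact collision_zero g f
  · rw [collision_eq g f hp]
    simp [hf]

theorem mem_generator_zero_of_defect {f : Mom → ℂ}
    (hf : ∀ p p' : Mom, ∀ ω : S2, defect f (quad (p, p', ω)) = 0) {ψ : State α β}
    (hψ : (ψ : Mom → ℂ) =ᵐ[eqMeasure α β] f) : (ψ, (0 : State α β)) ∈ generator α β g := by
  change ((0 : State α β) : Mom → ℂ) =ᵐ[eqMeasure α β] _
  filter_upwards [Lp.coeFn_zero ℂ 2 (eqMeasure α β), eqMeasure_absolutelyContinuous.ae_le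
    (collision_congr_ae g (invMeasure_absolutelyContinuous_eqMeasure.ae_le hψ))] with p h1 h2
  rw [h1, h2, collision_eq_zero_of_defect hf]
  simp

/-- Conservation of particle number, energy and momentum. -/
theorem mem_generator_zero_of_mem_hydro (hβ : 0 < β) (hg : 0 < g) {ψ : State α β}
    (hψ : ψ ∈ hydro α β) : (ψ, (0 : State α β)) ∈ generator α β g := by
  have hG := isSelfAdj_generator (α := α) hβ hg
  let S := hG.submodule.comap (LinearMap.inl ℂ (State α β) (State α β))
  have hle : hydro α β ≤ S := by
    refine Submodule.span_le.2 ?_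
    rintro ψ (h | h | ⟨i, h⟩)
    · exact mem_generator_zero_of_defect (fun p p' ω => by simp [defect]) h
    · refine mem_generator_zero_of_defect (fun p p' ω => ?_) h
      simp only [defect, quad]
      rw [← Complex.ofReal_add, norm_outgoing_add, Complex.ofReal_add]
      ring
    · refine mem_generator_zero_of_defect (fun p p' ω => ?_) h
      simp only [defect, quad, PiLp.sub_apply, PiLp.add_apply]
      push_cast
      ring
  exact hle hψ

/-- The orthogonal complement of the non-hydrodynamic states is the closure of the hydrodynamic
ones, and the kernel is closed. -/
theorem mem_generator_zero_of_mem_nonHydro_orthogonal (hβ : 0 < β) (hg : 0 < g) {ψ : State α β}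
    (hψ : ψ ∈ (nonHydro α β)ᗮ) : (ψ, (0 : State α β)) ∈ generator α β g := by
  have hG := isSelfAdj_generator (α := α) hβ hg
  rw [nonHydro, Submodule.orthogonal_orthogonal_eq_closure] at hψ
  have hc : IsClosed {ψ : State α β | (ψ, (0 : State α β)) ∈ generator α β g} :=
    hG.isClosed.preimage (by fun_prop : Continuous fun ψ : State α β => (ψ, (0 : State α β)))
  exact closure_minimal (fun ψ h => mem_generator_zero_of_mem_hydro hβ hg h) hc hψ

theorem mem_nonHydro_of_mem_generator (hβ : 0 < β) (hg : 0 < g) {φ χ : State α β}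
    (h : (φ, χ) ∈ generator α β g) : χ ∈ nonHydro α β := by
  rw [nonHydro, Submodule.mem_orthogonal]
  intro ψ hψ
  have := (isSelfAdj_generator hβ hg).symm (mem_generator_zero_of_mem_hydro hβ hg hψ) h
  simpa using this.symm

/-! ### Powers of null components under the gain operator -/

/-- The product of the four-momentum of a massless particle with the null vector `(1, a)`. -/
noncomputable def nullComp (a p : Mom) : ℝ := ‖p‖ - ⟪a, p⟫_ℝ

theorem nullComp_nonneg {a : Mom} (ha : ‖a‖ = 1) (p : Mom) : 0 ≤ nullComp a p := by
  have := real_inner_le_norm a p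
  rw [ha, one_mul] at this
  unfold nullComp
  linarith

theorem nullComp_le {a : Mom} (ha : ‖a‖ = 1) (p : Mom) : nullComp a p ≤ 2 * ‖p‖ := by
  have := neg_le_of_abs_le (abs_real_inner_le_norm a p)
  rw [ha, one_mul] at this
  unfold nullComp
  linarith

theorem integral_unif (F : S2 → ℝ) : ∫ ω, F ω ∂unif = (4 * Real.pi)⁻¹ * ∫ ω, F ω ∂area := by
  rw [unif, integral_smul_measure, ENNReal.toReal_ofReal (by positivity), smul_eq_mul]

/-- The null component of the emitted momentum is uniformly distributed between `0` and the null
component of the total momentum. -/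
theorem integral_nullComp_outgoing_pow {a : Mom} {p p' : Mom} (hp : p ≠ 0)
    (ha : ‖a‖ = 1) (m : ℕ) :
    ∫ ω, nullComp a (outgoing p p' ω) ^ m ∂unif
      = (nullComp a p + nullComp a p') ^ m / (m + 1) := by
  obtain ⟨E, hE⟩ : ∃ E, E = ‖p‖ + ‖p'‖ := ⟨_, rfl⟩
  obtain ⟨P, hP⟩ : ∃ P, P = p + p' := ⟨_, rfl⟩
  have hPE : ‖P‖ ≤ E := by rw [hP, hE]; exact norm_add_le _ _
  have hE0 : 0 < E := by
    rw [hE]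
    have := norm_pos_iff.2 hp
    positivity
  obtain ⟨R, hR⟩ : ∃ R, R = √(E ^ 2 - ‖P‖ ^ 2) := ⟨_, rfl⟩
  have hR0 : 0 ≤ R := hR ▸ Real.sqrt_nonneg _
  have hR2 : R ^ 2 = E ^ 2 - ‖P‖ ^ 2 := by
    rw [hR, Real.sq_sqrt]
    nlinarith [norm_nonneg P]
  obtain ⟨s, hs⟩ : ∃ s, s = ⟪a, P⟫_ℝ := ⟨_, rfl⟩
  have hER : E + R ≠ 0 := by positivity
  obtain ⟨c, hc⟩ : ∃ c, c = nullComp a p + nullComp a p' := ⟨_, rfl⟩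
  have hcE : c = E - s := by
    rw [hc, hE, hs, hP, nullComp, nullComp, inner_add_right]
    ring
  have hc0 : 0 ≤ c := by
    rw [hc]
    exact add_nonneg (nullComp_nonneg ha p) (nullComp_nonneg ha p')
  -- the null component of the emitted momentum is `(c + ⟪v, ω⟫) / 2`, and `‖v‖ = c` because
  -- `(c, -v)` is `√s` times the null vector `(1, a)` boosted to the rest frame
  obtain ⟨v, hv⟩ : ∃ v, v = (1 - s / (E + R)) • P - R • a := ⟨_, rfl⟩
  have hvn : ‖v‖ = c := by
    have h1 : ‖v‖ ^ 2 = c ^ 2 := by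
      rw [hv, norm_sub_sq_real, norm_smul, norm_smul, inner_smul_left, inner_smul_right,
        real_inner_comm, ← hs, ha, mul_one, mul_pow, Real.norm_eq_abs, Real.norm_eq_abs, sq_abs,
        sq_abs, conj_trivial, hcE]
      have h2 : ‖P‖ ^ 2 = E ^ 2 - R ^ 2 := by linarith
      rw [h2]
      field_simp
      ring
    exact (pow_left_inj₀ (norm_nonneg _) hc0 two_ne_zero).1 h1
  obtain ⟨n, hn, hvc⟩ : ∃ n : Mom, ‖n‖ = 1 ∧ v = c • n := by
    rcases eq_or_ne v 0 with h | h
    · obtain ⟨n, hn⟩ := exists_unit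
      have : c = 0 := by rw [← hvn, h, norm_zero]
      exact ⟨n, hn, by simp [h, this]⟩
    · have h' := norm_ne_zero_iff.2 h
      exact ⟨‖v‖⁻¹ • v, by rw [norm_smul, norm_inv, norm_norm, inv_mul_cancel₀ h'],
        by rw [smul_smul, ← hvn, mul_inv_cancel₀ h', one_smul]⟩
  have hval : ∀ ω : S2, nullComp a (outgoing p p' ω) = c / 2 * (1 + ⟪n, (ω : Mom)⟫_ℝ) := by
    intro ω
    have hω : ‖(ω : Mom)‖ = 1 := by simp
    have h1 : c * ⟪n, (ω : Mom)⟫_ℝ = (1 - s / (E + R)) * ⟪P, (ω : Mom)⟫_ℝ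
        - R * ⟪a, (ω : Mom)⟫_ℝ := by
      rw [← real_inner_smul_left, ← hvc, hv, inner_sub_left, real_inner_smul_left,
        real_inner_smul_left]
    have h2 : ⟪a, emission E P ω⟫_ℝ
        = 1 / 2 * (s + R * ⟪a, (ω : Mom)⟫_ℝ + ⟪P, (ω : Mom)⟫_ℝ / (E + R) * s) := by
      rw [emission, real_inner_smul_right, inner_add_right, inner_add_right, real_inner_smul_right,
        real_inner_smul_right, ← hs, ← hR]
    rw [outgoing_eq_emission, ← hE, ← hP, nullComp, norm_emission hPE hω, h2]
    linear_combination (-1 / 2) * h1 - (1 / 2) * hcE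
  simp only [hval, mul_pow]
  rw [integral_unif, integral_const_mul,
    integral_inner_area hn (F := fun u => (1 + u) ^ m) (by fun_prop), ← hc]
  have h3 : ∫ u in (-1 : ℝ)..1, (1 + u) ^ m = 2 ^ (m + 1) / (m + 1) := by
    rw [intervalIntegral.integral_comp_add_left (fun u => u ^ m)]
    norm_num
  rw [h3, div_pow, pow_succ]
  have := Real.pi_ne_zero
  field_simp
  ring

theorem integrable_norm_pow (hβ : 0 < β) (k : ℕ) :
    Integrable (fun p : Mom => ‖p‖ ^ k) (invMeasure α β) := by
  refine ⟨by fun_prop, ?_⟩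
  have h : ∀ p : Mom, ‖‖p‖ ^ k‖ₑ = ENNReal.ofReal (‖p‖ ^ k) := fun p =>
    Real.enorm_eq_ofReal (by positivity)
  rw [HasFiniteIntegral]
  simp only [h, lintegral_invMeasure_pow hβ]
  exact ENNReal.ofReal_lt_top

theorem integrable_nullComp_pow (hβ : 0 < β) {a : Mom} (ha : ‖a‖ = 1) (k : ℕ) :
    Integrable (fun p : Mom => nullComp a p ^ k) (invMeasure α β) := by
  refine ((integrable_norm_pow hβ k).const_mul (2 ^ k)).mono' ?_ (Eventually.of_forall fun p => ?_)
  · exact (Continuous.pow (by unfold nullComp; fun_prop) k).aestronglyMeasurable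
  · rw [Real.norm_eq_abs, abs_of_nonneg (pow_nonneg (nullComp_nonneg ha p) k), ← mul_pow]
    exact pow_le_pow_left₀ (nullComp_nonneg ha p) (nullComp_le ha p) k

theorem integral_nullComp_pow (hβ : 0 < β) {a : Mom} (ha : ‖a‖ = 1) (k : ℕ) :
    ∫ p, nullComp a p ^ k ∂(invMeasure α β)
      = invDensity α β * ((2 / β) ^ k * k.factorial) := by
  have hnn : ∀ p, 0 ≤ nullComp a p ^ k := fun p => pow_nonneg (nullComp_nonneg ha p) k
  rw [integral_eq_lintegral_of_nonneg_ae (Eventually.of_forall hnn)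
    (integrable_nullComp_pow hβ ha k).1]
  have h1 : ∫⁻ p, ENNReal.ofReal (nullComp a p ^ k) ∂(invMeasure α β)
      = ∫⁻ p, ENNReal.ofReal (‖p‖ ^ k) * ENNReal.ofReal ((1 - ⟪a, p⟫_ℝ / ‖p‖) ^ k)
        ∂(invMeasure α β) := by
    refine lintegral_congr_ae ?_
    filter_upwards [ae_invMeasure_ne_zero] with p hp
    have := norm_ne_zero_iff.2 hp
    rw [← ENNReal.ofReal_mul (by positivity), ← mul_pow, nullComp, mul_sub, mul_one,
      mul_div_cancel₀ _ this]
  have h2 : ∫⁻ u in Ioo (-1 : ℝ) 1, ENNReal.ofReal ((1 - u) ^ k)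
      = ENNReal.ofReal (2 ^ (k + 1) / (k + 1)) := by
    have h3 : ∫ u in (-1 : ℝ)..1, (1 - u) ^ k = 2 ^ (k + 1) / (k + 1) := by
      rw [intervalIntegral.integral_comp_sub_left (fun u => u ^ k)]
      norm_num
    rw [intervalIntegral.integral_of_le (by norm_num), integral_Ioc_eq_integral_Ioo] at h3
    rw [← h3, ofReal_integral_eq_lintegral_ofReal]
    · exact (Continuous.integrableOn_Icc (by fun_prop)).mono_set Ioo_subset_Icc_self
    · filter_upwards [ae_restrict_mem measurableSet_Ioo] with u hu
      have : 0 < 1 - u := by linarith [hu.2]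
      simp only [Pi.zero_apply]
      positivity
  rw [h1, lintegral_invMeasure_pow_mul hβ k ha (h := fun u => (1 - u) ^ k) (by fun_prop), h2,
    ← ENNReal.ofReal_mul (by positivity), ← ENNReal.ofReal_mul (by positivity),
    ENNReal.toReal_ofReal (by positivity), invDensity_val hβ, Nat.factorial_succ,
    div_pow]
  push_cast
  field_simp
  ring

theorem measurable_outgoing_right (p : Mom) :
    Measurable fun y : Mom × S2 => outgoing p y.1 y.2 := by
  simp only [outgoing_eq_emission]
  exact measurable_emission (by fun_prop) (by fun_prop) (by fun_prop)

theorem norm_outgoing_le (p p' : Mom) (ω : S2) : ‖outgoing p p' ω‖ ≤ ‖p‖ + ‖p'‖ := by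
  have := norm_outgoing_add p p' ω
  linarith [norm_nonneg (p + p' - outgoing p p' ω)]

theorem integrable_add_norm_pow (hβ : 0 < β) (c : ℝ) (k : ℕ) :
    Integrable (fun p : Mom => (c + ‖p‖) ^ k) (invMeasure α β) := by
  simp only [add_pow]
  refine integrable_finsetSum _ fun i _ => ?_
  exact ((integrable_norm_pow hβ (k - i)).const_mul (c ^ i)).mul_const _

/-- Functions of polynomial growth can be integrated over the partner and the scattering angle. -/
theorem integrable_outgoing_of_le (hβ : 0 < β) {X : Type*} [MeasurableSpace X] {μ : Measure X}
    [IsFiniteMeasure μ] (p : Mom) {f : X → Mom → ℝ} {C : ℝ} {k : ℕ}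
    (hf : Measurable (Function.uncurry f)) (hle : ∀ x q, |f x q| ≤ C * ‖q‖ ^ k) (hC : 0 ≤ C) :
    Integrable (fun z : (Mom × S2) × X => f z.2 (outgoing p z.1.1 z.1.2))
      (((invMeasure α β).prod unif).prod μ) := by
  have hm : Measurable fun z : (Mom × S2) × X => (z.2, outgoing p z.1.1 z.1.2) :=
    measurable_snd.prodMk ((measurable_outgoing_right p).comp measurable_fst)
  have h1 : Integrable (fun z : (Mom × S2) × X => C * (‖p‖ + ‖z.1.1‖) ^ k)
      (((invMeasure α β).prod unif).prod μ) :=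
    (((integrable_add_norm_pow hβ ‖p‖ k).const_mul C).comp_fst unif).comp_fst μ
  refine h1.mono' (hf.comp hm).aestronglyMeasurable (Eventually.of_forall fun z => ?_)
  rw [Real.norm_eq_abs]
  refine (hle _ _).trans ?_
  gcongr
  exact norm_outgoing_le _ _ _

theorem integrable_outgoing_of_le' (hβ : 0 < β) (p : Mom) {f : Mom → ℝ} {C : ℝ} {k : ℕ}
    (hf : Measurable f) (hle : ∀ q, |f q| ≤ C * ‖q‖ ^ k) (hC : 0 ≤ C) :
    Integrable (fun y : Mom × S2 => f (outgoing p y.1 y.2)) ((invMeasure α β).prod unif) := by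
  have h1 : Integrable (fun y : Mom × S2 => C * (‖p‖ + ‖y.1‖) ^ k)
      ((invMeasure α β).prod unif) :=
    ((integrable_add_norm_pow hβ ‖p‖ k).const_mul C).comp_fst unif
  refine h1.mono' (hf.comp (measurable_outgoing_right p)).aestronglyMeasurable
    (Eventually.of_forall fun y => ?_)
  rw [Real.norm_eq_abs]
  refine (hle _).trans ?_
  gcongr
  exact norm_outgoing_le _ _ _

/-- The normalised powers of null components, on which the gain operator is triangular. -/
noncomputable def nullPow (β : ℝ) (m : ℕ) (a p : Mom) : ℝ :=
  (β / 2 * nullComp a p) ^ m / m.factorial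

theorem continuous_nullPow (m : ℕ) {X : Type*} [TopologicalSpace X] {a q : X → Mom}
    (ha : Continuous a) (hq : Continuous q) : Continuous fun x => nullPow β m (a x) (q x) := by
  unfold nullPow nullComp
  fun_prop

theorem abs_nullPow_le (hβ : 0 < β) {a : Mom} (ha : ‖a‖ = 1) (m : ℕ) (q : Mom) :
    |nullPow β m a q| ≤ (β ^ m / m.factorial) * ‖q‖ ^ m := by
  have h := nullComp_nonneg ha q
  have e : (β ^ m / m.factorial) * ‖q‖ ^ m = (β * ‖q‖) ^ m / m.factorial := by
    rw [mul_pow]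
    ring
  rw [nullPow, abs_of_nonneg (by positivity), e]
  have h1 : β / 2 * nullComp a q ≤ β * ‖q‖ := by
    have := mul_le_mul_of_nonneg_left (nullComp_le ha q) (half_pos hβ).le
    linarith
  have h2 := pow_le_pow_left₀ (by positivity) h1 m
  gcongr

/-- The gain operator maps the `m`-th power of a null component to a combination of the powers up to
the `m`-th, with all coefficients equal in this normalisation. -/
theorem integral_nullPow_outgoing (hβ : 0 < β) {a p : Mom} (ha : ‖a‖ = 1) (hp : p ≠ 0) (m : ℕ) :
    ∫ y, nullPow β m a (outgoing p y.1 y.2) ∂((invMeasure α β).prod unif)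
      = invDensity α β / (m + 1) * ∑ i ∈ Finset.range (m + 1), nullPow β i a p := by
  have hint : Integrable (fun y : Mom × S2 => nullPow β m a (outgoing p y.1 y.2))
      ((invMeasure α β).prod unif) :=
    integrable_outgoing_of_le' hβ p
      (continuous_nullPow m continuous_const continuous_id).measurable
      (abs_nullPow_le hβ ha m) (by positivity)
  rw [integral_prod _ hint]
  have h1 : ∀ p', ∫ ω, nullPow β m a (outgoing p p' ω) ∂unif
      = (β / 2) ^ m / m.factorial / (m + 1) * ∑ i ∈ Finset.range (m + 1),
        nullComp a p ^ i * (m.choose i) * nullComp a p' ^ (m - i) := by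
    intro p'
    have h2 : ∀ ω : S2, nullPow β m a (outgoing p p' ω)
        = (β / 2) ^ m / m.factorial * nullComp a (outgoing p p' ω) ^ m := by
      intro ω
      rw [nullPow, mul_pow]
      ring
    simp only [h2]
    rw [integral_const_mul, integral_nullComp_outgoing_pow hp ha, add_pow]
    simp only [Finset.mul_sum, Finset.sum_div]
    refine Finset.sum_congr rfl fun i _ => ?_
    ring
  simp only [h1]
  rw [integral_const_mul, integral_finsetSum]
  · simp only [integral_const_mul, integral_nullComp_pow hβ ha, Finset.mul_sum]
    refine Finset.sum_congr rfl fun i hi => ?_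
    have hi' : i ≤ m := Nat.lt_succ_iff.1 (Finset.mem_range.1 hi)
    have hch := Nat.choose_mul_factorial_mul_factorial hi'
    have hch' : (m.choose i : ℝ) * i.factorial * (m - i).factorial = m.factorial := by
      exact_mod_cast hch
    have hpow : (β / 2) ^ m * (2 / β) ^ (m - i) = (β / 2) ^ i := by
      have : (β / 2) ^ m = (β / 2) ^ i * (β / 2) ^ (m - i) := by rw [← pow_add]; congr 1; omega
      have h3 : β / 2 * (2 / β) = 1 := by field_simp
      rw [this, mul_assoc, ← mul_pow, h3, one_pow, mul_one]
    have f1 : (i.factorial : ℝ) ≠ 0 := by positivity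
    have f2 : (m.factorial : ℝ) ≠ 0 := by positivity
    rw [nullPow, mul_pow, ← hpow]
    rw [← hch'] at f2 ⊢
    have f3 : ((m - i).factorial : ℝ) ≠ 0 := by positivity
    have f4 : (m.choose i : ℝ) ≠ 0 := by
      have := Nat.choose_pos hi'
      positivity
    field_simp
  · intro i _
    exact (integrable_nullComp_pow hβ ha (m - i)).const_mul _

/-! ### The angular average of powers of null components -/

/-- The projection of the powers of null components to the spherical harmonic `p² p³`. -/
noncomputable def tensorPow (β : ℝ) (m : ℕ) (p : Mom) : ℝ :=
  ∫ a : S2, nullPow β m a p * ((a : Mom) 1 * (a : Mom) 2) ∂area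

/-- The factor `m (m - 1)` makes the projections with `m < 2` vanish. -/
theorem tensorPow_eq (m : ℕ) {p : Mom} (hp : p ≠ 0) :
    tensorPow β m p = 4 * Real.pi * (m * (m - 1) / (m + 3).factorial)
      * ((β * ‖p‖) ^ m * (p 1 * p 2) / ‖p‖ ^ 2) := by
  have hp0 := norm_pos_iff.2 hp
  obtain ⟨n, hn, hpn⟩ : ∃ n : Mom, ‖n‖ = 1 ∧ p = ‖p‖ • n := by
    exact ⟨‖p‖⁻¹ • p, by rw [norm_smul, norm_inv, norm_norm, inv_mul_cancel₀ hp0.ne'],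
      by rw [smul_smul, mul_inv_cancel₀ hp0.ne', one_smul]⟩
  have h1 : ∀ a : S2, nullPow β m a p
      = (β * ‖p‖ / 2) ^ m / m.factorial * (1 - ⟪n, (a : Mom)⟫_ℝ) ^ m := by
    intro a
    have : ⟪(a : Mom), p⟫_ℝ = ‖p‖ * ⟪n, (a : Mom)⟫_ℝ := by
      conv_lhs => rw [hpn, real_inner_smul_right, real_inner_comm]
    have e : β / 2 * (‖p‖ - ‖p‖ * ⟪n, (a : Mom)⟫_ℝ) = β * ‖p‖ / 2 * (1 - ⟪n, (a : Mom)⟫_ℝ) := by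
      ring
    rw [nullPow, nullComp, this, e, mul_pow]
    ring
  have h2 : ∫ u in (-1 : ℝ)..1, (1 - u) ^ m * ((3 * u ^ 2 - 1) / 2)
      = (2 : ℝ) ^ (m + 1) * ((m : ℝ) * ((m : ℝ) - 1)) / (((m : ℝ) + 1) * ((m : ℝ) + 2)
          * ((m : ℝ) + 3)) := by
    have h3 : ∀ u : ℝ, (1 - u) ^ m * ((3 * u ^ 2 - 1) / 2)
        = (fun v : ℝ => v ^ m - 3 * v ^ (m + 1) + 3 / 2 * v ^ (m + 2)) (1 - u) := by
      intro u
      simp only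
      ring
    simp only [h3]
    rw [intervalIntegral.integral_comp_sub_left
      (fun v : ℝ => v ^ m - 3 * v ^ (m + 1) + 3 / 2 * v ^ (m + 2)),
      intervalIntegral.integral_add (Continuous.intervalIntegrable (by fun_prop) _ _)
        (Continuous.intervalIntegrable (by fun_prop) _ _),
      intervalIntegral.integral_sub (Continuous.intervalIntegrable (by fun_prop) _ _)
        (Continuous.intervalIntegrable (by fun_prop) _ _),
      intervalIntegral.integral_const_mul, intervalIntegral.integral_const_mul, integral_pow,
      integral_pow, integral_pow]
    push_cast
    have e1 : (m : ℝ) + 1 ≠ 0 := by positivity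
    have e2 : (m : ℝ) + 1 + 1 ≠ 0 := by positivity
    have e3 : (m : ℝ) + 2 + 1 ≠ 0 := by positivity
    have e4 : (m : ℝ) + 2 ≠ 0 := by positivity
    have e5 : (m : ℝ) + 3 ≠ 0 := by positivity
    norm_num
    field_simp
    ring
  have h4 : p 1 * p 2 / ‖p‖ ^ 2 = n 1 * n 2 := by
    have e : ∀ i, p i = ‖p‖ * n i := fun i => by
      conv_lhs => rw [hpn, PiLp.smul_apply, smul_eq_mul]
    rw [e 1, e 2]
    field_simp
  have h5 := integral_inner_mul_coord_mul_coord hn (F := fun u => (1 - u) ^ m) (by fun_prop)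
    (show (1 : Fin 3) ≠ 2 by decide)
  have h6 : ∀ a : S2, nullPow β m a p * ((a : Mom) 1 * (a : Mom) 2)
      = (β * ‖p‖ / 2) ^ m / m.factorial
      * ((1 - ⟪n, (a : Mom)⟫_ℝ) ^ m * ((a : Mom) 1 * (a : Mom) 2)) := by
    intro a
    rw [h1, mul_assoc]
  unfold tensorPow
  simp only [h6]
  rw [integral_const_mul, h5, h2, mul_div_assoc ((β * ‖p‖) ^ m), h4,
    Nat.factorial_succ, Nat.factorial_succ,
    Nat.factorial_succ, div_pow]
  push_cast
  have f2 : (m.factorial : ℝ) ≠ 0 := by positivity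
  have e1 : (m : ℝ) + 1 ≠ 0 := by positivity
  have e2 : (m : ℝ) + 1 + 1 ≠ 0 := by positivity
  have e3 : (m : ℝ) + 2 + 1 ≠ 0 := by positivity
  have e4 : (m : ℝ) + 2 ≠ 0 := by positivity
  have e5 : (m : ℝ) + 3 ≠ 0 := by positivity
  have e6 : (m : ℝ) + 1 + 1 = m + 2 := by ring
  have e7 : (m : ℝ) + 2 + 1 = m + 3 := by ring
  rw [e6, e7]
  field_simp
  ring

theorem tensorPow_zero (m : ℕ) : tensorPow β m 0 = 0 := by
  have hn : ‖(EuclideanSpace.single 0 1 : Mom)‖ = 1 := by simp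
  have h := integral_inner_mul_coord_mul_coord hn (F := fun _ => 1) continuous_const
    (show (1 : Fin 3) ≠ 2 by decide)
  unfold tensorPow nullPow nullComp
  simp only [norm_zero, inner_zero_right, sub_zero, mul_zero]
  rw [integral_const_mul]
  simp only [one_mul] at h
  rw [h]
  simp

theorem abs_coord_le (p : Mom) (i : Fin 3) : |p i| ≤ ‖p‖ := by
  have := PiLp.norm_apply_le p i
  rwa [Real.norm_eq_abs] at this

theorem integrable_nullPow_outgoing_mul (hβ : 0 < β) (p : Mom) (m : ℕ) :
    Integrable (fun z : (Mom × S2) × S2 => nullPow β m z.2 (outgoing p z.1.1 z.1.2)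
      * ((z.2 : Mom) 1 * (z.2 : Mom) 2)) (((invMeasure α β).prod unif).prod area) := by
  refine integrable_outgoing_of_le hβ p
    (f := fun (a : S2) (q : Mom) => nullPow β m a q * ((a : Mom) 1 * (a : Mom) 2))
    (C := β ^ m / m.factorial) (k := m) ?_ (fun a q => ?_) (by positivity)
  · have h : Continuous fun x : S2 × Mom => nullPow β m (x.1 : Mom) x.2 :=
      continuous_nullPow m (by fun_prop) (by fun_prop)
    have h' : Continuous fun x : S2 × Mom => (x.1 : Mom) 1 * (x.1 : Mom) 2 := by fun_prop
    exact (h.mul h').measurable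
  · have ha : ‖(a : Mom)‖ = 1 := by simp
    have h1 := abs_coord_le a 1
    have h2 := abs_coord_le a 2
    rw [ha] at h1 h2
    rw [abs_mul, abs_mul]
    refine (mul_le_of_le_one_right (abs_nonneg _) ?_).trans (abs_nullPow_le hβ ha m q)
    exact mul_le_one₀ h1 (abs_nonneg _) h2

theorem integrable_tensorPow_outgoing (hβ : 0 < β) (p : Mom) (m : ℕ) :
    Integrable (fun y : Mom × S2 => tensorPow β m (outgoing p y.1 y.2))
      ((invMeasure α β).prod unif) :=
  (integrable_nullPow_outgoing_mul hβ p m).integral_prod_left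

theorem integrable_nullPow_mul (m : ℕ) (p : Mom) :
    Integrable (fun a : S2 => nullPow β m a p * ((a : Mom) 1 * (a : Mom) 2)) area := by
  refine integrable_area_of_continuous ?_
  have h : Continuous fun a : S2 => nullPow β m (a : Mom) p :=
    continuous_nullPow m (by fun_prop) (by fun_prop)
  have h' : Continuous fun a : S2 => (a : Mom) 1 * (a : Mom) 2 := by fun_prop
  exact h.mul h'

theorem integral_tensorPow_outgoing (hβ : 0 < β) {p : Mom} (hp : p ≠ 0) (m : ℕ) :
    ∫ y, tensorPow β m (outgoing p y.1 y.2) ∂((invMeasure α β).prod unif)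
      = invDensity α β / (m + 1) * ∑ i ∈ Finset.range (m + 1), tensorPow β i p := by
  unfold tensorPow
  rw [integral_integral_swap (integrable_nullPow_outgoing_mul hβ p m)]
  have h1 : ∀ a : S2, ∫ y : Mom × S2, nullPow β m a (outgoing p y.1 y.2)
        * ((a : Mom) 1 * (a : Mom) 2) ∂((invMeasure α β).prod unif)
      = invDensity α β / (m + 1) * ∑ i ∈ Finset.range (m + 1),
        nullPow β i a p * ((a : Mom) 1 * (a : Mom) 2) := by
    intro a
    have ha : ‖(a : Mom)‖ = 1 := by simp
    rw [integral_mul_const, integral_nullPow_outgoing hβ ha hp, ← Finset.sum_mul, mul_assoc]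
  simp only [h1]
  rw [integral_const_mul, integral_finsetSum _ fun i _ => integrable_nullPow_mul i p]

theorem sum_range_alternating_choose_succ (N i : ℕ) :
    ∑ m ∈ Finset.range i, (-1 : ℝ) ^ m * ((N + 1).choose (m + 1) : ℝ)
      = 1 - (-1) ^ i * (N.choose i : ℝ) := by
  induction i with
  | zero => simp
  | succ i ih =>
    rw [Finset.sum_range_succ, ih, Nat.choose_succ_succ]
    push_cast
    ring

/-- A triangular operator with entries `1 / (m + 1)` has alternating binomial sums as
eigenvectors. -/
theorem sum_alternating_choose_mul_sum (N : ℕ) (e : ℕ → ℝ) :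
    ∑ m ∈ Finset.range (N + 1), (-1 : ℝ) ^ m * (N.choose m : ℝ) *
        (1 / ((m : ℝ) + 1) * ∑ i ∈ Finset.range (m + 1), e i)
      = 1 / ((N : ℝ) + 1) * ∑ i ∈ Finset.range (N + 1), (-1 : ℝ) ^ i * (N.choose i : ℝ) * e i := by
  have h1 : ∀ m : ℕ, (N.choose m : ℝ) * (1 / ((m : ℝ) + 1))
      = 1 / ((N : ℝ) + 1) * ((N + 1).choose (m + 1) : ℝ) := by
    intro m
    have h : ((N : ℝ) + 1) * (N.choose m : ℝ) = ((N + 1).choose (m + 1) : ℝ) * ((m : ℝ) + 1) := by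
      exact_mod_cast Nat.add_one_mul_choose_eq N m
    have : (m : ℝ) + 1 ≠ 0 := by positivity
    have : (N : ℝ) + 1 ≠ 0 := by positivity
    field_simp
    linarith
  have h2 : ∀ m ∈ Finset.range (N + 1), (-1 : ℝ) ^ m * (N.choose m : ℝ) *
        (1 / ((m : ℝ) + 1) * ∑ i ∈ Finset.range (m + 1), e i)
      = ∑ i ∈ Finset.range (m + 1), 1 / ((N : ℝ) + 1) *
        ((-1 : ℝ) ^ m * ((N + 1).choose (m + 1) : ℝ)) * e i := by
    intro m _
    rw [← Finset.mul_sum, ← mul_assoc, mul_assoc ((-1 : ℝ) ^ m), h1]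
    ring
  rw [Finset.sum_congr rfl h2, Finset.sum_comm' (t' := Finset.range (N + 1))
    (s' := fun i => Finset.Ico i (N + 1)), Finset.mul_sum]
  · refine Finset.sum_congr rfl fun i hi => ?_
    have hi' : i ≤ N + 1 := (Finset.mem_range.1 hi).le
    rw [← Finset.sum_mul, ← Finset.mul_sum, Finset.sum_Ico_eq_sub _ hi',
      sum_range_alternating_choose_succ, sum_range_alternating_choose_succ,
      Nat.choose_succ_self]
    push_cast
    ring
  · intro m i
    simp only [Finset.mem_range, Finset.mem_Ico]
    omega

/-! ### The eigenfunctions -/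

/-- The function `mode`, as a real function. -/
noncomputable def realMode (β : ℝ) (n : ℕ) (p : Mom) : ℝ := laguerre 5 n (β * ‖p‖) * p 1 * p 2

theorem mode_eq (n : ℕ) (p : Mom) : mode β n p = (realMode β n p : ℂ) := rfl

/-- The eigenfunctions are alternating binomial sums of the projected powers of null components,
with `m = k + 2` for the degree `k` in the Laguerre polynomial. -/
theorem realMode_eq_sum (hβ : 0 < β) (n : ℕ) (p : Mom) :
    realMode β n p = ((n + 5).factorial / ((n + 2).factorial * (4 * Real.pi * β ^ 2))) *
      ∑ m ∈ Finset.range (n + 2 + 1), (-1 : ℝ) ^ m * ((n + 2).choose m : ℝ) * tensorPow β m p := by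
  rcases eq_or_ne p 0 with rfl | hp
  · simp [realMode, tensorPow_zero]
  have hp0 := norm_pos_iff.2 hp
  rw [Finset.sum_range_succ', Finset.sum_range_succ', realMode, laguerre]
  have z0 : tensorPow β 0 p = 0 := by rw [tensorPow_eq 0 hp]; simp
  have z1 : tensorPow β (0 + 1) p = 0 := by rw [tensorPow_eq (0 + 1) hp]; simp
  rw [z0, z1, mul_zero, mul_zero, add_zero, add_zero, Finset.mul_sum, Finset.sum_mul,
    Finset.sum_mul]
  refine Finset.sum_congr rfl fun k hk => ?_
  have hk' : k ≤ n := Nat.lt_succ_iff.1 (Finset.mem_range.1 hk)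
  rw [tensorPow_eq _ hp]
  have c1 : ((n + 5).choose (n - k) : ℝ) * (n - k).factorial * (k + 5).factorial
      = (n + 5).factorial := by
    have := Nat.choose_mul_factorial_mul_factorial (show n - k ≤ n + 5 by omega)
    rw [show n + 5 - (n - k) = k + 5 by omega] at this
    exact_mod_cast this
  have c2 : ((n + 2).choose (k + 1 + 1) : ℝ) * ((k + 2) * ((k + 1) * k.factorial))
      * (n - k).factorial = (n + 2).factorial := by
    have := Nat.choose_mul_factorial_mul_factorial (show k + 1 + 1 ≤ n + 2 by omega)
    rw [show n + 2 - (k + 1 + 1) = n - k by omega, Nat.factorial_succ, Nat.factorial_succ] at this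
    exact_mod_cast this
  have f1 : ((n - k).factorial : ℝ) ≠ 0 := by positivity
  have f2 : ((k + 5).factorial : ℝ) ≠ 0 := by positivity
  have f3 : (k.factorial : ℝ) ≠ 0 := by positivity
  have f4 : ((n + 2).choose (k + 1 + 1) : ℝ) ≠ 0 := by
    have := Nat.choose_pos (show k + 1 + 1 ≤ n + 2 by omega)
    positivity
  have e1 : (k : ℝ) + 2 ≠ 0 := by positivity
  have e2 : (k : ℝ) + 1 ≠ 0 := by positivity
  have hpi := Real.pi_ne_zero
  rw [← c1, ← c2, show k + 1 + 1 + 3 = k + 5 by omega]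
  push_cast
  have e3 : (k : ℝ) + 1 + 1 = k + 2 := by ring
  rw [e3, add_sub_assoc, show (2 : ℝ) - 1 = 1 by norm_num]
  field_simp
  ring

theorem integrable_realMode_outgoing (hβ : 0 < β) (p : Mom) (n : ℕ) :
    Integrable (fun y : Mom × S2 => realMode β n (outgoing p y.1 y.2))
      ((invMeasure α β).prod unif) := by
  simp only [realMode_eq_sum hβ]
  refine (integrable_finsetSum _ fun m _ => ?_).const_mul _
  exact (integrable_tensorPow_outgoing hβ p m).const_mul _

theorem integral_realMode_outgoing (hβ : 0 < β) {p : Mom} (hp : p ≠ 0) (n : ℕ) :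
    ∫ y, realMode β n (outgoing p y.1 y.2) ∂((invMeasure α β).prod unif)
      = invDensity α β / (n + 3) * realMode β n p := by
  simp only [realMode_eq_sum hβ n]
  rw [integral_const_mul, integral_finsetSum]
  · simp only [integral_const_mul, integral_tensorPow_outgoing hβ hp]
    have h := sum_alternating_choose_mul_sum (n + 2) fun i => tensorPow β i p
    have h2 : ∀ m : ℕ, (-1 : ℝ) ^ m * ((n + 2).choose m : ℝ) * (invDensity α β / (m + 1) *
        ∑ i ∈ Finset.range (m + 1), tensorPow β i p)
        = invDensity α β * ((-1 : ℝ) ^ m * ((n + 2).choose m : ℝ) *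
          (1 / ((m : ℝ) + 1) * ∑ i ∈ Finset.range (m + 1), tensorPow β i p)) := by
      intro m
      ring
    simp only [h2, ← Finset.mul_sum]
    rw [h]
    push_cast
    rw [add_assoc, show (2 : ℝ) + 1 = 3 by norm_num]
    ring
  · intro m _
    exact (integrable_tensorPow_outgoing hβ p m).const_mul _

/-- The invariant measure is isotropic. -/
theorem measurePreserving_isometry_invMeasure (e : Mom ≃ₗᵢ[ℝ] Mom) :
    MeasurePreserving e (invMeasure α β) (invMeasure α β) := by
  refine ⟨by fun_prop, Measure.ext_of_lintegral _ fun F hF => ?_⟩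
  have hFe : Measurable fun p => F (e p) := hF.comp (by fun_prop)
  rw [lintegral_map hF (by fun_prop), invMeasure,
    lintegral_withDensity_eq_lintegral_mul _ (by fun_prop) hFe,
    lintegral_withDensity_eq_lintegral_mul _ (by fun_prop) hF,
    ← e.measurePreserving.lintegral_comp
      (f := (fun p => ENNReal.ofReal (invDens α β p)) * F) (by fun_prop)]
  refine lintegral_congr fun p => ?_
  simp only [Pi.mul_apply, invDens, feq, e.norm_map]

theorem realMode_flip (n : ℕ) (p : Mom) : realMode β n (flipIso 1 p) = -realMode β n p := by
  rw [realMode, realMode, (flipIso 1).norm_map, flipIso_apply, flipIso_apply, if_pos rfl,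
    if_neg (by decide)]
  ring

theorem integral_realMode (n : ℕ) : ∫ p, realMode β n p ∂(invMeasure α β) = 0 := by
  have h := (measurePreserving_isometry_invMeasure (α := α) (β := β) (flipIso 1)).integral_comp
    (flipIso 1).toHomeomorph.measurableEmbedding (realMode β n)
  simp only [realMode_flip, integral_neg] at h
  linarith

/-- The two outgoing momenta have the same distribution: they are exchanged when the scattering
direction is reversed. -/
theorem integral_outgoing_symm (p : Mom) (f : Mom → ℝ) :
    ∫ y : Mom × S2, f (p + y.1 - outgoing p y.1 y.2) ∂((invMeasure α β).prod unif)
      = ∫ y : Mom × S2, f (outgoing p y.1 y.2) ∂((invMeasure α β).prod unif) := by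
  have hmp : MeasurePreserving (Prod.map id fun ω : S2 => -ω) ((invMeasure α β).prod unif)
      ((invMeasure α β).prod unif) :=
    (MeasurePreserving.id _).prod measurePreserving_neg_unif
  have hemb : MeasurableEmbedding (Prod.map id fun ω : S2 => -ω : Mom × S2 → Mom × S2) :=
    (MeasurableEquiv.prodCongr (MeasurableEquiv.refl Mom)
      (Homeomorph.neg S2).toMeasurableEquiv).measurableEmbedding
  rw [← hmp.integral_comp hemb]
  simp only [Prod.map, id, outgoing_neg, sub_sub_cancel]

theorem measurable_realMode (n : ℕ) : Measurable (realMode β n) := by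
  unfold realMode laguerre
  fun_prop

theorem abs_laguerre_le (n : ℕ) {x : ℝ} (hx : 0 ≤ x) :
    |laguerre 5 n x| ≤ ∑ k ∈ Finset.range (n + 1), ((n + 5).choose (n - k) : ℝ) * x ^ k := by
  refine (Finset.abs_sum_le_sum_abs _ _).trans (Finset.sum_le_sum fun k _ => ?_)
  rw [abs_div, abs_mul, abs_mul, abs_pow, abs_neg, abs_one, one_pow, one_mul, Nat.abs_cast,
    Nat.abs_cast, abs_of_nonneg (pow_nonneg hx k)]
  have : (1 : ℝ) ≤ k.factorial := by exact_mod_cast k.factorial_pos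
  exact div_le_self (by positivity) this

theorem abs_realMode_le (hβ : 0 < β) (n : ℕ) (p : Mom) : |realMode β n p|
    ≤ ∑ k ∈ Finset.range (n + 1), ((n + 5).choose (n - k) : ℝ) * β ^ k * ‖p‖ ^ (k + 2) := by
  have h1 := abs_coord_le p 1
  have h2 := abs_coord_le p 2
  have h3 := abs_laguerre_le n (show 0 ≤ β * ‖p‖ by positivity)
  have h4 : 0 ≤ ∑ k ∈ Finset.range (n + 1), ((n + 5).choose (n - k) : ℝ) * (β * ‖p‖) ^ k :=
    (abs_nonneg _).trans h3
  rw [realMode, abs_mul, abs_mul]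
  calc _ ≤ (∑ k ∈ Finset.range (n + 1), ((n + 5).choose (n - k) : ℝ) * (β * ‖p‖) ^ k)
        * ‖p‖ * ‖p‖ := by gcongr
    _ = _ := by
      rw [Finset.sum_mul, Finset.sum_mul]
      refine Finset.sum_congr rfl fun k _ => ?_
      ring

theorem integrable_realMode (hβ : 0 < β) (n : ℕ) : Integrable (realMode β n) (invMeasure α β) := by
  refine Integrable.mono' (integrable_finsetSum _ fun k _ => (integrable_norm_pow hβ _).const_mul _)
    (measurable_realMode n).aestronglyMeasurable (Eventually.of_forall (abs_realMode_le hβ n))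

/-- The eigenvalue equation, pointwise. Each of the two gain terms is `M / (n + 3)` times the
function, the loss term is `M` times the function, and the average over the partner vanishes by
reflection. -/
theorem collision_mode (hβ : 0 < β) (g : ℝ) (n : ℕ) (p : Mom) :
    collision α β g (mode β n) p = (eigval α β g n : ℂ) * mode β n p := by
  -- at `p = 0` both sides vanish
  rcases eq_or_ne p 0 with rfl | hp
  · rw [collision_zero, mode_eq, realMode]
    simp
  have := isFiniteMeasure_invMeasure (α := α) hβ
  have hr : ∀ y : Mom × S2, defect (mode β n) (quad (p, y))
      = ((realMode β n (outgoing p y.1 y.2) + realMode β n (p + y.1 - outgoing p y.1 y.2)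
        - realMode β n p - realMode β n y.1 : ℝ) : ℂ) := by
    intro y
    simp only [defect, quad, mode_eq]
    push_cast
    rfl
  have i1 := integrable_realMode_outgoing (α := α) hβ p n
  have i2 : Integrable (fun y : Mom × S2 => realMode β n (p + y.1 - outgoing p y.1 y.2))
      ((invMeasure α β).prod unif) := by
    have hmp : MeasurePreserving (Prod.map id fun ω : S2 => -ω) ((invMeasure α β).prod unif)
        ((invMeasure α β).prod unif) :=
      (MeasurePreserving.id _).prod measurePreserving_neg_unif
    have h := hmp.integrable_comp_of_integrable i1
    have h2 : ((fun y : Mom × S2 => realMode β n (outgoing p y.1 y.2)) ∘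
        Prod.map id fun ω : S2 => -ω)
        = fun y : Mom × S2 => realMode β n (p + y.1 - outgoing p y.1 y.2) := by
      funext y
      simp only [Function.comp, Prod.map, id, outgoing_neg]
    rwa [h2] at h
  have i3 : Integrable (fun y : Mom × S2 => realMode β n y.1) ((invMeasure α β).prod unif) :=
    (integrable_realMode hβ n).comp_fst unif
  have i12 : Integrable (fun y : Mom × S2 => realMode β n (outgoing p y.1 y.2)
      + realMode β n (p + y.1 - outgoing p y.1 y.2)) ((invMeasure α β).prod unif) := i1.add i2
  have i124 : Integrable (fun y : Mom × S2 => realMode β n (outgoing p y.1 y.2)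
      + realMode β n (p + y.1 - outgoing p y.1 y.2) - realMode β n p)
      ((invMeasure α β).prod unif) := i12.sub (integrable_const _)
  have i1243 : Integrable (fun y : Mom × S2 => realMode β n (outgoing p y.1 y.2)
      + realMode β n (p + y.1 - outgoing p y.1 y.2) - realMode β n p - realMode β n y.1)
      ((invMeasure α β).prod unif) := i124.sub i3
  have hd : Integrable (fun y : Mom × S2 => defect (mode β n) (quad (p, y)))
      ((invMeasure α β).prod unif) := by
    simp only [hr]
    exact i1243.ofReal
  have huniv : ((invMeasure α β).prod unif).real univ = invDensity α β := by
    rw [invDensity_eq, Measure.real, Measure.real, ← univ_prod_univ, Measure.prod_prod,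
      measure_univ (μ := unif), mul_one]
  have h3 : ∫ y : Mom × S2, realMode β n y.1 ∂((invMeasure α β).prod unif) = 0 := by
    rw [integral_fun_fst, integral_realMode, smul_zero]
  rw [collision_eq g _ hp, ← integral_prod (fun y => defect (mode β n) (quad (p, y))) hd]
  simp only [hr]
  rw [integral_complex_ofReal, integral_sub i124 i3, integral_sub i12 (integrable_const _),
    integral_add i1 i2, integral_outgoing_symm, integral_realMode_outgoing hβ hp, integral_const,
    huniv, h3, smul_eq_mul, mode_eq, eigval, ← Complex.ofReal_mul, ← Complex.ofReal_mul]
  congr 1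
  have : (n : ℝ) + 3 ≠ 0 := by positivity
  field_simp
  ring

end Collision

/-! ### Laguerre polynomials -/

namespace LaguerrePolynomial

open Polynomial

/-- The linear functional `P ↦ ∫ x in (0, ∞), P(x) x^a e^{-x}` on polynomials, defined by its values
`(k + a)!` on the monomials `x^k`. -/
noncomputable def moment (a : ℕ) : ℝ[X] →ₗ[ℝ] ℝ :=
  Polynomial.lsum fun k => ((k + a).factorial : ℝ) • LinearMap.id

theorem moment_monomial (a k : ℕ) (c : ℝ) :
    moment a (monomial k c) = (k + a).factorial * c := by
  simp [moment, lsum_apply, sum_monomial_index]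

theorem moment_X_mul (a : ℕ) (P : ℝ[X]) : moment a (X * P) = moment (a + 1) P := by
  induction P using Polynomial.induction_on' with
  | add p q hp hq => rw [mul_add, map_add, map_add, hp, hq]
  | monomial k c =>
    rw [X_mul_monomial, moment_monomial, moment_monomial, add_right_comm, add_assoc]

/-- Integration by parts. -/
theorem moment_X_mul' (a : ℕ) (P : ℝ[X]) :
    moment a (X * P) = (a + 1) * moment a P + moment a (X * derivative P) := by
  induction P using Polynomial.induction_on' with
  | add p q hp hq =>
    rw [mul_add, map_add, map_add, hp, hq, derivative_add, mul_add, mul_add, map_add]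
    ring
  | monomial k c =>
    rw [X_mul_monomial, moment_monomial, moment_monomial, derivative_monomial, X_mul_monomial,
      moment_monomial]
    rcases k with _ | k
    · rw [show 0 + 1 + a = (0 + a) + 1 by ring, Nat.factorial_succ]
      push_cast
      ring
    · rw [show k + 1 + 1 + a = (k + 1 + a) + 1 by ring, Nat.factorial_succ (k + 1 + a),
        Nat.add_sub_cancel]
      push_cast
      ring

/-- The generalised Laguerre polynomial `L_n^{(5)}`. -/
noncomputable def lag (n : ℕ) : ℝ[X] :=
  ∑ k ∈ Finset.range (n + 1),
    monomial k ((-1) ^ k * ((n + 5).choose (n - k) : ℝ) / (k.factorial : ℝ))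

theorem eval_lag (n : ℕ) (x : ℝ) : (lag n).eval x = MasslessGas.laguerre 5 n x := by
  rw [lag, MasslessGas.laguerre, eval_finsetSum]
  refine Finset.sum_congr rfl fun k _ => ?_
  rw [eval_monomial]
  ring

theorem coeff_lag_self (n : ℕ) : (lag n).coeff n = (-1) ^ n / (n.factorial : ℝ) := by
  rw [lag, finsetSum_coeff, Finset.sum_eq_single n]
  · simp
  · intro k _ hk
    rw [coeff_monomial, if_neg hk]
  · intro h
    exact absurd (Finset.self_mem_range_succ n) h

theorem coeff_lag_of_lt {n k : ℕ} (h : n < k) : (lag n).coeff k = 0 := by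
  rw [lag, finsetSum_coeff]
  refine Finset.sum_eq_zero fun i hi => ?_
  rw [coeff_monomial, if_neg]
  have := Finset.mem_range.1 hi
  omega

theorem coeff_lag_self_ne_zero (n : ℕ) : (lag n).coeff n ≠ 0 := by
  rw [coeff_lag_self]
  exact div_ne_zero (pow_ne_zero _ (by norm_num)) (by positivity)

theorem degree_lag (n : ℕ) : (lag n).degree = n :=
  le_antisymm ((degree_le_iff_coeff_zero _ _).2 fun k hk => coeff_lag_of_lt (by exact_mod_cast hk))
    (le_degree_of_ne_zero (coeff_lag_self_ne_zero n))

theorem span_lag : Submodule.span ℝ (Set.range lag) = ⊤ := by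
  let S : Polynomial.Sequence ℝ := ⟨lag, degree_lag⟩
  exact S.span fun i => isUnit_iff_ne_zero.2 (leadingCoeff_ne_zero.2 (S.ne_zero i))

/-- The moments of a Laguerre polynomial are iterated differences of a polynomial of degree `j`,
which vanish for `j < n`. -/
theorem moment_lag_mul_monomial (n j : ℕ) :
    moment 5 (lag n * monomial j 1) = (n + 5).factorial / n.factorial * (-1) ^ n *
      ((fwdDiff 1)^[n] (fun x => (ascPochhammer ℝ j).eval x) 6) := by
  rw [fwdDiff_iter_eq_sum_shift, lag, Finset.sum_mul, map_sum, Finset.mul_sum]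
  refine Finset.sum_congr rfl fun k hk => ?_
  have hk' : k ≤ n := Nat.lt_succ_iff.1 (Finset.mem_range.1 hk)
  rw [monomial_mul_monomial, moment_monomial]
  have c1 : ((n + 5).choose (n - k) : ℝ) * (n - k).factorial * (k + 5).factorial
      = (n + 5).factorial := by
    have := Nat.choose_mul_factorial_mul_factorial (show n - k ≤ n + 5 by omega)
    rw [show n + 5 - (n - k) = k + 5 by omega] at this
    exact_mod_cast this
  have c2 : (n.choose k : ℝ) * k.factorial * (n - k).factorial = n.factorial := by
    exact_mod_cast Nat.choose_mul_factorial_mul_factorial hk'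
  have c3 := factorial_mul_ascPochhammer ℝ (5 + k) j
  have c4 : (6 : ℝ) + k • (1 : ℝ) = ((5 + k : ℕ) : ℝ) + 1 := by
    push_cast
    rw [nsmul_eq_mul]
    ring
  have c5 : (-1 : ℝ) ^ n * (-1) ^ (n - k) = (-1) ^ k := by
    have e : n = (n - k) + k := by omega
    conv_lhs => rw [e, Nat.add_sub_cancel, pow_add]
    rw [mul_right_comm, ← mul_pow]
    norm_num
  rw [c4, show k + j + 5 = 5 + k + j by ring, ← c3, ← c1, ← c2, ← c5, zsmul_eq_mul,
    show 5 + k = k + 5 by ring]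
  push_cast
  have f1 : ((n - k).factorial : ℝ) ≠ 0 := by positivity
  have f3 : (k.factorial : ℝ) ≠ 0 := by positivity
  have f4 : (n.choose k : ℝ) ≠ 0 := by
    have := Nat.choose_pos hk'
    positivity
  field_simp

theorem moment_lag_mul_monomial_of_lt {n j : ℕ} (h : j < n) (c : ℝ) :
    moment 5 (lag n * monomial j c) = 0 := by
  have h1 : monomial j c = c • (monomial j 1 : ℝ[X]) := by rw [smul_monomial, smul_eq_mul, mul_one]
  have h2 := Polynomial.fwdDiff_iter_eq_zero_of_degree_lt (P := ascPochhammer ℝ j) (n := n)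
    (by rwa [ascPochhammer_natDegree])
  rw [h1, mul_smul_comm, map_smul, moment_lag_mul_monomial, h2]
  simp

theorem moment_lag_mul_monomial_self (n : ℕ) :
    moment 5 (lag n * monomial n 1) = (n + 5).factorial * (-1) ^ n := by
  have h2 := Polynomial.fwdDiff_iter_degree_eq_factorial (ascPochhammer ℝ n)
  rw [ascPochhammer_natDegree, (monic_ascPochhammer ℝ n).leadingCoeff, one_smul] at h2
  rw [moment_lag_mul_monomial, h2]
  have : (n.factorial : ℝ) ≠ 0 := by positivity
  simp only [Pi.natCast_apply]
  field_simp

/-- Orthogonality of the Laguerre polynomials. -/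
theorem moment_lag_mul_of_degree_lt {n : ℕ} {P : ℝ[X]} (h : P.degree < n) :
    moment 5 (lag n * P) = 0 := by
  rw [P.as_sum_support, Finset.mul_sum, map_sum]
  refine Finset.sum_eq_zero fun j hj => moment_lag_mul_monomial_of_lt ?_ _
  exact_mod_cast (le_degree_of_mem_supp j hj).trans_lt h

theorem moment_lag_sq_pos (n : ℕ) : 0 < moment 5 (lag n * lag n) := by
  have h1 : (lag n - monomial n ((lag n).coeff n)).degree < n := by
    rw [degree_lt_iff_coeff_zero]
    intro m hm
    rw [coeff_sub, coeff_monomial]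
    rcases hm.eq_or_lt with rfl | h
    · simp
    · rw [if_neg h.ne, coeff_lag_of_lt h, sub_zero]
  have h2 := moment_lag_mul_of_degree_lt h1
  have h3 : monomial n ((lag n).coeff n) = (lag n).coeff n • (monomial n 1 : ℝ[X]) := by
    rw [smul_monomial, smul_eq_mul, mul_one]
  rw [mul_sub, map_sub, h3, mul_smul_comm, map_smul, moment_lag_mul_monomial_self, coeff_lag_self,
    sub_eq_zero] at h2
  have h4 : (-1 : ℝ) ^ n * (-1) ^ n = 1 := by rw [← mul_pow]; norm_num
  rw [h2, smul_eq_mul, show (-1 : ℝ) ^ n / n.factorial * ((n + 5).factorial * (-1) ^ n)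
    = ((-1) ^ n * (-1) ^ n) * ((n + 5).factorial / n.factorial) by ring, h4]
  positivity

/-- The ratio of the norms of `L_n` for the weights `x⁴ e^{-x}` and `x⁵ e^{-x}`. -/
theorem moment_four_lag_sq (n : ℕ) :
    moment 5 (lag n * lag n) = 5 * moment 4 (lag n * lag n) := by
  have h1 := moment_X_mul' 4 (lag n * lag n)
  have h2 : (derivative (lag n)).degree < n :=
    (degree_derivative_lt (fun h => coeff_lag_self_ne_zero n (by rw [h, coeff_zero]))).trans_eq
      (degree_lag n)
  have h3 := moment_lag_mul_of_degree_lt h2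
  have h4 : X * derivative (lag n * lag n) = (2 : ℝ) • (X * (lag n * derivative (lag n))) := by
    rw [derivative_mul, smul_eq_C_mul, show (C (2 : ℝ)) = (2 : ℝ[X]) from rfl]
    ring
  rw [h4, map_smul, moment_X_mul, moment_X_mul, h3, smul_zero, add_zero] at h1
  rw [h1]
  norm_num

/-- The ratio of the norms of `L_n` for the weights `x⁵ e^{-x}` and `x⁶ e^{-x}`. -/
theorem moment_six_lag_sq (n : ℕ) :
    moment 6 (lag n * lag n) = (2 * n + 6) * moment 5 (lag n * lag n) := by
  have h1 := moment_X_mul' 5 (lag n * lag n)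
  -- `x L_n' - n L_n` has lower degree than `L_n`
  have h2 : (X * derivative (lag n) - (n : ℝ) • lag n).degree < (n : WithBot ℕ) := by
    rw [degree_lt_iff_coeff_zero]
    intro m hm
    rw [coeff_sub, coeff_smul, smul_eq_mul]
    rcases m with _ | m
    · obtain rfl : n = 0 := Nat.le_zero.1 hm
      simp
    · rw [coeff_X_mul, coeff_derivative]
      rcases hm.eq_or_lt with h | h
      · rw [h]
        push_cast
        ring
      · rw [coeff_lag_of_lt h]
        simp
  have h3 := moment_lag_mul_of_degree_lt h2
  rw [mul_sub, map_sub, mul_smul_comm, map_smul, sub_eq_zero, smul_eq_mul] at h3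
  have h4 : X * derivative (lag n * lag n) = (2 : ℝ) • (lag n * (X * derivative (lag n))) := by
    rw [derivative_mul, smul_eq_C_mul, show (C (2 : ℝ)) = (2 : ℝ[X]) from rfl]
    ring
  rw [h4, map_smul, h3, moment_X_mul, smul_eq_mul] at h1
  rw [h1]
  push_cast
  ring

end LaguerrePolynomial

/-! ### The eigenfunctions in the Hilbert space -/

namespace Collision

open MasslessGas SphereIntegral Kinematics LaguerrePolynomial Polynomial

variable {α β g : ℝ}

/-- The squared norm of `p² p³ / (p⁰)²` on the unit sphere, with the normalisation of the radial
integrals. -/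
noncomputable def normConst (α β : ℝ) : ℝ :=
  Real.exp α / ((2 * Real.pi) ^ 3 * β ^ 5) * ∫ ω : S2, ((ω : Mom) 1 * (ω : Mom) 2) ^ 2 ∂area

theorem integral_sphere_sq_pos : 0 < ∫ ω : S2, ((ω : Mom) 1 * (ω : Mom) 2) ^ 2 ∂area := by
  have hc : Continuous fun ω : S2 => ((ω : Mom) 1 * (ω : Mom) 2) ^ 2 := by fun_prop
  obtain ⟨b, hb⟩ : ∃ b : Mom, b = !₂[(0 : ℝ), 1, 1] := ⟨_, rfl⟩
  have hb0 : ‖b‖ ≠ 0 := by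
    rw [norm_ne_zero_iff]
    intro h
    have := congrArg (fun x : Mom => x 1) h
    simp [hb] at this
  refine hc.integral_pos_of_hasCompactSupport_nonneg_nonzero
    (HasCompactSupport.of_compactSpace _) (fun ω => sq_nonneg _)
    (x := ⟨‖b‖⁻¹ • b, by simp [norm_smul, hb0]⟩) ?_
  simp only [PiLp.smul_apply, smul_eq_mul]
  have h1 : b 1 = 1 := by simp [hb]
  have h2 : b 2 = 1 := by simp [hb]
  rw [h1, h2]
  positivity

theorem normConst_pos (hβ : 0 < β) : 0 < normConst α β := by
  have := integral_sphere_sq_pos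
  unfold normConst
  positivity

/-- The radial moments behind the norms of the functions `P(β p⁰) p² p³ / p⁰`. -/
theorem lintegral_pow_mul_harmonic (hβ : 0 < β) (k : ℕ) :
    ∫⁻ p : Mom, ENNReal.ofReal (‖p‖ ^ 3 * (β * ‖p‖) ^ k * (p 1 * p 2 / ‖p‖ ^ 2) ^ 2)
      ∂(invMeasure α β) = ENNReal.ofReal (normConst α β * (k + 4).factorial) := by
  have hcont : Continuous fun ω : S2 => ((ω : Mom) 1 * (ω : Mom) 2) ^ 2 := by fun_prop
  rw [lintegral_invMeasure_polar (by fun_prop)]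
  have h1 : ∀ ω : S2, ∫⁻ r in Ioi (0 : ℝ),
      ENNReal.ofReal (Real.exp α / (2 * Real.pi) ^ 3 * (r * Real.exp (-(β * r))))
        * ENNReal.ofReal (‖r • (ω : Mom)‖ ^ 3 * (β * ‖r • (ω : Mom)‖) ^ k
          * ((r • (ω : Mom)) 1 * (r • (ω : Mom)) 2 / ‖r • (ω : Mom)‖ ^ 2) ^ 2)
      = ENNReal.ofReal (Real.exp α / (2 * Real.pi) ^ 3 * β ^ k *
          ((k + 4).factorial / β ^ (k + 4 + 1)))
        * ENNReal.ofReal (((ω : Mom) 1 * (ω : Mom) 2) ^ 2) := by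
    intro ω
    have hω : ‖(ω : Mom)‖ = 1 := by simp
    rw [ENNReal.ofReal_mul (by positivity), ← lintegral_pow_mul_exp hβ,
      ← lintegral_const_mul' _ _ ENNReal.ofReal_ne_top,
      ← lintegral_mul_const' _ _ ENNReal.ofReal_ne_top]
    refine setLIntegral_congr_fun measurableSet_Ioi fun r hr => ?_
    have hr0 : (0 : ℝ) < r := hr
    rw [norm_smul, hω, mul_one, Real.norm_eq_abs, abs_of_pos hr0, PiLp.smul_apply,
      PiLp.smul_apply, smul_eq_mul, smul_eq_mul, ← ENNReal.ofReal_mul (by positivity),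
      ← ENNReal.ofReal_mul (by positivity), ← ENNReal.ofReal_mul (by positivity)]
    congr 1
    field_simp
    ring
  simp only [h1]
  rw [lintegral_const_mul' _ _ ENNReal.ofReal_ne_top, ← ofReal_integral_eq_lintegral_ofReal
    (integrable_area_of_continuous hcont) (Eventually.of_forall fun ω => sq_nonneg _),
    ← ENNReal.ofReal_mul (by positivity), normConst]
  congr 1
  field_simp
  ring

theorem integrable_eval_mul_harmonic (hβ : 0 < β) (Q : ℝ[X]) :
    Integrable (fun p : Mom => ‖p‖ ^ 3 * Q.eval (β * ‖p‖) * (p 1 * p 2 / ‖p‖ ^ 2) ^ 2)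
      (invMeasure α β) ∧
    ∫ p : Mom, ‖p‖ ^ 3 * Q.eval (β * ‖p‖) * (p 1 * p 2 / ‖p‖ ^ 2) ^ 2 ∂(invMeasure α β)
      = normConst α β * moment 4 Q := by
  induction Q using Polynomial.induction_on' with
  | add P Q hP hQ =>
    simp only [eval_add, mul_add, add_mul, map_add]
    exact ⟨hP.1.add hQ.1, by rw [integral_add hP.1 hQ.1, hP.2, hQ.2]⟩
  | monomial k c =>
    have hn := (normConst_pos (α := α) hβ).le
    have hnn : ∀ p : Mom, 0 ≤ ‖p‖ ^ 3 * (β * ‖p‖) ^ k * (p 1 * p 2 / ‖p‖ ^ 2) ^ 2 :=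
      fun p => by positivity
    have hi : Integrable (fun p : Mom => ‖p‖ ^ 3 * (β * ‖p‖) ^ k * (p 1 * p 2 / ‖p‖ ^ 2) ^ 2)
        (invMeasure α β) := by
      refine ⟨by fun_prop, ?_⟩
      rw [hasFiniteIntegral_iff_ofReal (Eventually.of_forall hnn), lintegral_pow_mul_harmonic hβ]
      exact ENNReal.ofReal_lt_top
    have hv : ∫ p : Mom, ‖p‖ ^ 3 * (β * ‖p‖) ^ k * (p 1 * p 2 / ‖p‖ ^ 2) ^ 2 ∂(invMeasure α β)
        = normConst α β * (k + 4).factorial := by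
      rw [integral_eq_lintegral_of_nonneg_ae (Eventually.of_forall hnn) hi.1,
        lintegral_pow_mul_harmonic hβ, ENNReal.toReal_ofReal (by positivity)]
    have he : ∀ p : Mom, ‖p‖ ^ 3 * (monomial k c).eval (β * ‖p‖) * (p 1 * p 2 / ‖p‖ ^ 2) ^ 2
        = c * (‖p‖ ^ 3 * (β * ‖p‖) ^ k * (p 1 * p 2 / ‖p‖ ^ 2) ^ 2) := by
      intro p
      rw [eval_monomial]
      ring
    simp only [he]
    refine ⟨hi.const_mul c, ?_⟩
    rw [integral_const_mul, hv, moment_monomial]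
    ring

/-- The function `P(β p⁰) p² p³ / p⁰`. -/
noncomputable def polyFun (β : ℝ) (P : ℝ[X]) (p : Mom) : ℂ :=
  ((P.eval (β * ‖p‖) * (p 1 * p 2 / ‖p‖) : ℝ) : ℂ)

theorem norm_mul_polyFun_sq (P : ℝ[X]) (p : Mom) : ‖p‖ * ‖polyFun β P p‖ ^ 2
    = ‖p‖ ^ 3 * (P * P).eval (β * ‖p‖) * (p 1 * p 2 / ‖p‖ ^ 2) ^ 2 := by
  rw [polyFun, Complex.norm_real, Real.norm_eq_abs, sq_abs, eval_mul]
  rcases eq_or_ne p 0 with rfl | hp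
  · simp
  have := norm_ne_zero_iff.2 hp
  field_simp

theorem memLp_polyFun (hβ : 0 < β) (P : ℝ[X]) : MemLp (polyFun β P) 2 (eqMeasure α β) := by
  refine memLp_eqMeasure_iff.2 ⟨?_, ?_⟩
  · have h1 : Measurable fun p : Mom => P.eval (β * ‖p‖) * (p 1 * p 2 / ‖p‖) := by
      have : Measurable fun p : Mom => P.eval (β * ‖p‖) :=
        (P.continuous.comp (by fun_prop)).measurable
      fun_prop
    exact (Complex.measurable_ofReal.comp h1).aestronglyMeasurable
  · simp only [norm_mul_polyFun_sq]
    exact (integrable_eval_mul_harmonic hβ (P * P)).1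

/-- The state `P(β p⁰) p² p³ / p⁰`. -/
noncomputable def polyState (α : ℝ) (hβ : 0 < β) (P : ℝ[X]) : State α β :=
  (memLp_polyFun hβ P).toLp _

theorem coe_polyState (hβ : 0 < β) (P : ℝ[X]) :
    polyState α hβ P =ᵐ[eqMeasure α β] polyFun β P := MemLp.coeFn_toLp _

theorem polyState_add (hβ : 0 < β) (P Q : ℝ[X]) :
    polyState α hβ (P + Q) = polyState α hβ P + polyState α hβ Q := by
  have h : polyFun β (P + Q) = polyFun β P + polyFun β Q := by
    funext p
    simp only [polyFun, eval_add, Pi.add_apply]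
    push_cast
    ring
  rw [polyState, polyState, polyState, ← MemLp.toLp_add, MemLp.toLp_eq_toLp_iff, h]

theorem polyState_smul (hβ : 0 < β) (c : ℝ) (P : ℝ[X]) :
    polyState α hβ (c • P) = (c : ℂ) • polyState α hβ P := by
  have h : polyFun β (c • P) = (c : ℂ) • polyFun β P := by
    funext p
    simp only [polyFun, eval_smul, Pi.smul_apply, smul_eq_mul]
    push_cast
    ring
  rw [polyState, polyState, ← MemLp.toLp_const_smul, MemLp.toLp_eq_toLp_iff, h]

theorem norm_sq_polyState (hβ : 0 < β) (P : ℝ[X]) :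
    ‖polyState α hβ P‖ ^ 2 = normConst α β * moment 4 (P * P) := by
  have h : ((‖polyState α hβ P‖ ^ 2 : ℝ) : ℂ) = ((normConst α β * moment 4 (P * P) : ℝ) : ℂ) := by
    rw [Complex.ofReal_pow]
    refine (inner_self_eq_norm_sq_to_K (𝕜 := ℂ) (polyState α hβ P)).symm.trans ?_
    rw [L2.inner_def, integral_congr_ae (g := fun p => ((‖polyFun β P p‖ ^ 2 : ℝ) : ℂ)),
      integral_eqMeasure, ← (integrable_eval_mul_harmonic (α := α) hβ (P * P)).2,
      ← integral_complex_ofReal]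
    · refine integral_congr_ae (Eventually.of_forall fun p => ?_)
      simp only
      rw [← norm_mul_polyFun_sq]
      push_cast
      rfl
    · filter_upwards [coe_polyState (α := α) hβ P] with p hp
      rw [RCLike.inner_apply, hp, mul_comm, Complex.conj_mul']
      push_cast
      rfl
  exact_mod_cast h

theorem mode_eq_polyFun (hβ : 0 < β) (n : ℕ) :
    mode β n = polyFun β (C β⁻¹ * X * lag n) := by
  funext p
  rw [mode, polyFun, ← eval_lag]
  rcases eq_or_ne p 0 with rfl | hp
  · simp
  have := norm_ne_zero_iff.2 hp
  congr 1
  simp only [eval_mul, eval_C, eval_X]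
  field_simp

theorem inv_norm_mul_mode (n : ℕ) (p : Mom) :
    ((‖p‖⁻¹ : ℝ) : ℂ) * mode β n p = polyFun β (lag n) p := by
  rw [mode, polyFun, ← eval_lag, ← Complex.ofReal_mul]
  congr 1
  ring

theorem memLp_mode (hβ : 0 < β) (n : ℕ) : MemLp (mode β n) 2 (eqMeasure α β) := by
  rw [mode_eq_polyFun hβ]
  exact memLp_polyFun hβ _

/-- The eigenfunctions, as states. -/
noncomputable def modeState (α : ℝ) (hβ : 0 < β) (n : ℕ) : State α β :=
  (memLp_mode hβ n).toLp _

theorem coe_modeState (hβ : 0 < β) (n : ℕ) : modeState α hβ n =ᵐ[eqMeasure α β] mode β n :=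
  MemLp.coeFn_toLp _

theorem modeState_eq (hβ : 0 < β) (n : ℕ) :
    modeState α hβ n = polyState α hβ (C β⁻¹ * X * lag n) := by
  rw [modeState, polyState, MemLp.toLp_eq_toLp_iff, mode_eq_polyFun hβ]

/-- With `x = β p⁰`, this is `∫ x⁶ e^{-x} L_n² = (2 n + 6) · 5 · ∫ x⁴ e^{-x} L_n²`. -/
theorem norm_modeState_sq (hβ : 0 < β) (n : ℕ) : β ^ 2 * ‖modeState α hβ n‖ ^ 2
    = 10 * (n + 3) * ‖polyState α hβ (lag n)‖ ^ 2 := by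
  have h1 : C β⁻¹ * X * lag n * (C β⁻¹ * X * lag n) = (β⁻¹ ^ 2) • (X * (X * (lag n * lag n))) := by
    rw [smul_eq_C_mul, C_pow]
    ring
  rw [modeState_eq, norm_sq_polyState, norm_sq_polyState, h1, map_smul, moment_X_mul, moment_X_mul,
    moment_six_lag_sq, moment_four_lag_sq, smul_eq_mul]
  field_simp
  ring

theorem norm_polyState_lag_pos (hβ : 0 < β) (n : ℕ) : 0 < ‖polyState α hβ (lag n)‖ := by
  have h1 : 0 < ‖polyState α hβ (lag n)‖ ^ 2 := by
    rw [norm_sq_polyState]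
    have h2 := moment_lag_sq_pos n
    rw [moment_four_lag_sq] at h2
    exact mul_pos (normConst_pos hβ) (by linarith)
  exact lt_of_pow_lt_pow_left₀ 2 (norm_nonneg _) (by simpa using h1)

theorem modeState_ne_zero (hβ : 0 < β) (n : ℕ) : modeState α hβ n ≠ 0 := by
  intro h
  have h1 := norm_modeState_sq (α := α) hβ n
  have h2 := norm_polyState_lag_pos (α := α) hβ n
  rw [h, norm_zero] at h1
  have : 0 < 10 * ((n : ℝ) + 3) * ‖polyState α hβ (lag n)‖ ^ 2 := by positivity
  linarith [h1, this]

/-- The eigenfunctions of `L` are not eigenvectors of `(p⁰)⁻¹ L`, which maps `φ⁽ⁿ⁾` to a multiple of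
`L_n(β p⁰) p² p³ / p⁰`. -/
theorem modeState_mem_generator (hβ : 0 < β) (g : ℝ) (n : ℕ) :
    (modeState α hβ n, (eigval α β g n : ℂ) • polyState α hβ (lag n)) ∈ generator α β g := by
  change (((eigval α β g n : ℂ) • polyState α hβ (lag n) : State α β) : Mom → ℂ)
    =ᵐ[eqMeasure α β] _
  filter_upwards [Lp.coeFn_smul (eigval α β g n : ℂ) (polyState α hβ (lag n)),
    coe_polyState (α := α) hβ (lag n), eqMeasure_absolutelyContinuous.ae_le
      (collision_congr_ae g (invMeasure_absolutelyContinuous_eqMeasure.ae_le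
        (coe_modeState (α := α) hβ n)))] with p h1 h2 h3
  rw [h1, Pi.smul_apply, h2, smul_eq_mul, h3, collision_mode hβ, mul_left_comm, inv_norm_mul_mode]

theorem integral_eq_zero_of_flip (k : Fin 3) {F : Mom → ℝ} (hF : ∀ p, F (flipIso k p) = -F p) :
    ∫ p, F p ∂(invMeasure α β) = 0 := by
  have h := (measurePreserving_isometry_invMeasure (α := α) (β := β) (flipIso k)).integral_comp
    (flipIso k).toHomeomorph.measurableEmbedding F
  simp only [hF, integral_neg] at h
  linarith

theorem inner_modeState_eq_zero (hβ : 0 < β) (n : ℕ) (k : Fin 3) {f : Mom → ℝ}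
    (hf : ∀ p, realMode β n (flipIso k p) * f (flipIso k p) = -(realMode β n p * f p))
    {ψ : State α β} (hψ : ψ =ᵐ[eqMeasure α β] fun p => (f p : ℂ)) :
    ⟪ψ, modeState α hβ n⟫_ℂ = 0 := by
  rw [L2.inner_def, integral_congr_ae (g := fun p => ((realMode β n p * f p : ℝ) : ℂ)),
    integral_eqMeasure]
  · simp only [← Complex.ofReal_mul]
    rw [integral_complex_ofReal, integral_eq_zero_of_flip k, Complex.ofReal_zero]
    intro p
    rw [hf, (flipIso k).norm_map, mul_neg]
  · filter_upwards [hψ, coe_modeState (α := α) hβ n] with p h1 h2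
    rw [RCLike.inner_apply, h1, h2, Complex.conj_ofReal, mode_eq, Complex.ofReal_mul]

/-- The eigenfunctions are orthogonal to the hydrodynamic states, by reflection symmetry. -/
theorem modeState_mem_nonHydro (hβ : 0 < β) (n : ℕ) : modeState α hβ n ∈ nonHydro α β := by
  rw [nonHydro, Submodule.mem_orthogonal]
  have h2 : ∀ p : Mom, realMode β n (flipIso 2 p) = -realMode β n p := by
    intro p
    rw [realMode, realMode, (flipIso 2).norm_map, flipIso_apply, flipIso_apply,
      if_neg (by decide), if_pos rfl]
    ring
  intro ψ hψ
  induction hψ using Submodule.span_induction with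
  | mem ψ h =>
    rcases h with h | h | ⟨i, h⟩
    · refine inner_modeState_eq_zero hβ n 1 (f := fun _ => 1) (fun p => ?_)
        (h.trans (by simp))
      rw [realMode_flip]
      ring
    · refine inner_modeState_eq_zero hβ n 1 (f := fun p => ‖p‖) (fun p => ?_) h
      rw [realMode_flip, (flipIso 1).norm_map]
      ring
    · by_cases hi : i = 1
      · refine inner_modeState_eq_zero hβ n 2 (f := fun p => p i) (fun p => ?_) h
        rw [h2, flipIso_apply, if_neg (by rw [hi]; decide)]
        ring
      · refine inner_modeState_eq_zero hβ n 1 (f := fun p => p i) (fun p => ?_) h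
        rw [realMode_flip, flipIso_apply, if_neg hi]
        ring
  | zero => exact inner_zero_left _
  | add x y _ _ hx hy => rw [inner_add_left, hx, hy, add_zero]
  | smul c x _ hx => rw [inner_smul_left, hx, mul_zero]

theorem eigval_neg (hβ : 0 < β) (hg : 0 < g) (n : ℕ) : eigval α β g n < 0 := by
  have := invDensity_pos (α := α) hβ
  have h : 0 < g * invDensity α β / 2 * (((n : ℝ) + 1) / ((n : ℝ) + 3)) := by positivity
  rw [eigval]
  linarith

/-- The kernel is orthogonal to the eigenfunctions: it is orthogonal to all `A φ⁽ⁿ⁾`, that is to all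
`L_m(β p⁰) p² p³ / p⁰`, and `φ⁽ⁿ⁾` is a linear combination of these, because the Laguerre
polynomials span all polynomials, among them `x L_n(x)`. -/
theorem inner_modeState_eq_zero_of_kernel (hβ : 0 < β) (hg : 0 < g) {ψ : State α β}
    (hψ : (ψ, (0 : State α β)) ∈ generator α β g) (n : ℕ) : ⟪modeState α hβ n, ψ⟫_ℂ = 0 := by
  have hG := isSelfAdj_generator (α := α) hβ hg
  have h1 : ∀ m, ⟪polyState α hβ (lag m), ψ⟫_ℂ = 0 := by
    intro m
    have h := hG.symm (modeState_mem_generator hβ g m) hψ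
    simp only [inner_zero_right, inner_smul_left, Complex.conj_ofReal] at h
    exact (mul_eq_zero.1 h).resolve_left (Complex.ofReal_ne_zero.2 (eigval_neg hβ hg m).ne)
  have h2 : ∀ P : ℝ[X], ⟪polyState α hβ P, ψ⟫_ℂ = 0 := by
    intro P
    have hP : P ∈ Submodule.span ℝ (Set.range lag) := by
      rw [span_lag]
      exact Submodule.mem_top
    induction hP using Submodule.span_induction with
    | mem x h =>
      obtain ⟨m, rfl⟩ := h
      exact h1 m
    | zero =>
      have := polyState_smul (α := α) hβ 0 0
      rw [zero_smul, Complex.ofReal_zero, zero_smul] at this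
      rw [this, inner_zero_left]
    | add x y _ _ hx hy => rw [polyState_add, inner_add_left, hx, hy, add_zero]
    | smul c x _ hx => rw [polyState_smul, inner_smul_left, hx, mul_zero]
  rw [modeState_eq]
  exact h2 _

theorem norm_polyState_lag (hβ : 0 < β) (n : ℕ) : ‖polyState α hβ (lag n)‖
    = β / (√10 * √((n : ℝ) + 3)) * ‖modeState α hβ n‖ := by
  have h1 := norm_modeState_sq (α := α) hβ n
  have h2 : (√10 * √((n : ℝ) + 3)) ^ 2 = 10 * (n + 3) := by
    rw [mul_pow, Real.sq_sqrt (by norm_num), Real.sq_sqrt (by positivity)]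
  have h3 : 0 < √10 * √((n : ℝ) + 3) := by positivity
  refine (pow_left_inj₀ (norm_nonneg _) (by positivity) two_ne_zero).1 ?_
  rw [mul_pow, div_pow, h2, div_mul_eq_mul_div, h1]
  have : (n : ℝ) + 3 ≠ 0 := by positivity
  field_simp

/-- The eigenfunctions are slow: `‖(p⁰)⁻¹ L φ⁽ⁿ⁾‖` is small compared with `‖φ⁽ⁿ⁾‖`. -/
theorem norm_generator_modeState_le (hβ : 0 < β) (hg : 0 < g) (n : ℕ) :
    ‖(eigval α β g n : ℂ) • polyState α hβ (lag n)‖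
      ≤ (g * invDensity α β * β / (2 * √10)) / √((n : ℝ) + 3) * ‖modeState α hβ n‖ := by
  have hM := invDensity_pos (α := α) hβ
  have h3 : 0 < √((n : ℝ) + 3) := by positivity
  have h1 : |eigval α β g n| ≤ g * invDensity α β / 2 := by
    rw [abs_of_neg (eigval_neg hβ hg n), eigval, neg_mul, neg_neg]
    refine mul_le_of_le_one_right (by positivity) ?_
    rw [div_le_one (by positivity)]
    linarith
  rw [norm_smul, Complex.norm_real, Real.norm_eq_abs, norm_polyState_lag]
  calc |eigval α β g n| * (β / (√10 * √((n : ℝ) + 3)) * ‖modeState α hβ n‖)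
      ≤ g * invDensity α β / 2 * (β / (√10 * √((n : ℝ) + 3)) * ‖modeState α hβ n‖) := by gcongr
    _ = _ := by
      field_simp

/-! ### The non-hydrodynamic sector -/

open SelfAdjointRelation

instance : CompleteSpace (nonHydro α β) := by
  unfold nonHydro
  infer_instance

theorem isSelfAdj_part_nonHydro (hβ : 0 < β) (hg : 0 < g) :
    IsSelfAdj (part (generator α β g) (nonHydro α β)) :=
  (isSelfAdj_generator hβ hg).part _ fun _ h =>
      mem_generator_zero_of_mem_nonHydro_orthogonal hβ hg h

theorem isDissipative_part_nonHydro (hβ : 0 < β) (hg : 0 < g) :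
    IsDissipative (part (generator α β g) (nonHydro α β)) :=
  (isDissipative_generator hβ hg).part _

theorem exists_norm_generator_modeState_lt (hβ : 0 < β) (hg : 0 < g) {c : ℝ} (hc : 0 < c) :
    ∃ n : ℕ, ‖(eigval α β g n : ℂ) • polyState α hβ (lag n)‖ < c * ‖modeState α hβ n‖ := by
  have hM := invDensity_pos (α := α) hβ
  have hlim : Tendsto (fun n : ℕ => (g * invDensity α β * β / (2 * √10)) / √((n : ℝ) + 3))
      atTop (𝓝 0) := by
    refine Tendsto.const_div_atTop ?_ _
    refine Real.tendsto_sqrt_atTop.comp ?_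
    exact tendsto_atTop_add_const_right _ _ tendsto_natCast_atTop_atTop
  obtain ⟨n, hn⟩ := (hlim.eventually (gt_mem_nhds hc)).exists
  refine ⟨n, (norm_generator_modeState_le hβ hg n).trans_lt ?_⟩
  exact mul_lt_mul_of_pos_right hn (norm_pos_iff.2 (modeState_ne_zero hβ n))

/-- Within the non-hydrodynamic space there are arbitrarily slow states orthogonal to the kernel. -/
theorem exists_slow_mem_part (hβ : 0 < β) (hg : 0 < g) {c : ℝ} (hc : 0 < c) :
    ∃ x ∈ part (generator α β g) (nonHydro α β), x.1 ≠ 0 ∧ ‖x.2‖ < c * ‖x.1‖ ∧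
      ∀ ψ, (ψ, (0 : nonHydro α β)) ∈ part (generator α β g) (nonHydro α β) → ⟪ψ, x.1⟫_ℂ = 0 := by
  obtain ⟨n, hn⟩ := exists_norm_generator_modeState_lt (α := α) hβ hg hc
  have hmem := modeState_mem_generator (α := α) hβ g n
  refine ⟨(⟨_, modeState_mem_nonHydro hβ n⟩, ⟨_, mem_nonHydro_of_mem_generator hβ hg hmem⟩), hmem,
    fun h => modeState_ne_zero (α := α) hβ n (congrArg Subtype.val h), hn, fun ψ hψ => ?_⟩
  have := inner_modeState_eq_zero_of_kernel hβ hg (ψ := (ψ : State α β)) hψ n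
  rw [← inner_conj_symm, map_eq_zero] at this
  exact this

theorem isGLB_ratio (hβ : 0 < β) (hg : 0 < g) :
    IsGLB {r : ℝ | ∃ φ χ : State α β, φ ∈ nonHydro α β ∧ φ ≠ 0 ∧
      (φ, χ) ∈ generator α β g ∧ r = ‖χ‖ / ‖φ‖} 0 := by
  refine ⟨?_, fun b hb => ?_⟩
  · rintro r ⟨φ, χ, -, -, -, rfl⟩
    positivity
  · refine le_of_forall_pos_le_add fun c hc => ?_
    obtain ⟨n, hn⟩ := exists_norm_generator_modeState_lt (α := α) hβ hg hc
    have h1 := hb ⟨_, _, modeState_mem_nonHydro hβ n, modeState_ne_zero hβ n,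
      modeState_mem_generator hβ g n, rfl⟩
    rw [zero_add]
    refine h1.trans (div_le_of_le_mul₀ (norm_nonneg _) hc.le hn.le)

theorem isLUB_survival (hβ : 0 < β) (hg : 0 < g) {t : ℝ} (ht : 0 < t) :
    IsLUB {r : ℝ | ∃ u : ℝ → State α β, IsEvolution α β g u ∧
        u 0 ∈ nonHydro α β ∧ u 0 ≠ 0 ∧ r = ‖u t‖ / ‖u 0‖} 1 := by
  refine ⟨?_, fun b hb => ?_⟩
  · rintro r ⟨u, hu, -, -, rfl⟩
    exact div_le_one_of_le₀ (IsMildSolution.norm_le (isSelfAdj_generator hβ hg)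
      (isDissipative_generator hβ hg) hu ht.le) (norm_nonneg _)
  · -- solutions within the non-hydrodynamic space that decay at most like `e^{-tε}`
    have h1 : ∀ ε : ℝ, 0 < ε → Real.exp (-(t * ε)) ≤ b := by
      intro ε hε
      obtain ⟨u, hu, hu0, hut⟩ := exists_slow_mildSolution (isSelfAdj_part_nonHydro (α := α) hβ hg)
        (isDissipative_part_nonHydro hβ hg) (fun c hc => by
          obtain ⟨x, hx, hx0, hlt, -⟩ := exists_slow_mem_part (α := α) hβ hg hc
          exact ⟨x, hx, hx0, hlt⟩) ht.le hε
      refine le_trans ?_ (hb ⟨fun s => (u s : State α β), hu.of_part, (u 0).2,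
        fun h => hu0 (Subtype.ext h), rfl⟩)
      exact (le_div_iff₀ (norm_pos_iff.2 fun h => hu0 (Subtype.ext h))).2 hut
    have h2 : Tendsto (fun ε : ℝ => Real.exp (-(t * ε))) (𝓝[>] 0) (𝓝 1) := by
      have : Continuous fun ε : ℝ => Real.exp (-(t * ε)) := by fun_prop
      simpa using (this.tendsto 0).mono_left nhdsWithin_le_nhds
    exact le_of_tendsto h2 (eventually_nhdsWithin_of_forall h1)

theorem nonHydroSpectrum_eq :
    nonHydroSpectrum α β g = relSpectrum (part (generator α β g) (nonHydro α β)) := rfl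

end Collision

theorem mainTheorem3 (α β g : ℝ) (hβ : 0 < β) (hg : 0 < g) :
    -- `(p⁰)⁻¹ L` is self-adjoint and leaves the non-hydrodynamic space invariant
    MasslessGas.IsSelfAdjointGraph (MasslessGas.generator α β g) ∧
    (∀ φ χ : MasslessGas.State α β, φ ∈ MasslessGas.nonHydro α β →
      (φ, χ) ∈ MasslessGas.generator α β g → χ ∈ MasslessGas.nonHydro α β) ∧
    -- the states `φ⁽ⁿ⁾` are eigenvectors of `L` with the stated eigenvalues
    (∀ (n : ℕ) (p : MasslessGas.Mom),
      MasslessGas.collision α β g (MasslessGas.mode β n) p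
        = (MasslessGas.eigval α β g n : ℂ) * MasslessGas.mode β n p) ∧
    -- they are non-zero non-hydrodynamic states, and they satisfy the bound
    (∃ h : ∀ n : ℕ, MemLp (MasslessGas.mode β n) 2 (MasslessGas.eqMeasure α β),
      ∀ n : ℕ,
        (h n).toLp (MasslessGas.mode β n) ∈ MasslessGas.nonHydro α β ∧
        (h n).toLp (MasslessGas.mode β n) ≠ 0 ∧
        ∃ χ : MasslessGas.State α β,
          ((h n).toLp (MasslessGas.mode β n), χ) ∈ MasslessGas.generator α β g ∧
          ‖χ‖ / ‖(h n).toLp (MasslessGas.mode β n)‖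
            ≤ (g * MasslessGas.invDensity α β * β / (2 * Real.sqrt 10))
                / Real.sqrt ((n : ℝ) + 3)) ∧
    -- criterion (b)
    IsGLB {r : ℝ | ∃ φ χ : MasslessGas.State α β, φ ∈ MasslessGas.nonHydro α β ∧ φ ≠ 0 ∧
      (φ, χ) ∈ MasslessGas.generator α β g ∧ r = ‖χ‖ / ‖φ‖} 0 ∧
    -- there are non-hydrodynamic excitations that survive as long as one wants
    (∀ t : ℝ, 0 < t →
      IsLUB {r : ℝ | ∃ u : ℝ → MasslessGas.State α β, MasslessGas.IsEvolution α β g u ∧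
        u 0 ∈ MasslessGas.nonHydro α β ∧ u 0 ≠ 0 ∧ r = ‖u t‖ / ‖u 0‖} 1) ∧
    -- the non-hydrodynamic sector is gapless
    (∀ ε : ℝ, 0 < ε →
      ∃ z ∈ MasslessGas.nonHydroSpectrum α β g, z ≠ 0 ∧ ‖z‖ < ε) := by
  refine ⟨Collision.isSelfAdj_generator hβ hg,
    fun φ χ _ h => Collision.mem_nonHydro_of_mem_generator hβ hg h, Collision.collision_mode hβ g,
    ⟨Collision.memLp_mode hβ, fun n => ⟨Collision.modeState_mem_nonHydro hβ n,
      Collision.modeState_ne_zero hβ n, _, Collision.modeState_mem_generator hβ g n, ?_⟩⟩,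
    Collision.isGLB_ratio hβ hg, fun t ht => Collision.isLUB_survival hβ hg ht, fun ε hε => ?_⟩
  · exact (div_le_iff₀ (norm_pos_iff.2 (Collision.modeState_ne_zero hβ n))).2
      (Collision.norm_generator_modeState_le hβ hg n)
  · rw [Collision.nonHydroSpectrum_eq]
    exact SelfAdjointRelation.exists_mem_relSpectrum (Collision.isSelfAdj_part_nonHydro hβ hg)
      (Collision.isDissipative_part_nonHydro hβ hg)
      (fun c hc => Collision.exists_slow_mem_part hβ hg hc) hε
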